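/- For an oriented link $K\subset S^3$ let $\Delta_K(t)=\nabla_K(t^{-1/2}-t^{1/2})\in\mathbb Z[t^{\pm 1/2}]$ be its Conway-normalized Alexander polynomial, where $\nabla_K(z)$ is the Conway polynomial ($\nabla_{\rm unknot}=1$, $\nabla_{K_+}-\nabla_{K_-}=z\nabla_{K_0}$). Let $r$ be a prime, $s$ a positive integer and $n=r^s$. Let $L$ be an oriented $n$-periodic link in $S^3$, i.e. $L$ is disjoint from an unknotted axis $A$ and invariant, with its orientation, under the rotation of order $n$ about $A$. Let $L$ be given by a periodic diagram, i.e. a diagram in the plane that misses the point in which $A$ meets the plane and that is invariant under the rotation by $2\pi/n$ about this point; equivalently, a diagram obtained by stacking $n$ copies of an oriented tangle diagram $w$ (with the same sequence of oriented endpoints at its bottom and at its top) and joining the top to the bottom around the axis. Let $L'$ be the link obtained from $L$ by changing all the crossings in the $\mathbb Z_n$-orbit of a single crossing of this diagram (equivalently, by changing one crossing of $w$). For an integer $q$ let $L(q)$ and $L'(q)$ be the links obtained from $L$ and $L'$ by inserting $-q$ full twists (that is, $|q|$ full twists, right-handed if $q<0$ and left-handed if $q>0$) into all the strands that pass through a half-plane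 bounded by $A$; equivalently, by performing a $1/q$-surgery along $A$. Then $$\Delta_{L(q)}(t)\equiv\Delta_{L'(q)}(t)\pmod{(t^{r^s}-1,\;r)},$$ i.e. the difference lies in the ideal of $\mathbb Z[t^{\pm1/2}]$ generated by $t^{r^s}-1$ and $r$. -/

import Mathlib

open LaurentPolynomial

/-!
# Oriented link diagrams around an axis

A link that misses a fixed unknotted axis is drawn in the annulus around the axis.  Cutting the
annulus along a ray that meets the diagram transversally turns the diagram into a tangle diagram in
a rectangle, read counterclockwise around the axis ("upwards"), whose strand positions are numbered
from the axis outwards ("from left to right").  In general position the tangle diagram is a stack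
of elementary pieces: one crossing, one minimum or one maximum, next to vertical strands.

A row of strands is a list of Booleans: `true` is a strand oriented upwards (counterclockwise around
the axis), `false` a strand oriented downwards.
-/

/-- One elementary horizontal slice of an oriented tangle diagram, from the row of strands at its
bottom to the row at its top. -/
inductive Piece : List Bool → List Bool → Type
  /-- The two leftmost strands cross: the strand with orientation `x` runs between bottom left and
  top right, the one with orientation `y` between bottom right and top left. The former is the upper
  (over) strand iff `o = true`. -/
  | cross (x y o : Bool) (b : List Bool) : Piece (x :: y :: b) (y :: x :: b)
  /-- A local minimum to the left of all other strands. -/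
  | cup (x : Bool) (b : List Bool) : Piece b (x :: (!x) :: b)
  /-- A local maximum to the left of all other strands. -/
  | cap (x : Bool) (b : List Bool) : Piece (x :: (!x) :: b) b
  /-- Add a vertical strand on the left. -/
  | skip (x : Bool) {a b : List Bool} (p : Piece a b) : Piece (x :: a) (x :: b)

/-- Oriented tangle diagrams: stacks of elementary pieces, listed from bottom to top. -/
inductive Tangle : List Bool → List Bool → Type
  | nil (a : List Bool) : Tangle a a
  | cons {a b c : List Bool} (p : Piece a b) (w : Tangle b c) : Tangle a c

/-- The orientation of a strand as a sign. -/
def strandSign (x : Bool) : ℤ := if x then 1 else -1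

/-- The sign of a crossing `Piece.cross x y o b` (positive: turning the over direction
counterclockwise by less than a half-turn gives the under direction). -/
def crossingSign (x y o : Bool) : ℤ := if (x == y) == o then 1 else -1

/-- Two pieces that differ by a crossing change. -/
inductive Piece.CrossingChange : {a b : List Bool} → Piece a b → Piece a b → Prop
  | cross (x y o : Bool) (b : List Bool) :
      Piece.CrossingChange (.cross x y o b) (.cross x y (!o) b)
  | skip (x : Bool) {a b : List Bool} {p p' : Piece a b} (h : Piece.CrossingChange p p') :
      Piece.CrossingChange (.skip x p) (.skip x p')

namespace Tangle

/-- Two tangle diagrams that differ by changing exactly one crossing. -/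
inductive CrossingChange : {a b : List Bool} → Tangle a b → Tangle a b → Prop
  | head {a b c : List Bool} {p p' : Piece a b} (w : Tangle b c)
      (h : Piece.CrossingChange p p') : CrossingChange (.cons p w) (.cons p' w)
  | tail {a b c : List Bool} (p : Piece a b) {w w' : Tangle b c}
      (h : CrossingChange w w') : CrossingChange (.cons p w) (.cons p w')

/-- Stacking: `v` is put on top of `w`. -/
def comp : {a b c : List Bool} → Tangle a b → Tangle b c → Tangle a c
  | _, _, _, .nil _, v => v
  | _, _, _, .cons p w, v => .cons p (comp w v)

/-- The stack of `n` copies of `w`. -/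
def pow {a : List Bool} (w : Tangle a a) : ℕ → Tangle a a
  | 0 => .nil a
  | n + 1 => w.comp (pow w n)

/-- Add a vertical strand on the left of a tangle diagram. -/
def skip (x : Bool) : {a b : List Bool} → Tangle a b → Tangle (x :: a) (x :: b)
  | _, _, .nil a => .nil (x :: a)
  | _, _, .cons p w => .cons (.skip x p) (skip x w)

/-- The pure braid `σ₁ σ₂ ⋯ σₖ₋₁ σₖ₋₁ ⋯ σ₂ σ₁` (for `o = true`), in which the leftmost strand goes
once around all the others; its mirror image for `o = false`. -/
def encircle (o : Bool) (x : Bool) : (b : List Bool) → Tangle (x :: b) (x :: b)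
  | [] => .nil [x]
  | y :: b => .cons (.cross x y o b)
      (((encircle o x b).skip y).comp (.cons (.cross y x o b) (.nil (x :: y :: b))))

/-- One full twist on all strands: right-handed for `o = true` (strands that run in parallel cross
positively), left-handed for `o = false`. -/
def fullTwist (o : Bool) : (a : List Bool) → Tangle a a
  | [] => .nil []
  | x :: b => (encircle o x b).comp ((fullTwist o b).skip x)

/-- `m` full twists, that is `|m|` full twists, right-handed for `m ≥ 0` and left-handed for
`m < 0`. -/
def fullTwists (a : List Bool) (m : ℤ) : Tangle a a :=
  (fullTwist (decide (0 ≤ m)) a).pow m.natAbs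

end Tangle

/-!
# The Alexander polynomial

A tangle diagram `w : Tangle a a` stands for the oriented link diagram in the annulus that arises by
joining the top of `w` to its bottom around the axis.  Polynomials in `t^{±1/2}` are elements of
`ℤ[T;T⁻¹]`, where `T 1` is `t^{1/2}` and `T 2` is `t`.
-/

section Flow

variable {E : Type} [DecidableEq E]

/-- A strand without crossings between the edges `e` and `f`, directed from `e` to `f` iff `x`. -/
noncomputable def strandFlow (x : Bool) (e f : E) : Matrix E E ℤ[T;T⁻¹] :=
  if x then Matrix.single e f 1 else Matrix.single f e 1

/-- A crossing of sign `s` with incoming and outgoing over edges `oi`, `oo` and incoming and outgoing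
under edges `ui`, `uo`. The corresponding rows of `1 - flow` are the relations
`oi = oo` and `ui = t ^ s • uo + (1 - t ^ s) • oo` of the Alexander module, which
come from the Wirtinger presentation by Fox calculus. -/
noncomputable def crossingFlow (s : ℤ) (oi oo ui uo : E) : Matrix E E ℤ[T;T⁻¹] :=
  Matrix.single oi oo 1 + Matrix.single ui uo (T (2 * s)) + Matrix.single ui oo (1 - T (2 * s))

/-- The flow matrix of a piece whose bottom edges are `l` and whose top edges are `u`. -/
noncomputable def Piece.flow : {a b : List Bool} → Piece a b →
    (Fin a.length → E) → (Fin b.length → E) → Matrix E E ℤ[T;T⁻¹]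
  | _, _, .cross x y o b, l, u =>
      let l₀ := l ⟨0, Nat.succ_pos _⟩
      let l₁ := l ⟨1, Nat.succ_lt_succ (Nat.succ_pos _)⟩
      let u₀ := u ⟨0, Nat.succ_pos _⟩
      let u₁ := u ⟨1, Nat.succ_lt_succ (Nat.succ_pos _)⟩
      -- initial and final edge of the strands with orientation `x` and `y`
      let xi := if x then l₀ else u₁
      let xo := if x then u₁ else l₀
      let yi := if y then l₁ else u₀
      let yo := if y then u₀ else l₁
      (if o then crossingFlow (crossingSign x y o) xi xo yi yo
        else crossingFlow (crossingSign x y o) yi yo xi xo) +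
      ∑ i : Fin b.length, strandFlow (b.get i) (l i.succ.succ) (u i.succ.succ)
  | _, _, .cup x b, l, u =>
      strandFlow x (u ⟨1, Nat.succ_lt_succ (Nat.succ_pos _)⟩) (u ⟨0, Nat.succ_pos _⟩) +
      ∑ i : Fin b.length, strandFlow (b.get i) (l i) (u i.succ.succ)
  | _, _, .cap x b, l, u =>
      strandFlow x (l ⟨0, Nat.succ_pos _⟩) (l ⟨1, Nat.succ_lt_succ (Nat.succ_pos _)⟩) +
      ∑ i : Fin b.length, strandFlow (b.get i) (l i.succ.succ) (u i)
  | _, _, .skip x p, l, u =>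
      strandFlow x (l ⟨0, Nat.succ_pos _⟩) (u ⟨0, Nat.succ_pos _⟩) +
      p.flow (fun i => l i.succ) (fun i => u i.succ)

end Flow

/-- The sum of the signs of the crossings of a piece. -/
def Piece.writhe : {a b : List Bool} → Piece a b → ℤ
  | _, _, .cross x y o _ => crossingSign x y o
  | _, _, .cup _ _ => 0
  | _, _, .cap _ _ => 0
  | _, _, .skip _ p => p.writhe

/-- The signed number of points of a piece at which the oriented strand is directed horizontally to
the right: such a point counts `1` at a minimum (where the direction turns counterclockwise) and `-1`
at a maximum. -/
def Piece.turning : {a b : List Bool} → Piece a b → ℤ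
  | _, _, .cross _ _ _ _ => 0
  | _, _, .cup x _ => if x then 0 else 1
  | _, _, .cap x _ => if x then -1 else 0
  | _, _, .skip _ p => p.turning

/-- The winding number of a row of strands around the axis. -/
def winding (a : List Bool) : ℤ := (a.map strandSign).sum

/-- Twice the mean of the winding numbers of the diagram around the two regions to the left and to
the right of the `i`-th strand of a row. -/
def rowIndex (a : List Bool) (i : Fin a.length) : ℤ :=
  2 * winding (a.drop (i + 1)) + strandSign (a.get i)

namespace Tangle

/-- The edges of a tangle diagram: the points in which it meets the horizontal lines at the bottom,
between the pieces and at the top. -/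
def Edge : {a b : List Bool} → Tangle a b → Type
  | _, _, .nil a => Fin a.length
  | a, _, .cons _ w => Fin a.length ⊕ w.Edge

instance Edge.instFintype : {a b : List Bool} → (w : Tangle a b) → Fintype w.Edge
  | _, _, .nil a => inferInstanceAs (Fintype (Fin a.length))
  | a, _, .cons _ w =>
      letI := Edge.instFintype w
      inferInstanceAs (Fintype (Fin a.length ⊕ w.Edge))

instance Edge.instDecidableEq : {a b : List Bool} → (w : Tangle a b) → DecidableEq w.Edge
  | _, _, .nil a => inferInstanceAs (DecidableEq (Fin a.length))
  | a, _, .cons _ w =>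
      letI := Edge.instDecidableEq w
      inferInstanceAs (DecidableEq (Fin a.length ⊕ w.Edge))

/-- The edges at the bottom. -/
def bottom : {a b : List Bool} → (w : Tangle a b) → Fin a.length → w.Edge
  | _, _, .nil _, i => i
  | _, _, .cons _ _, i => Sum.inl i

/-- The edges at the top. -/
def top : {a b : List Bool} → (w : Tangle a b) → Fin b.length → w.Edge
  | _, _, .nil _, i => i
  | _, _, .cons _ w, i => Sum.inr (w.top i)

/-- The flow matrix of a tangle diagram, the sum of those of its pieces. -/
noncomputable def flow : {a b : List Bool} → (w : Tangle a b) → Matrix w.Edge w.Edge ℤ[T;T⁻¹]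
  | _, _, .nil _ => 0
  | a, _, .cons p w =>
      (p.flow (E := Fin a.length ⊕ w.Edge) Sum.inl (fun i => Sum.inr (w.bottom i)) +
        Matrix.fromBlocks 0 0 0 w.flow : Matrix (Fin a.length ⊕ w.Edge) (Fin a.length ⊕ w.Edge) _)

def writhe : {a b : List Bool} → Tangle a b → ℤ
  | _, _, .nil _ => 0
  | _, _, .cons p w => p.writhe + w.writhe

def turning : {a b : List Bool} → Tangle a b → ℤ
  | _, _, .nil _ => 0
  | _, _, .cons p w => p.turning + w.turning

/-- Twice the mean of the winding numbers of the diagram around the two regions next to an edge. -/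
def edgeIndex : {a b : List Bool} → (w : Tangle a b) → w.Edge → ℤ
  | _, _, .nil a => rowIndex a
  | a, _, .cons _ w => Sum.elim (rowIndex a) w.edgeIndex

variable {a : List Bool}

/-- The flow matrix of the closed diagram. -/
noncomputable def closedFlow (w : Tangle a a) : Matrix w.Edge w.Edge ℤ[T;T⁻¹] :=
  w.flow + ∑ i : Fin a.length, strandFlow (a.get i) (w.top i) (w.bottom i)

/-- The rotation number (total curvature divided by `2π`) of the closed diagram in the plane. -/
def rotation (w : Tangle a a) : ℤ := winding a + w.turning

/-- The Conway-normalized Alexander polynomial of the closed diagram, computed at the edge `e`: the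
principal minor of the Alexander matrix at `e`, multiplied by the power of `t^{1/2}` that makes it
independent of the edge and of the diagram of the link. -/
noncomputable def alexanderAt (w : Tangle a a) (e : w.Edge) : ℤ[T;T⁻¹] :=
  T (w.rotation - w.writhe - w.edgeIndex e) *
    ((1 - w.closedFlow).submatrix (Subtype.val : {f // f ≠ e} → w.Edge) Subtype.val).det

open Classical in
/-- The Conway-normalized Alexander polynomial `Δ(t) = ∇(t^{-1/2} - t^{1/2})` of the oriented link
given by closing `w` around the axis. It is `1` for the unknot, and
`Δ₊ - Δ₋ = (t^{-1/2} - t^{1/2}) Δ₀` for diagrams that differ at one crossing only, where they have a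
positive crossing, a negative crossing and the oriented smoothing. (The value `0` for the empty
link is a convention.) -/
noncomputable def alexander (w : Tangle a a) : ℤ[T;T⁻¹] :=
  if h : Nonempty w.Edge then w.alexanderAt (Classical.choice h) else 0

/-- The diagram with `n`-fold rotational symmetry around the axis whose fundamental domain is `w`,
with `m` full twists added to the strands that go around the axis. -/
def periodicTwisted (w : Tangle a a) (n : ℕ) (m : ℤ) : Tangle a a :=
  (w.pow n).comp (fullTwists a m)

end Tangle

/-!
# Determinants of flow matrices
-/

section LinearAlgebra

open Matrix

variable {R : Type*} [CommRing R] {ι κ E E' : Type*}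

/-- The matrix of a map between index sets: the `i`-th row is the unit vector at `f i`. -/
def indicator (R : Type*) [CommRing R] [DecidableEq E] (f : ι → E) : Matrix ι E R :=
  Matrix.of fun i e => if f i = e then 1 else 0

section

variable [DecidableEq E] [DecidableEq E']

theorem indicator_apply (f : ι → E) (i : ι) (e : E) :
    indicator R f i e = if f i = e then 1 else 0 := rfl

theorem indicator_mul [Fintype E] (f : ι → E) (A : Matrix E κ R) :
    indicator R f * A = A.submatrix f id := by
  ext i j
  simp [Matrix.mul_apply, indicator_apply]

theorem mul_indicator_transpose [Fintype E] (f : ι → E) (A : Matrix κ E R) :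
    A * (indicator R f)ᵀ = A.submatrix id f := by
  ext i j
  simp [Matrix.mul_apply, indicator_apply]

theorem indicator_comp [Fintype E] (g : E → E') (f : ι → E) :
    indicator R (g ∘ f) = indicator R f * indicator R g := by
  rw [indicator_mul]; rfl

theorem indicator_id : indicator R (id : E → E) = 1 := by
  ext i j; simp [indicator_apply, Matrix.one_apply]

theorem indicator_mul_transpose_self [Fintype E] [DecidableEq ι] {f : ι → E}
    (hf : Function.Injective f) : indicator R f * (indicator R f)ᵀ = 1 := by
  ext i j
  simp [indicator_mul, indicator_apply, Matrix.one_apply, hf.eq_iff, eq_comm]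

theorem indicator_mul_transpose_of_ne [Fintype E] {f : ι → E} {g : κ → E}
    (h : ∀ i j, f i ≠ g j) : indicator R f * (indicator R g)ᵀ = 0 := by
  ext i j
  simp [indicator_mul, indicator_apply, (h i j).symm]

/-- Contracting strands of a flow matrix: if the rows in `K` of the flow are strands `S` that lead
to edges outside of `K`, then every edge in `K` can be identified with the end of its strand. -/
theorem det_contract [Fintype E] [Fintype E'] (π : E → E') (K : E → Prop) [DecidablePred K]
    (S F : Matrix E E R)
    (hπ : Function.Bijective (fun x : {x // ¬K x} => π x))
    (hS0 : ∀ x, ¬K x → S x = 0)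
    (hS1 : ∀ x, K x → ∃ y, ¬K y ∧ π y = π x ∧ S x = Pi.single y 1)
    (hF : ∀ x, K x → F x = 0) :
    (1 - F - S).det = (1 - (indicator R π)ᵀ * F * indicator R π).det := by
  classical
  have hinj : ∀ x y, ¬K x → ¬K y → π x = π y → x = y := fun x y hx hy h =>
    congrArg Subtype.val (@hπ.1 ⟨x, hx⟩ ⟨y, hy⟩ h)
  have hSK : ∀ x y, K x → ¬K y → S x y = if π x = π y then 1 else 0 := by
    intro x y hx hy
    obtain ⟨z, hz, hzx, hs⟩ := hS1 x hx
    rw [hs, Pi.single_apply]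
    by_cases h : y = z
    · subst h; simp [hzx]
    · rw [if_neg h, if_neg]
      intro h'; exact h (hinj _ _ hy hz (by rw [hzx, h']))
  have hSKK : ∀ x y, K x → K y → S x y = 0 := by
    intro x y hx hy
    obtain ⟨z, hz, hzx, hs⟩ := hS1 x hx
    rw [hs, Pi.single_apply, if_neg]
    rintro rfl; exact hz hy
  -- With the indices in K first, the upper left block is the identity, since strands lead out of K
  -- and F vanishes on these rows. The determinant is therefore that of the Schur complement.
  have hblock : (1 - F - S).submatrix (Equiv.sumCompl K) (Equiv.sumCompl K) =
      fromBlocks 1 (-(S.submatrix (fun x : {x // K x} => x.1) (fun y : {x // ¬K x} => y.1)))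
        (-(F.submatrix (fun x : {x // ¬K x} => x.1) (fun y : {x // K x} => y.1)))
        (1 - F.submatrix (fun x : {x // ¬K x} => x.1) (fun y : {x // ¬K x} => y.1)) := by
    ext x y
    rcases x with ⟨x, hx⟩ | ⟨x, hx⟩ <;> rcases y with ⟨y, hy⟩ | ⟨y, hy⟩
    · simp [hF x hx, hSKK x y hx hy, Matrix.one_apply]
    · have : x ≠ y := by rintro rfl; exact hy hx
      simp [hF x hx, this]
    · have : x ≠ y := by rintro rfl; exact hx hy
      simp [hS0 x hx, this]
    · simp [hS0 x hx, Matrix.one_apply]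
  rw [← det_submatrix_equiv_self (Equiv.sumCompl K) (1 - F - S), hblock, det_fromBlocks_one₁₁,
    ← det_submatrix_equiv_self (Equiv.ofBijective _ hπ)
      (1 - (indicator R π)ᵀ * F * indicator R π)]
  congr 1
  ext ⟨x, hx⟩ ⟨y, hy⟩
  -- Each fibre of π contains exactly one edge outside K, and the rows of F in K are zero.
  have hrow : ∀ b, ((indicator R π)ᵀ * F) (π x) b = F x b := by
    intro b
    simp only [Matrix.mul_apply, transpose_apply, indicator_apply, ite_mul, one_mul, zero_mul]
    rw [Finset.sum_eq_single x]
    · simp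
    · intro a _ ha
      by_cases hK : K a
      · simp [hF a hK]
      · rw [if_neg]
        intro h; exact ha (hinj _ _ hK hx h)
    · simp
  have hone : (1 : Matrix {x // ¬K x} {x // ¬K x} R) ⟨x, hx⟩ ⟨y, hy⟩ =
      (1 : Matrix E' E' R) (π x) (π y) := by
    simp only [Matrix.one_apply, Subtype.mk.injEq]
    by_cases h : x = y
    · simp [h]
    · rw [if_neg h, if_neg fun h' => h (hinj _ _ hx hy h')]
  simp only [Matrix.neg_mul, Matrix.mul_neg, neg_neg, Matrix.sub_apply, submatrix_apply, hone,
    Equiv.ofBijective_apply]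
  rw [sub_sub]
  congr 1
  rw [Matrix.mul_apply (M := (indicator R π)ᵀ * F)]
  simp only [hrow, indicator_apply, mul_ite, mul_one, mul_zero]
  rw [← Fintype.sum_subtype_add_sum_subtype K, add_comm]
  simp only [Matrix.mul_apply, submatrix_apply]
  congr 1
  · exact Finset.sum_congr rfl fun a _ => by rw [hSK a.1 y a.2 hy]; simp
  · rw [Finset.sum_eq_single ⟨y, hy⟩]
    · simp
    · intro b _ hb
      rw [if_neg]
      intro h; exact hb (Subtype.ext (hinj _ _ b.2 hy h))
    · simp

end

/-- Two rows of a determinant enter only through their exterior product. -/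
theorem det_updateRow_skein [Fintype E] [DecidableEq E] (M : Matrix E E R) {i j : E} (hij : i ≠ j)
    (a b c d : E → R) (p q : R) (hpq : p * q = 1) :
    q * ((M.updateRow i (a - c)).updateRow j (b - (p * p) • d - (1 - p * p) • c)).det -
      p * ((M.updateRow i (a - (q * q) • c - (1 - q * q) • d)).updateRow j (b - d)).det =
      (q - p) * ((M.updateRow i (a - d)).updateRow j (b - c)).det := by
  -- In the application, a and b come from the rest of the diagram, c and d are the unit vectors of
  -- the outgoing edges, and p = t^{s/2}. Both rows are expanded; the determinant is alternating in
  -- them, so a scalar identity modulo pq = 1 is left.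
  have add₂ : ∀ u v w, ((M.updateRow i u).updateRow j (v + w)).det =
      ((M.updateRow i u).updateRow j v).det + ((M.updateRow i u).updateRow j w).det :=
    fun u v w => det_updateRow_add _ _ _ _
  have smul₂ : ∀ u v (r : R), ((M.updateRow i u).updateRow j (r • v)).det =
      r * ((M.updateRow i u).updateRow j v).det := fun u v r => det_updateRow_smul _ _ _ _
  have comm : ∀ u v, (M.updateRow i u).updateRow j v = (M.updateRow j v).updateRow i u :=
    fun u v => by
      ext x y
      by_cases hx : x = j
      · subst hx; simp [updateRow_apply, hij.symm]
      · by_cases hx' : x = i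
        · subst hx'; simp [updateRow_apply, hij]
        · simp [updateRow_apply, hx, hx']
  have add₁ : ∀ u u' v, ((M.updateRow i (u + u')).updateRow j v).det =
      ((M.updateRow i u).updateRow j v).det + ((M.updateRow i u').updateRow j v).det := by
    intro u u' v; simp only [comm]; exact det_updateRow_add _ _ _ _
  have smul₁ : ∀ u v (r : R), ((M.updateRow i (r • u)).updateRow j v).det =
      r * ((M.updateRow i u).updateRow j v).det := by
    intro u v r; simp only [comm]; exact det_updateRow_smul _ _ _ _
  have alt : ∀ u, ((M.updateRow i u).updateRow j u).det = 0 := fun u =>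
    det_zero_of_row_eq hij (by
      rw [updateRow_ne hij, updateRow_self, updateRow_self])
  have anti : ((M.updateRow i d).updateRow j c).det = -((M.updateRow i c).updateRow j d).det := by
    have := alt (c + d)
    rw [add₁, add₂, add₂, alt, alt] at this
    linear_combination this
  have sub₂ : ∀ u v w, ((M.updateRow i u).updateRow j (v - w)).det =
      ((M.updateRow i u).updateRow j v).det - ((M.updateRow i u).updateRow j w).det := by
    intro u v w
    rw [sub_eq_add_neg, ← neg_one_smul R w, add₂, smul₂]; ring
  have sub₁ : ∀ u u' v, ((M.updateRow i (u - u')).updateRow j v).det =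
      ((M.updateRow i u).updateRow j v).det - ((M.updateRow i u').updateRow j v).det := by
    intro u u' v
    rw [sub_eq_add_neg, ← neg_one_smul R u', add₁, smul₁]; ring
  simp only [sub₁, sub₂, smul₁, smul₂, alt, anti]
  linear_combination
    ((p - q) * ((M.updateRow i c).updateRow j d).det - p * ((M.updateRow i a).updateRow j d).det +
      p * ((M.updateRow i a).updateRow j c).det + q * ((M.updateRow i c).updateRow j b).det -
      q * ((M.updateRow i d).updateRow j b).det) * hpq

end LinearAlgebra

/-! ### Moving a rank-one perturbation of a scalar across part of a linear system -/

section LinearAlgebra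

open Matrix

variable {R : Type*} [CommRing R] {ι κ E E' : Type*}

/-- If a rank-one perturbation `C` of a scalar matrix can be moved across a part `J` of a system of
linear equations, moving it does not change the determinant. The equations are those of `A`, the
equations `t₁ = C b₁` or `t₁ = b₁` in the rows `r₁`, and `t₂ = b₂` or `t₂ = C b₂` in the rows
`r₂`. -/
theorem det_move [Fintype κ] [DecidableEq κ] [Fintype E] [DecidableEq E]
    (A J : Matrix E E R) (r₁ r₂ t₁ b₁ t₂ b₂ r : Matrix κ E R) (S : Matrix κ κ R)
    (one : Matrix κ Unit R) (v : Matrix E Unit R) (ℓ : Matrix Unit κ R) (lam : Matrix Unit E R)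
    (α α' c : R) (hα : α * α' = 1) (hS : S * S = 1)
    (h₁₁ : r₁ * r₁ᵀ = 1) (h₂₂ : r₂ * r₂ᵀ = 1) (h₁₂ : r₁ * r₂ᵀ = 0) (h₂₁ : r₂ * r₁ᵀ = 0)
    (h₁A : r₁ * A = 0) (h₂A : r₂ * A = 0) (hJJ : J * J = J) (hJA : J * A = A * J)
    (ht₁ : t₁ * J = t₁) (hb₁ : b₁ * J = 0) (ht₂ : t₂ * J = 0) (hb₂ : b₂ * J = b₂)
    (hJr : J * (r₁ᵀ * r₁ + r₂ᵀ * r₂) = rᵀ * r)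
    (hrJ : (r₁ᵀ * r₁ + r₂ᵀ * r₂) * J = rᵀ * r) (hrr : r * rᵀ = 1)
    (hAv : A * v = 0) (hJv : J * v = v) (htv : t₁ * v = one) (hbv : b₂ * v = one)
    (hlA : lam * A = ℓ * (b₂ - t₁)) (hl₁ : lam * r₁ᵀ = 0) (hl₂ : lam * r₂ᵀ = 0)
    (hone : α • (1 : Matrix Unit Unit R) + c • (ℓ * one) = 1) (C : Matrix κ κ R)
    (hC : C = α • (1 : Matrix κ κ R) + c • (one * ℓ)) :
    (A + r₁ᵀ * (S * (t₁ - C * b₁)) + r₂ᵀ * (S * (t₂ - b₂))).det =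
      (A + r₁ᵀ * (S * (t₁ - b₁)) + r₂ᵀ * (S * (t₂ - C * b₂))).det := by
  set P := r₁ᵀ * r₁ + r₂ᵀ * r₂ with hP
  have hPr₁ : P * r₁ᵀ = r₁ᵀ := by
    rw [hP, Matrix.add_mul, Matrix.mul_assoc, Matrix.mul_assoc, h₁₁, h₂₁]; simp
  have hPr₂ : P * r₂ᵀ = r₂ᵀ := by
    rw [hP, Matrix.add_mul, Matrix.mul_assoc, Matrix.mul_assoc, h₁₂, h₂₂]; simp
  have hPA : P * A = 0 := by
    rw [hP, Matrix.add_mul, Matrix.mul_assoc, Matrix.mul_assoc, h₁A, h₂A]; simp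
  have hPP : P * P = P := by
    conv_lhs => rw [hP, Matrix.mul_add, ← Matrix.mul_assoc, ← Matrix.mul_assoc, ← hP, hPr₁, hPr₂]
  -- Q projects to the equations of the part J that are not in the rows `r₁`, `r₂`. Multiplying them
  -- by α compensates for the scaling of the variables of J.
  set Q := J * (1 - P) with hQ
  have hQr₁ : Q * r₁ᵀ = 0 := by
    rw [hQ, Matrix.mul_assoc, Matrix.sub_mul, hPr₁]; simp
  have hQr₂ : Q * r₂ᵀ = 0 := by
    rw [hQ, Matrix.mul_assoc, Matrix.sub_mul, hPr₂]; simp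
  have hQA : Q * A = J * A := by
    rw [hQ, Matrix.mul_assoc, Matrix.sub_mul, hPA]; simp
  -- Here C b₂ is replaced by α b₂ + c·one·(ℓ t₁). This is a row operation, because the combination
  -- `lam` of the equations says that ℓ b₂ = ℓ t₁.
  set Y := A + r₁ᵀ * (S * (t₁ - b₁)) + r₂ᵀ * (S * (t₂ - α • b₂ - c • (one * (ℓ * t₁)))) with hY
  have hlM : lam * (A + r₁ᵀ * (S * (t₁ - b₁)) + r₂ᵀ * (S * (t₂ - C * b₂))) =
      ℓ * (b₂ - t₁) := by
    rw [Matrix.mul_add, Matrix.mul_add, ← Matrix.mul_assoc lam, ← Matrix.mul_assoc lam, hl₁, hl₂,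
      hlA]
    simp
  have step₃ : (1 + r₂ᵀ * (c • (S * (one * lam)))) *
      (A + r₁ᵀ * (S * (t₁ - b₁)) + r₂ᵀ * (S * (t₂ - C * b₂))) = Y := by
    have h1 : r₂ᵀ * (c • (S * (one * lam))) *
        (A + r₁ᵀ * (S * (t₁ - b₁)) + r₂ᵀ * (S * (t₂ - C * b₂))) =
        r₂ᵀ * (S * (c • (one * (ℓ * (b₂ - t₁))))) := by
      rw [← hlM]
      simp only [Matrix.mul_smul, Matrix.smul_mul, Matrix.mul_assoc]
    rw [Matrix.add_mul, Matrix.one_mul, h1, hY, add_assoc, ← Matrix.mul_add, ← Matrix.mul_add]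
    congr 3
    rw [hC]
    simp only [Matrix.add_mul, Matrix.smul_mul, Matrix.one_mul, Matrix.mul_sub, Matrix.mul_assoc,
      smul_sub]
    abel
  have hQY : Q * Y = J * A := by
    rw [hY, Matrix.mul_add, Matrix.mul_add, ← Matrix.mul_assoc Q, ← Matrix.mul_assoc Q, hQr₁, hQr₂,
      hQA]
    simp
  have step₂ : (1 + (α - 1) • Q) * Y = Y + (α - 1) • (J * A) := by
    rw [Matrix.add_mul, Matrix.one_mul, Matrix.smul_mul, hQY]
  have hr₁Y : r₁ * (Y + (α - 1) • (J * A)) = S * (t₁ - b₁) := by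
    rw [Matrix.mul_add, Matrix.mul_smul, hJA, ← Matrix.mul_assoc r₁, h₁A, hY, Matrix.mul_add,
      Matrix.mul_add, ← Matrix.mul_assoc r₁, ← Matrix.mul_assoc r₁, h₁₁, h₁₂, h₁A]
    simp
  have step₁ : (1 + r₁ᵀ * ((S * C * S - 1) * r₁)) * (Y + (α - 1) • (J * A)) =
      A + (α - 1) • (J * A) + r₁ᵀ * (S * (C * (t₁ - b₁))) +
        r₂ᵀ * (S * (t₂ - α • b₂ - c • (one * (ℓ * t₁)))) := by
    have h2 : (S * C * S - 1) * (S * (t₁ - b₁)) = S * (C * (t₁ - b₁)) - S * (t₁ - b₁) := by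
      rw [Matrix.sub_mul, Matrix.one_mul, Matrix.mul_assoc, ← Matrix.mul_assoc S S, hS,
        Matrix.one_mul, Matrix.mul_assoc]
    rw [Matrix.add_mul, Matrix.one_mul, Matrix.mul_assoc, Matrix.mul_assoc, hr₁Y, h2, hY,
      Matrix.mul_sub r₁ᵀ (S * (C * (t₁ - b₁))) (S * (t₁ - b₁))]
    abel
  -- The change of variables that lets C act on the whole part J: its variables are scaled by α and
  -- shifted by c·(ℓ t₁) times the constant solution `v`; the variables outside J stay as they are.
  set Z := 1 + (α - 1) • J + c • (v * (ℓ * t₁)) with hZ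
  have hrhs : (A + r₁ᵀ * (S * (t₁ - C * b₁)) + r₂ᵀ * (S * (t₂ - b₂))) * Z =
      A + (α - 1) • (J * A) + r₁ᵀ * (S * (C * (t₁ - b₁))) +
        r₂ᵀ * (S * (t₂ - α • b₂ - c • (one * (ℓ * t₁)))) := by
    have hb₁v : b₁ * v = 0 := by rw [← hJv, ← Matrix.mul_assoc, hb₁, Matrix.zero_mul]
    have ht₂v : t₂ * v = 0 := by rw [← hJv, ← Matrix.mul_assoc, ht₂, Matrix.zero_mul]
    have hAZ : A * Z = A + (α - 1) • (J * A) := by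
      rw [hZ, Matrix.mul_add, Matrix.mul_add, Matrix.mul_smul, Matrix.mul_smul,
        ← Matrix.mul_assoc A v, hAv, hJA]
      simp
    have hb₁Z : b₁ * Z = b₁ := by
      rw [hZ, Matrix.mul_add, Matrix.mul_add, Matrix.mul_smul, Matrix.mul_smul,
        ← Matrix.mul_assoc b₁ v, hb₁v, hb₁]
      simp
    have ht₂Z : t₂ * Z = t₂ := by
      rw [hZ, Matrix.mul_add, Matrix.mul_add, Matrix.mul_smul, Matrix.mul_smul,
        ← Matrix.mul_assoc t₂ v, ht₂v, ht₂]
      simp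
    have ht₁Z : t₁ * Z = C * t₁ := by
      rw [hZ, Matrix.mul_add, Matrix.mul_add, Matrix.mul_smul, Matrix.mul_smul,
        ← Matrix.mul_assoc t₁ v, htv, ht₁, hC, Matrix.add_mul, Matrix.smul_mul, Matrix.smul_mul,
        Matrix.mul_assoc, sub_smul]
      simp
    have hb₂Z : b₂ * Z = α • b₂ + c • (one * (ℓ * t₁)) := by
      rw [hZ, Matrix.mul_add, Matrix.mul_add, Matrix.mul_smul, Matrix.mul_smul,
        ← Matrix.mul_assoc b₂ v, hbv, hb₂, sub_smul]
      simp
    rw [Matrix.add_mul, Matrix.add_mul, hAZ, Matrix.mul_assoc, Matrix.mul_assoc, Matrix.mul_assoc,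
      Matrix.mul_assoc, Matrix.sub_mul, Matrix.sub_mul, Matrix.mul_assoc C, hb₁Z, ht₂Z, ht₁Z, hb₂Z,
      Matrix.mul_sub C, sub_sub]
  have key : (A + r₁ᵀ * (S * (t₁ - C * b₁)) + r₂ᵀ * (S * (t₂ - b₂))) * Z =
      (1 + r₁ᵀ * ((S * C * S - 1) * r₁)) * ((1 + (α - 1) • Q) *
        ((1 + r₂ᵀ * (c • (S * (one * lam)))) *
          (A + r₁ᵀ * (S * (t₁ - b₁)) + r₂ᵀ * (S * (t₂ - C * b₂))))) := by
    rw [step₃, step₂, step₁, hrhs]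
  have hdet₃ : (1 + r₂ᵀ * (c • (S * (one * lam)))).det = 1 := by
    rw [det_one_add_mul_comm, Matrix.smul_mul, Matrix.mul_assoc, Matrix.mul_assoc, hl₂]
    simp
  have hdetS : S.det * S.det = 1 := by rw [← det_mul, hS, det_one]
  have hdet₁ : (1 + r₁ᵀ * ((S * C * S - 1) * r₁)).det = C.det := by
    rw [det_one_add_mul_comm, Matrix.mul_assoc, h₁₁, Matrix.mul_one, add_sub_cancel, det_mul,
      det_mul]
    linear_combination C.det * hdetS
  -- By `hone`, α + c·ℓ(one) = 1 (C fixes the constants), so this factor equals α⁻¹; it is the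
  -- rank-one contribution to both det C and det Z.
  set g := (1 + (α' * c) • (ℓ * one)).det with hg
  have hgα : g = α' := by
    have : 1 + (α' * c) • (ℓ * one) = α' • (1 : Matrix Unit Unit R) := by
      conv_rhs => rw [← hone]
      rw [smul_add, smul_smul, smul_smul, mul_comm α' α, hα, one_smul]
    rw [hg, this, det_smul]; simp
  have hdetC : C.det = (α • (1 : Matrix κ κ R)).det * g := by
    have : C = (α • (1 : Matrix κ κ R)) * (1 + ((α' * c) • one) * ℓ) := by
      rw [hC, Matrix.mul_add, Matrix.mul_one, Matrix.smul_mul, Matrix.one_mul, Matrix.smul_mul,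
        smul_smul, ← mul_assoc, hα, one_mul]
    rw [this, det_mul, det_one_add_mul_comm, Matrix.mul_smul]
  have hdetZ : Z.det = (1 + (α - 1) • J).det * g := by
    have : Z = (1 + (α - 1) • J) * (1 + ((α' * c) • v) * (ℓ * t₁)) := by
      rw [Matrix.mul_add, Matrix.mul_one, ← Matrix.mul_assoc, Matrix.add_mul, Matrix.one_mul,
        Matrix.smul_mul, Matrix.mul_smul, hJv, smul_smul, ← add_smul, Matrix.smul_mul, hZ]
      congr 2
      linear_combination (-c) * hα
    rw [this, det_mul, det_one_add_mul_comm, Matrix.mul_smul, Matrix.mul_assoc, htv]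
  have hdetJ : (1 + (α - 1) • J).det = (1 + (α - 1) • Q).det * (α • (1 : Matrix κ κ R)).det := by
    have hQr : Q * (rᵀ * r) = 0 := by
      rw [hQ, ← hrJ, Matrix.mul_assoc, ← Matrix.mul_assoc (1 - P), Matrix.sub_mul, Matrix.one_mul,
        hPP]
      simp
    have : 1 + (α - 1) • J = (1 + (α - 1) • Q) * (1 + ((α - 1) • rᵀ) * r) := by
      rw [Matrix.mul_add, Matrix.mul_one, Matrix.smul_mul, Matrix.mul_smul, Matrix.add_mul,
        Matrix.one_mul, Matrix.smul_mul, hQr, ← hJr, hQ, Matrix.mul_sub, Matrix.mul_one, smul_sub, smul_zero, add_zero]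
      abel
    rw [this, det_mul, det_one_add_mul_comm, Matrix.mul_smul, hrr]
    congr 2
    rw [sub_smul, one_smul]; abel
  -- The column operation and the row operations have equal determinants: J consists of Q and one
  -- connection row per strand. These rows contribute det(α·1), the scalar factor of det C.
  have hZC : Z.det = (1 + (α - 1) • Q).det * C.det := by
    rw [hdetZ, hdetJ, hdetC, mul_assoc]
  have hunit : IsUnit Z.det := by
    rw [hdetZ, hgα]
    refine IsUnit.mul (IsUnit.of_mul_eq_one (1 + (α' - 1) • J).det ?_)
      (IsUnit.of_mul_eq_one α (by rw [mul_comm, hα]))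
    have hmul : (1 + (α - 1) • J) * (1 + (α' - 1) • J) = 1 := by
      rw [Matrix.mul_add, Matrix.mul_one, Matrix.mul_smul, Matrix.add_mul, Matrix.one_mul,
        Matrix.smul_mul, hJJ]
      have : 1 + (α - 1) • J + (α' - 1) • (J + (α - 1) • J) = 1 + (α * α' - 1) • J := by module
      rw [this, hα, sub_self, zero_smul, add_zero]
    rw [← det_mul, hmul, det_one]
  have hfin := congrArg det key
  rw [det_mul, det_mul, det_mul, det_mul, hdet₁, hdet₃, one_mul, ← mul_assoc,
    mul_comm C.det, ← hZC, mul_comm] at hfin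
  exact hunit.mul_left_cancel hfin

end LinearAlgebra

/-! ### Connections t = C b between two rows of edges -/

section LinearAlgebra

open Matrix

variable {R : Type*} [CommRing R] {ι κ E E' : Type*}

/-- The edge at which the strand `i` enters the region between the edges `t` below and `b` above. -/
def port (x : κ → Bool) (t b : κ → E) (i : κ) : E := if x i then t i else b i

/-- The diagonal matrix of the orientations of strands. -/
def orient (R : Type*) [CommRing R] [DecidableEq κ] (x : κ → Bool) : Matrix κ κ R :=
  diagonal fun i => if x i then 1 else -1

/-- The flow matrix of the equations `t = C b`, in the rows of the edges at which the strands
leave `t` or `b`. -/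
def conn [Fintype κ] [DecidableEq κ] [DecidableEq E] (x : κ → Bool) (t b : κ → E)
    (C : Matrix κ κ R) : Matrix E E R :=
  (indicator R (port x t b))ᵀ *
    (indicator R (port x t b) - orient R x * (indicator R t - C * indicator R b))

theorem orient_mul_self [Fintype κ] [DecidableEq κ] (x : κ → Bool) :
    orient R x * orient R x = 1 := by
  rw [orient, diagonal_mul_diagonal, ← diagonal_one]
  congr 1
  ext i
  split_ifs <;> simp

theorem conn_push [Fintype κ] [DecidableEq κ] [Fintype E] [DecidableEq E] [DecidableEq E']
    (π : E → E') (x : κ → Bool) (t b : κ → E) (C : Matrix κ κ R) :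
    (indicator R π)ᵀ * conn x t b C * indicator R π = conn x (π ∘ t) (π ∘ b) C := by
  have h : port x (π ∘ t) (π ∘ b) = π ∘ port x t b := by
    ext i; simp only [port, Function.comp_apply]; split_ifs <;> rfl
  rw [conn, conn, h, indicator_comp, indicator_comp, indicator_comp, transpose_mul]
  simp only [Matrix.mul_assoc, Matrix.sub_mul, Matrix.mul_sub]

theorem conn_reindex [Fintype κ] [DecidableEq κ] [Fintype ι] [DecidableEq ι] [DecidableEq E]
    (e : ι ≃ κ) (x : κ → Bool) (t b : κ → E) (C : Matrix κ κ R) :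
    conn (x ∘ e) (t ∘ e) (b ∘ e) (C.submatrix e e) = conn x t b C := by
  have h : ∀ f : κ → E, indicator R (f ∘ e) = (indicator R f).submatrix e id := fun f => rfl
  have hp : port (x ∘ e) (t ∘ e) (b ∘ e) = port x t b ∘ e := rfl
  have hs : orient R (x ∘ e) = (orient R x).submatrix e e := by
    simp only [orient, submatrix_diagonal_equiv]; rfl
  have hsub : ∀ A B : Matrix κ E R, A.submatrix e id - B.submatrix e id = (A - B).submatrix e id :=
    fun _ _ => rfl
  simp only [conn, hp, h, hs, transpose_submatrix, submatrix_mul_equiv, hsub, submatrix_id_id]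

theorem conn_apply_of_ne [Fintype κ] [DecidableEq κ] [DecidableEq E] (x : κ → Bool) (t b : κ → E)
    (C : Matrix κ κ R) (e : E) (h : ∀ i, port x t b i ≠ e) : conn x t b C e = 0 := by
  ext f
  rw [conn, Matrix.mul_apply]
  exact Finset.sum_eq_zero fun i _ => by simp [indicator_apply, h i]

/-- A connection without twists consists of strands. -/
theorem conn_one [Fintype κ] [DecidableEq κ] [DecidableEq E] (x : κ → Bool) (t b : κ → E) :
    conn x t b (1 : Matrix κ κ R) =
      ∑ i, if x i then Matrix.single (t i) (b i) 1 else Matrix.single (b i) (t i) 1 := by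
  ext e f
  rw [conn, Matrix.mul_apply, Matrix.sum_apply]
  refine Finset.sum_congr rfl fun i _ => ?_
  rw [Matrix.one_mul, orient, Matrix.sub_apply, diagonal_mul]
  simp only [transpose_apply, indicator_apply, Matrix.sub_apply, port]
  by_cases hx : x i = true <;> simp [hx, Matrix.single_apply] <;> split_ifs <;> simp_all

theorem conn_one_row [Fintype κ] [DecidableEq κ] [DecidableEq E] {x : κ → Bool} {t b : κ → E}
    (h : Function.Injective (port x t b)) (i : κ) :
    conn x t b (1 : Matrix κ κ R) (port x t b i) = Pi.single (if x i then b i else t i) 1 := by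
  ext f
  rw [conn, Matrix.mul_apply, Finset.sum_eq_single i]
  · rw [Matrix.one_mul, orient, Matrix.sub_apply, diagonal_mul]
    simp only [transpose_apply, indicator_apply, Matrix.sub_apply, port, Pi.single_apply]
    by_cases hx : x i = true <;> simp [hx, eq_comm]
  · intro j _ hj
    simp [indicator_apply, h.ne hj]
  · simp

theorem fromBlocks_sub {l m n o : Type*} (A A' : Matrix n l R) (B B' : Matrix n m R)
    (C C' : Matrix o l R) (D D' : Matrix o m R) :
    fromBlocks A B C D - fromBlocks A' B' C' D' =
      fromBlocks (A - A') (B - B') (C - C') (D - D') := by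
  ext (i | i) (j | j) <;> simp

/-! ### Eliminating a braid-like layer -/

section Peel

variable [Fintype κ] [DecidableEq κ] [DecidableEq E]

/-- The diagonal projection to the strands with orientation `y`. -/
def orientProj (R : Type*) [CommRing R] (x : κ → Bool) (y : Bool) : Matrix κ κ R :=
  diagonal fun i => if x i = y then 1 else 0

theorem orientProj_mul_self (x : κ → Bool) (y : Bool) :
    orientProj R x y * orientProj R x y = orientProj R x y := by
  rw [orientProj, diagonal_mul_diagonal]; congr 1; ext i; split_ifs <;> simp

theorem orientProj_mul_not (x : κ → Bool) (y : Bool) :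
    orientProj R x y * orientProj R x (!y) = 0 := by
  rw [orientProj, orientProj, diagonal_mul_diagonal, ← diagonal_zero]
  congr 1; ext i; cases x i <;> cases y <;> simp

theorem indicator_port (x : κ → Bool) (t b : κ → E) :
    indicator R (port x t b) =
      orientProj R x true * indicator R t + orientProj R x false * indicator R b := by
  ext i e
  rw [Matrix.add_apply, orientProj, orientProj, diagonal_mul, diagonal_mul]
  simp only [indicator_apply, port]
  by_cases hx : x i = true <;> simp [hx]

theorem transpose_orientProj (x : κ → Bool) (y : Bool) :
    (orientProj R x y)ᵀ = orientProj R x y := diagonal_transpose _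

theorem orientProj_add (x : κ → Bool) : orientProj R x true + orientProj R x false = 1 := by
  rw [orientProj, orientProj, diagonal_add, ← diagonal_one]
  congr 1; ext i; cases x i <;> simp

theorem indicator_inl (R : Type*) [CommRing R] :
    indicator R (Sum.inl : κ → κ ⊕ E) = fromCols 1 0 := by
  ext i (j | j) <;> simp [indicator_apply, Matrix.one_apply]

theorem indicator_inr_comp [DecidableEq ι] (t : κ → E) :
    indicator R (Sum.inr ∘ t : κ → ι ⊕ E) = fromCols 0 (indicator R t) := by
  ext i (j | j) <;> simp [indicator_apply]

/-- Solving the equations of a braid-like layer, in which the lower variables are the image of the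
upper variables under `B`. The equations of the layer are the combinations `Q` of these. -/
theorem det_peel [Fintype E] [Fintype ι] [DecidableEq ι] (x : κ → Bool) (π : κ ≃ ι) (t : κ → E)
    (bot : ι → E) (hbot : Function.Injective bot)
    (hne : ∀ i j, x i = false → x j = true → bot (π i) ≠ t j) (F : Matrix E E R)
    (hF : ∀ i, x i = false → F (bot (π i)) = 0) (Q C : Matrix κ κ R) (B : Matrix κ ι R)
    (L₁₁ : Matrix κ κ R) (L₁₂ : Matrix κ ι R) (L₂₁ : Matrix ι κ R) (L₂₂ : Matrix ι ι R)
    (h₁₁ : L₁₁ = orientProj R x true - orientProj R x true * Q)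
    (h₁₂ : L₁₂ = orientProj R x true * Q * B)
    (h₂₁ : L₂₁ = -((indicator R π)ᵀ * (orientProj R x false * Q)))
    (h₂₂ : L₂₂ = (indicator R π)ᵀ * (orientProj R x false * Q * B) +
      (indicator R π)ᵀ * (orientProj R x false * indicator R π)) :
    (1 - fromBlocks L₁₁ (L₁₂ * indicator R bot) ((indicator R bot)ᵀ * L₂₁)
        ((indicator R bot)ᵀ * L₂₂ * indicator R bot + F) -
      conn x (Sum.inr ∘ t) Sum.inl C).det =
    ((1 - (2 : R) • orientProj R x false).det * Q.det) *
      (1 - F - conn x t (bot ∘ π) (C * B * (indicator R π)ᵀ)).det := by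
  set u := orientProj R x true with hu
  set d := orientProj R x false with hd
  set S := orient R x with hS
  set β' := indicator R bot with hβ'
  set β := indicator R (bot ∘ π) with hβ
  set τ := indicator R t with hτ
  have hββ : β = indicator R π * β' := indicator_comp _ _
  have hβt : βᵀ = β'ᵀ * (indicator R π)ᵀ := by rw [hββ, transpose_mul]
  have hdd : d * d = d := orientProj_mul_self _ _
  have huu : u * u = u := orientProj_mul_self _ _
  have hdu : d * u = 0 := orientProj_mul_not x false
  have hud : u * d = 0 := orientProj_mul_not x true
  have hsum : u + d = 1 := orientProj_add x
  have hβ1 : β * βᵀ = 1 := indicator_mul_transpose_self (hbot.comp π.injective)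
  have hdτ : d * (β * (τᵀ * u)) = 0 := by
    ext i j
    rw [hd, hu, orientProj, orientProj, diagonal_mul, ← Matrix.mul_assoc, mul_diagonal,
      hβ, hτ, indicator_mul]
    simp only [submatrix_apply, transpose_apply, indicator_apply, id, Function.comp_apply]
    by_cases hi : x i = false <;> by_cases hj : x j = true <;> simp [hi, hj]
    exact fun h => absurd h.symm (hne i j hi hj)
  have hdF : d * (β * F) = 0 := by
    ext i j
    rw [hd, orientProj, diagonal_mul, hβ, indicator_mul]
    by_cases hi : x i = false
    · simp [hF i hi]
    · simp [hi]
  set ρ := indicator R (port x t (bot ∘ π)) with hρ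
  have hρ' : ρ = u * τ + d * β := indicator_port _ _ _
  have hρt : ρᵀ = τᵀ * u + βᵀ * d := by
    rw [hρ', transpose_add, transpose_mul, transpose_mul, hu, hd, transpose_orientProj,
      transpose_orientProj]
  have hdβρ : d * (β * ρᵀ) = d := by
    rw [hρt, Matrix.mul_add, Matrix.mul_add, hdτ, ← Matrix.mul_assoc β, hβ1, Matrix.one_mul, hdd,
      zero_add]
  have hρρ : ρᵀ * ρ = τᵀ * (u * τ) + βᵀ * (d * β) := by
    rw [hρt, hρ', Matrix.add_mul, Matrix.mul_add, Matrix.mul_add]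
    simp only [Matrix.mul_assoc]
    rw [← Matrix.mul_assoc u u, ← Matrix.mul_assoc u d, ← Matrix.mul_assoc d u,
      ← Matrix.mul_assoc d d, huu, hud, hdu, hdd]
    simp
  have hβρ : (1 - βᵀ * (d * β)) * ρᵀ = τᵀ * u := by
    rw [Matrix.sub_mul, Matrix.mul_assoc, Matrix.mul_assoc, hdβρ, hρt]; simp
  set A := 1 - F - ρᵀ * ρ with hA
  have hdA : d * (β * A) = 0 := by
    rw [hA, Matrix.mul_sub, Matrix.mul_sub, Matrix.mul_sub, Matrix.mul_sub, hdF,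
      ← Matrix.mul_assoc β, ← Matrix.mul_assoc d (β * ρᵀ), hdβρ, hρ', Matrix.mul_add,
      ← Matrix.mul_assoc d u, ← Matrix.mul_assoc d d, hdu, hdd]
    simp
  have hconn : conn x (Sum.inr ∘ t) Sum.inl C =
      fromBlocks (d + d * (S * C)) (-(d * (S * τ)))
        (τᵀ * (u * (S * C))) (τᵀ * (u * τ) - τᵀ * (u * (S * τ))) := by
    rw [conn, indicator_port, indicator_inr_comp, indicator_inl, ← hu, ← hd, ← hS, ← hτ]
    have h1 : u * fromCols 0 τ + d * fromCols (1 : Matrix κ κ R) 0 =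
        (fromCols d (u * τ) : Matrix κ (κ ⊕ E) R) := by
      rw [mul_fromCols, mul_fromCols]
      ext i (j | j) <;> simp
    have h2 : (fromCols d (u * τ) : Matrix κ (κ ⊕ E) R) -
        S * ((fromCols 0 τ : Matrix κ (κ ⊕ E) R) - C * (fromCols 1 0 : Matrix κ (κ ⊕ E) R)) =
        fromCols (d + S * C) (u * τ - S * τ) := by
      rw [Matrix.mul_sub, mul_fromCols, mul_fromCols C, mul_fromCols]
      ext i (j | j) <;> simp
    rw [h1, h2, transpose_fromCols, fromRows_mul_fromCols, transpose_mul, hd, hu,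
      transpose_orientProj, transpose_orientProj, ← hd, ← hu]
    simp only [Matrix.mul_add, Matrix.mul_sub, Matrix.mul_assoc]
    rw [← Matrix.mul_assoc d u, ← Matrix.mul_assoc u u, hdu, hud, huu, hdd]
    simp
  -- The first block row of the right factor reads "lower variables = B times upper variables"; its
  -- Schur complement substitutes this into the rest, so that C becomes C B. The left factor records
  -- how the equations of the layer combine these relations; its determinant depends only on Q and
  -- on the orientations.
  have key : 1 - fromBlocks L₁₁ (L₁₂ * β') (β'ᵀ * L₂₁) (β'ᵀ * L₂₂ * β' + F) -
      conn x (Sum.inr ∘ t) Sum.inl C =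
      fromBlocks (u * Q) (d * β) (βᵀ * (d * Q)) (1 - βᵀ * (d * β)) *
        fromBlocks 1 (-(B * β')) (-(ρᵀ * (S * C))) (A + ρᵀ * (S * τ)) := by
    rw [hconn, ← fromBlocks_one, fromBlocks_multiply, fromBlocks_sub, fromBlocks_sub]
    congr 1
    · rw [h₁₁, Matrix.mul_one]
      simp only [Matrix.mul_neg, Matrix.mul_assoc]
      rw [← Matrix.mul_assoc β, ← Matrix.mul_assoc d (β * ρᵀ), hdβρ, ← hsum]
      abel
    · rw [h₁₂, Matrix.mul_add]
      simp only [Matrix.mul_neg, Matrix.mul_add, Matrix.mul_assoc]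
      rw [← Matrix.mul_assoc β ρᵀ, ← Matrix.mul_assoc d (β * ρᵀ), hdβρ, hdA]
      simp
    · rw [h₂₁, Matrix.mul_neg, Matrix.mul_neg, ← Matrix.mul_assoc _ ρᵀ, hβρ, hβt]
      simp only [Matrix.mul_one, Matrix.mul_assoc]
      abel
    · rw [h₂₂, Matrix.mul_add (1 - βᵀ * (d * β)),
        ← Matrix.mul_assoc _ ρᵀ, hβρ, Matrix.sub_mul, Matrix.mul_assoc βᵀ (d * β), Matrix.mul_assoc d β, hdA, hA,
        hρρ, hβt, hββ]
      simp only [Matrix.mul_neg, Matrix.mul_add, Matrix.add_mul, Matrix.mul_assoc, Matrix.one_mul,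
        Matrix.mul_zero]
      abel
  have hΩ : (fromBlocks (u * Q) (d * β) (βᵀ * (d * Q)) (1 - βᵀ * (d * β))).det =
      (1 - (2 : R) • d).det * Q.det := by
    -- Apart from Q, the left factor is a perturbation of 1 of the form 1 - XY. Passing to 1 - YX
    -- gives 1 - d(1 + ββᵀ) = 1 - 2d.
    have hfac : fromBlocks (u * Q) (d * β) (βᵀ * (d * Q)) (1 - βᵀ * (d * β)) =
        (1 - fromRows 1 (-βᵀ) * (d * fromCols 1 (-β))) * fromBlocks Q 0 0 1 := by
      rw [mul_fromCols, fromRows_mul_fromCols, ← fromBlocks_one, fromBlocks_sub,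
        fromBlocks_multiply]
      congr 1
      · rw [Matrix.one_mul, Matrix.mul_one, ← hsum]; simp
      · simp
      · simp [Matrix.mul_assoc]
      · simp
    rw [hfac, det_mul, det_one_sub_mul_comm, Matrix.mul_assoc, fromCols_mul_fromRows,
      det_fromBlocks_zero₁₂, det_one, mul_one Q.det]
    congr 3
    simp [hβ1, Matrix.mul_add, two_smul]
  rw [key, det_mul, hΩ, det_fromBlocks_one₁₁]
  congr 2
  rw [conn, ← hρ, ← hS, ← hτ, ← hβ, hA, hββ]
  have hπ : (indicator R π)ᵀ * indicator R π = 1 := by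
    ext i j
    rw [Matrix.mul_apply, Finset.sum_eq_single (π.symm i)]
    · simp [indicator_apply, Matrix.one_apply]
    · intro k _ hk
      have : π k ≠ i := fun h => hk (by rw [← h]; simp)
      simp [indicator_apply, this]
    · simp
  have : C * B * (indicator R π)ᵀ * (indicator R π * β') = C * (B * β') := by
    rw [Matrix.mul_assoc, ← Matrix.mul_assoc _ (indicator R π), hπ, Matrix.one_mul,
      Matrix.mul_assoc]
  rw [this]
  simp only [Matrix.mul_sub, Matrix.neg_mul, Matrix.mul_neg, neg_neg, Matrix.mul_assoc]
  abel

end Peel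

end LinearAlgebra

/-! ### Principal minors of a matrix with a left and a right null vector -/

section LinearAlgebra

open Matrix

variable {R : Type*} [CommRing R] {E : Type*} [Fintype E] [DecidableEq E]

/-- A principal minor is the determinant of the matrix with a row replaced by a unit vector. -/
theorem det_submatrix_ne (M : Matrix E E R) (e : E) :
    (M.submatrix (Subtype.val : {f // f ≠ e} → E) Subtype.val).det =
      (M.updateRow e (Pi.single e 1)).det := by
  rw [twoBlockTriangular_det (M.updateRow e (Pi.single e 1)) (fun f => f ≠ e)]
  · have h1 : (M.updateRow e (Pi.single e 1)).toSquareBlockProp (fun f => f ≠ e) =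
        M.submatrix (Subtype.val : {f // f ≠ e} → E) Subtype.val := by
      ext ⟨x, hx⟩ ⟨y, hy⟩
      simp [toSquareBlockProp_def, hx]
    have h2 : (M.updateRow e (Pi.single e 1)).toSquareBlockProp (fun f => ¬f ≠ e) = 1 := by
      ext ⟨x, hx⟩ ⟨y, hy⟩
      have hx' : x = e := not_not.mp hx
      have hy' : y = e := not_not.mp hy
      subst hx'; subst hy'
      simp [toSquareBlockProp_def]
    rw [h1, h2, det_one, mul_one]
  · intro i hi j hj
    have hi' : i = e := not_not.mp hi
    subst hi'
    simp [hj]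

/-- If the rows of a square matrix satisfy a linear relation `lam` and add up to zero, then its
principal minors are proportional to `lam`. -/
theorem mul_det_updateRow_single [IsDomain R] (M : Matrix E E R) (lam : E → R)
    (hrow : M *ᵥ 1 = 0) (hcol : lam ᵥ* M = 0) (e f : E) :
    lam f * (M.updateRow e (Pi.single e 1)).det = lam e * (M.updateRow f (Pi.single f 1)).det := by
  by_cases hef : e = f
  · subst hef; rfl
  have hfe : f ≠ e := fun h => hef h.symm
  -- The difference is the determinant with row e equal to δ_e - δ_f. That matrix kills the constant
  -- vector, so over a domain its determinant is zero.
  have h1 : (M.updateRow e (Pi.single e 1)).det = (M.updateRow e (Pi.single f 1)).det := by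
    have hz : (M.updateRow e (Pi.single e 1 - Pi.single f 1)).det = 0 := by
      refine exists_mulVec_eq_zero_iff.mp ⟨1, fun h => one_ne_zero (congrFun h e), ?_⟩
      ext g
      by_cases hg : g = e
      · subst hg
        have : (fun j => (Pi.single g 1 - Pi.single f 1 : E → R) j) =
          (Pi.single g 1 - Pi.single f 1 : E → R) := rfl
        simp only [mulVec, updateRow_self, this, sub_dotProduct]
        simp
      · have := congrFun hrow g
        simpa [mulVec, hg] using this
    rw [sub_eq_add_neg, ← neg_one_smul R (Pi.single f 1 : E → R), det_updateRow_add,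
      det_updateRow_smul] at hz
    linear_combination hz
  rw [h1]
  set N := M.updateRow e (Pi.single f 1) with hN
  have h2 : (N.updateRow f (∑ k, lam k • N k)).det = lam f • N.det := det_updateRow_sum N f lam
  -- In N only row e differs from M, so the relation `lam` reduces the combined row to lam e·(δ_f -
  -- M e). Two row operations then restore M e in row e and leave δ_f in row f.
  have h3 : ∑ k, lam k • N k = lam e • (Pi.single f 1 - M e) := by
    have h4 : ∑ k, lam k • M k = 0 := by
      rw [← hcol]; ext g; simp [vecMul, dotProduct]
    rw [Finset.sum_eq_add_sum_sdiff_singleton_of_mem (Finset.mem_univ e)] at h4 ⊢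
    have h5 : ∑ k ∈ Finset.univ \ {e}, lam k • N k = ∑ k ∈ Finset.univ \ {e}, lam k • M k := by
      refine Finset.sum_congr rfl fun k hk => ?_
      have : k ≠ e := by simpa using hk
      rw [hN, updateRow_ne this]
    rw [h5, eq_neg_of_add_eq_zero_right h4, hN, updateRow_self, smul_sub, sub_eq_add_neg]
  rw [h3, det_updateRow_smul, smul_eq_mul] at h2
  rw [← h2]
  congr 1
  set A := N.updateRow f (Pi.single f 1 - M e) with hA
  have hAe : A e = Pi.single f 1 := by rw [hA, updateRow_ne hef, hN, updateRow_self]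
  have hAf : A f = Pi.single f 1 - M e := by rw [hA, updateRow_self]
  have h6 := det_updateRow_add_smul_self A hef (-1)
  have h7 : A e + (-1 : R) • A f = M e := by rw [hAe, hAf]; ext; simp
  rw [h7] at h6
  set A' := A.updateRow e (M e) with hA'
  have h8 := det_updateRow_add_smul_self A' hfe 1
  rw [← h6, ← h8]
  congr 1
  ext g k
  by_cases hg : g = f
  · subst hg
    simp [hA', hA, hfe]
  · by_cases hg' : g = e
    · subst hg'; simp [hA', hg]
    · simp [hA', hA, hN, hg, hg']

end LinearAlgebra

/-!
# Networks
-/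

/-- The indicator function of the strands of a row with a given orientation. -/
noncomputable def strandVec (y : Bool) (a : List Bool) (i : Fin a.length) : ℤ[T;T⁻¹] :=
  if a.get i = y then 1 else 0

/-- The weights of the strands of a row in the linear relation between the rows of the Alexander
matrix. -/
noncomputable def rowWeight (a : List Bool) (i : Fin a.length) : ℤ[T;T⁻¹] := T (rowIndex a i)

/-- The flow matrix of a horizontal slice of a diagram. -/
structure Layer (a b : List Bool) where
  flow : Matrix (Fin a.length ⊕ Fin b.length) (Fin a.length ⊕ Fin b.length) ℤ[T;T⁻¹]
  zero_bot : ∀ i, a.get i = false → flow (Sum.inl i) = 0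
  zero_top : ∀ j, b.get j = true → flow (Sum.inr j) = 0
  row : flow.mulVec 1 = Sum.elim (strandVec true a) (strandVec false b)
  col : flow.vecMul (Sum.elim (rowWeight a) (rowWeight b)) =
    Sum.elim (strandVec false a * rowWeight a) (strandVec true b * rowWeight b)
  inner : (∃ i, a.get i = true) ∨ ∃ j, b.get j = false

/-- An open diagram, described by its edges, the edges at its bottom and at its top, its flow
matrix, and the indices of its edges. -/
structure Net (a b : List Bool) where
  E : Type
  [fintype : Fintype E]
  [decEq : DecidableEq E]
  bot : Fin a.length → E
  top : Fin b.length → E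
  F : Matrix E E ℤ[T;T⁻¹]
  idx : E → ℤ

attribute [instance] Net.fintype Net.decEq

namespace Net

open Matrix

variable {a b c : List Bool}

/-- Vertical strands. -/
noncomputable def nil (a : List Bool) : Net a a where
  E := Fin a.length
  bot := id
  top := id
  F := 0
  idx := rowIndex a

/-- Put a layer below a diagram. -/
noncomputable def cons (L : Layer a b) (N : Net b c) : Net a c where
  E := Fin a.length ⊕ N.E
  bot := Sum.inl
  top := Sum.inr ∘ N.top
  F := fromBlocks L.flow.toBlocks₁₁ (L.flow.toBlocks₁₂ * indicator ℤ[T;T⁻¹] N.bot)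
    ((indicator ℤ[T;T⁻¹] N.bot)ᵀ * L.flow.toBlocks₂₁)
    ((indicator ℤ[T;T⁻¹] N.bot)ᵀ * L.flow.toBlocks₂₂ * indicator ℤ[T;T⁻¹] N.bot + N.F)
  idx := Sum.elim (rowIndex a) N.idx

/-- The weight of an edge. -/
noncomputable def weight (N : Net a b) (e : N.E) : ℤ[T;T⁻¹] := T (N.idx e)

/-- The properties of the flow matrix of a diagram. -/
structure Good (N : Net a b) : Prop where
  bot_inj : Function.Injective N.bot
  top_inj : Function.Injective N.top
  orient : ∀ i j, N.bot i = N.top j → a.get i = b.get j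
  idx_bot : ∀ i, N.idx (N.bot i) = rowIndex a i
  idx_top : ∀ j, N.idx (N.top j) = rowIndex b j
  zero_bot : ∀ i, a.get i = false → N.F (N.bot i) = 0
  zero_top : ∀ j, b.get j = true → N.F (N.top j) = 0
  row : N.F.mulVec 1 = 1 - (strandVec false a) ᵥ* indicator ℤ[T;T⁻¹] N.bot -
    (strandVec true b) ᵥ* indicator ℤ[T;T⁻¹] N.top
  col : N.F.vecMul N.weight = N.weight - (strandVec true a * rowWeight a) ᵥ* indicator ℤ[T;T⁻¹] N.bot -
    (strandVec false b * rowWeight b) ᵥ* indicator ℤ[T;T⁻¹] N.top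

theorem strandVec_add (a : List Bool) : strandVec true a + strandVec false a = 1 := by
  ext1 i
  simp only [strandVec, Pi.add_apply, Pi.one_apply]
  by_cases h : a.get i = true <;> simp only [h] <;> simp

theorem nil_good (a : List Bool) : (nil a).Good where
  bot_inj := Function.injective_id
  top_inj := Function.injective_id
  orient := by rintro i j (h : i = j); rw [h]
  idx_bot := fun _ => rfl
  idx_top := fun _ => rfl
  zero_bot := fun _ _ => rfl
  zero_top := fun _ _ => rfl
  row := by
    have : (nil a).F = 0 := rfl
    rw [this, zero_mulVec]
    have h2 : indicator ℤ[T;T⁻¹] (nil a).bot = (1 : Matrix (Fin a.length) (Fin a.length) _) :=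
      indicator_id
    have h3 : indicator ℤ[T;T⁻¹] (nil a).top = (1 : Matrix (Fin a.length) (Fin a.length) _) :=
      indicator_id
    rw [h2, h3]
    have h4 : (1 : (nil a).E → ℤ[T;T⁻¹]) = strandVec true a + strandVec false a :=
      (strandVec_add a).symm
    rw [h4]
    erw [vecMul_one, vecMul_one, add_sub_cancel_right, sub_self]
  col := by
    have : (nil a).F = 0 := rfl
    rw [this, vecMul_zero]
    have h2 : indicator ℤ[T;T⁻¹] (nil a).bot = (1 : Matrix (Fin a.length) (Fin a.length) _) :=
      indicator_id
    have h3 : indicator ℤ[T;T⁻¹] (nil a).top = (1 : Matrix (Fin a.length) (Fin a.length) _) :=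
      indicator_id
    rw [h2, h3]
    erw [vecMul_one, vecMul_one]
    have h4 : (nil a).weight = (strandVec true a + strandVec false a) * rowWeight a := by
      rw [strandVec_add, one_mul]; rfl
    rw [h4, add_mul]
    erw [sub_sub, sub_self]

theorem indicator_mulVec_one {ι E : Type*} [Fintype E] [DecidableEq E] (f : ι → E) :
    indicator ℤ[T;T⁻¹] f *ᵥ 1 = 1 := by
  ext1 i; simp [mulVec, dotProduct, indicator_apply]

theorem weight_vecMul_indicator {N : Net b c} (hN : N.Good) :
    N.weight ᵥ* (indicator ℤ[T;T⁻¹] N.bot)ᵀ = rowWeight b := by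
  ext1 i; simp [vecMul, dotProduct, indicator_apply, weight, rowWeight, hN.idx_bot]

theorem row_cons {E : Type} [Fintype E] [DecidableEq E] (L : Layer a b) {bot : Fin b.length → E}
    {top : Fin c.length → E} {F : Matrix E E ℤ[T;T⁻¹]}
    (hF : F *ᵥ 1 = 1 - (strandVec false b) ᵥ* indicator ℤ[T;T⁻¹] bot -
      (strandVec true c) ᵥ* indicator ℤ[T;T⁻¹] top) :
    fromBlocks L.flow.toBlocks₁₁ (L.flow.toBlocks₁₂ * indicator ℤ[T;T⁻¹] bot)
      ((indicator ℤ[T;T⁻¹] bot)ᵀ * L.flow.toBlocks₂₁)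
      ((indicator ℤ[T;T⁻¹] bot)ᵀ * L.flow.toBlocks₂₂ * indicator ℤ[T;T⁻¹] bot + F) *ᵥ 1 =
    1 - (strandVec false a) ᵥ* indicator ℤ[T;T⁻¹] (Sum.inl : Fin a.length → Fin a.length ⊕ E) -
      (strandVec true c) ᵥ* indicator ℤ[T;T⁻¹] (Sum.inr ∘ top : _ → Fin a.length ⊕ E) := by
  have hL := L.row
  rw [← fromBlocks_toBlocks L.flow, fromBlocks_mulVec] at hL
  have h1 := congrArg (fun f => f ∘ Sum.inl) hL
  have h2 := congrArg (fun f => f ∘ Sum.inr) hL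
  simp only [Sum.elim_comp_inl, Sum.elim_comp_inr] at h1 h2
  have e1 : ((1 : Fin a.length ⊕ Fin b.length → ℤ[T;T⁻¹]) ∘ Sum.inl) = 1 := rfl
  have e2 : ((1 : Fin a.length ⊕ Fin b.length → ℤ[T;T⁻¹]) ∘ Sum.inr) = 1 := rfl
  have e3 : ((1 : Fin a.length ⊕ E → ℤ[T;T⁻¹]) ∘ Sum.inl) = 1 := rfl
  have e4 : ((1 : Fin a.length ⊕ E → ℤ[T;T⁻¹]) ∘ Sum.inr) = 1 := rfl
  rw [e1, e2] at h1 h2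
  rw [fromBlocks_mulVec, e3, e4, ← mulVec_mulVec, indicator_mulVec_one, h1, add_mulVec,
    ← mulVec_mulVec, ← mulVec_mulVec, ← mulVec_mulVec, indicator_mulVec_one, ← add_assoc,
    ← mulVec_add, h2, mulVec_transpose, hF, indicator_inl, indicator_inr_comp, vecMul_fromCols,
    vecMul_fromCols]
  have h3 := eq_sub_of_add_eq (strandVec_add a)
  ext1 (i | i)
  · simp [h3]
  · simp only [Sum.elim_inr, Pi.sub_apply, Pi.add_apply, Pi.one_apply, vecMul_zero, Pi.zero_apply]
    ring

theorem col_cons {E : Type} [Fintype E] [DecidableEq E] (L : Layer a b) {bot : Fin b.length → E}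
    {top : Fin c.length → E} {F : Matrix E E ℤ[T;T⁻¹]} {idx : E → ℤ}
    (hbot : (fun e => (T (idx e) : ℤ[T;T⁻¹])) ᵥ* (indicator ℤ[T;T⁻¹] bot)ᵀ = rowWeight b)
    (hF : (fun e => T (idx e)) ᵥ* F =
      (fun e => T (idx e)) - (strandVec true b * rowWeight b) ᵥ* indicator ℤ[T;T⁻¹] bot -
      (strandVec false c * rowWeight c) ᵥ* indicator ℤ[T;T⁻¹] top) :
    (fun e => T (Sum.elim (rowIndex a) idx e)) ᵥ*
      fromBlocks L.flow.toBlocks₁₁ (L.flow.toBlocks₁₂ * indicator ℤ[T;T⁻¹] bot)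
      ((indicator ℤ[T;T⁻¹] bot)ᵀ * L.flow.toBlocks₂₁)
      ((indicator ℤ[T;T⁻¹] bot)ᵀ * L.flow.toBlocks₂₂ * indicator ℤ[T;T⁻¹] bot + F) =
    (fun e => T (Sum.elim (rowIndex a) idx e)) - (strandVec true a * rowWeight a) ᵥ*
        indicator ℤ[T;T⁻¹] (Sum.inl : Fin a.length → Fin a.length ⊕ E) -
      (strandVec false c * rowWeight c) ᵥ*
        indicator ℤ[T;T⁻¹] (Sum.inr ∘ top : _ → Fin a.length ⊕ E) := by
  have hL := L.col
  rw [← fromBlocks_toBlocks L.flow, vecMul_fromBlocks] at hL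
  have h1 := congrArg (fun f => f ∘ Sum.inl) hL
  have h2 := congrArg (fun f => f ∘ Sum.inr) hL
  simp only [Sum.elim_comp_inl, Sum.elim_comp_inr] at h1 h2
  have e3 : (fun e : Fin a.length ⊕ E => (T (Sum.elim (rowIndex a) idx e) : ℤ[T;T⁻¹])) ∘ Sum.inl =
    rowWeight a := rfl
  have e4 : (fun e : Fin a.length ⊕ E => (T (Sum.elim (rowIndex a) idx e) : ℤ[T;T⁻¹])) ∘ Sum.inr =
    fun e => T (idx e) := rfl
  rw [vecMul_fromBlocks, e3, e4, ← vecMul_vecMul, ← vecMul_vecMul, hbot, h1, vecMul_add,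
    ← vecMul_vecMul, ← vecMul_vecMul, hbot, ← add_assoc, ← add_vecMul, h2, hF, indicator_inl,
    indicator_inr_comp, vecMul_fromCols, vecMul_fromCols]
  ext1 (i | i)
  · have := congrFun (strandVec_add a) i
    rw [Pi.add_apply, Pi.one_apply] at this
    simp only [Sum.elim_inl, Pi.mul_apply, Pi.sub_apply, vecMul_one, vecMul_zero, Pi.zero_apply,
      sub_zero]
    change _ = rowWeight a i - _
    linear_combination rowWeight a i * this
  · simp only [Sum.elim_inr, Pi.sub_apply, Pi.add_apply, vecMul_zero, Pi.zero_apply]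
    ring

/-- Both balance laws are local. On the common row, an equation is supplied by the layer for strands
directed downwards and by the upper diagram for strands directed upwards, so the boundary terms of
the two parts complement each other. -/
theorem cons_good (L : Layer a b) {N : Net b c} (hN : N.Good) : (cons L N).Good where
  bot_inj := Sum.inl_injective
  top_inj := Sum.inr_injective.comp hN.top_inj
  orient := fun i j h => by cases h
  idx_bot := fun _ => rfl
  idx_top := hN.idx_top
  zero_bot := by
    intro i hi
    have h := L.zero_bot i hi
    ext1 (j | j)
    · exact congrFun h (Sum.inl j)
    · change (L.flow.toBlocks₁₂ * indicator ℤ[T;T⁻¹] N.bot) i j = 0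
      rw [Matrix.mul_apply]
      exact Finset.sum_eq_zero fun k _ => by
        rw [show L.flow.toBlocks₁₂ i k = 0 from congrFun h (Sum.inr k), zero_mul]
  zero_top := by
    intro j hj
    have hz : ∀ k, N.bot k = N.top j → L.flow (Sum.inr k) = 0 := fun k hk =>
      L.zero_top k (by rw [hN.orient k j hk, hj])
    have hz' : ∀ X : Type, ∀ A : Matrix (Fin b.length) X ℤ[T;T⁻¹],
        (∀ k, N.bot k = N.top j → A k = 0) → ((indicator ℤ[T;T⁻¹] N.bot)ᵀ * A) (N.top j) = 0 := by
      intro X A hA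
      ext1 x
      rw [Matrix.mul_apply]
      refine Finset.sum_eq_zero fun k _ => ?_
      rw [transpose_apply, indicator_apply]
      split_ifs with hk
      · rw [hA k hk]; simp
      · simp
    ext1 (i | i)
    · exact congrFun (hz' _ L.flow.toBlocks₂₁ fun k hk => by
        ext1 x; exact congrFun (hz k hk) (Sum.inl x)) i
    · change ((indicator ℤ[T;T⁻¹] N.bot)ᵀ * L.flow.toBlocks₂₂ * indicator ℤ[T;T⁻¹] N.bot + N.F) (N.top j) i = 0
      rw [Matrix.add_apply, hN.zero_top j hj, Matrix.mul_assoc,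
        congrFun (hz' _ (L.flow.toBlocks₂₂ * indicator ℤ[T;T⁻¹] N.bot) fun k hk => by
          ext1 x
          rw [Matrix.mul_apply]
          exact Finset.sum_eq_zero fun m _ => by
            rw [show L.flow.toBlocks₂₂ k m = 0 from congrFun (hz k hk) (Sum.inr m), zero_mul]) i]
      simp
  row := row_cons L hN.row
  col := col_cons L (weight_vecMul_indicator hN) hN.col

end Net

/-- Stacks of layers, listed from bottom to top. -/
inductive Chain : List Bool → List Bool → Type
  | nil (a : List Bool) : Chain a a
  | cons {a b c : List Bool} (L : Layer a b) (w : Chain b c) : Chain a c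

/-! ### Stacks of layers and the edges of their two parts -/

namespace Chain

open Matrix

/-- Stacking: `v` is put on top of `w`. -/
def comp : {a b c : List Bool} → Chain a b → Chain b c → Chain a c
  | _, _, _, .nil _, v => v
  | _, _, _, .cons L w, v => .cons L (comp w v)

/-- Put a stack of layers below a diagram. -/
noncomputable def act : {a b c : List Bool} → Chain a b → Net b c → Net a c
  | _, _, _, .nil _, N => N
  | _, _, _, .cons L w, N => Net.cons L (act w N)

/-- The diagram of a stack of layers. -/
noncomputable def net {a b : List Bool} (u : Chain a b) : Net a b := u.act (Net.nil b)

variable {a b c d : List Bool}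

theorem comp_assoc (u : Chain a b) (v : Chain b c) (w : Chain c d) :
    (u.comp v).comp w = u.comp (v.comp w) := by
  induction u with
  | nil => rfl
  | cons L u ih => simp only [comp, ih]

theorem comp_nil (u : Chain a b) : u.comp (nil b) = u := by
  induction u with
  | nil => rfl
  | cons L u ih => simp only [comp, ih]

theorem act_comp (u : Chain a b) (v : Chain b c) (N : Net c d) :
    (u.comp v).act N = u.act (v.act N) := by
  induction u with
  | nil => rfl
  | cons L u ih => simp only [comp, act, ih]

theorem act_good (u : Chain a b) {N : Net b c} (hN : N.Good) : (u.act N).Good := by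
  induction u with
  | nil => exact hN
  | cons L u ih => exact Net.cons_good L (ih hN)

theorem net_good (u : Chain a b) : u.net.Good := u.act_good (Net.nil_good b)

theorem net_comp (u : Chain a b) (v : Chain b c) : (u.comp v).net = u.act v.net :=
  act_comp u v _

/-- The edges of the lower part of a stack. -/
def inLower : {a b c : List Bool} → (u : Chain a b) → (N : Net b c) → u.net.E → (u.act N).E
  | _, _, _, .nil _, N => N.bot
  | _, _, _, .cons _ u, N => Sum.map id (inLower u N)

/-- The edges of the upper part of a stack. -/
def inUpper : {a b c : List Bool} → (u : Chain a b) → (N : Net b c) → N.E → (u.act N).E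
  | _, _, _, .nil _, _ => id
  | _, _, _, .cons _ u, N => Sum.inr ∘ inUpper u N

theorem inLower_bot (u : Chain a b) (N : Net b c) (i : Fin a.length) :
    u.inLower N (u.net.bot i) = (u.act N).bot i := by
  cases u <;> rfl

theorem inUpper_top (u : Chain a b) (N : Net b c) (i : Fin c.length) :
    u.inUpper N (N.top i) = (u.act N).top i := by
  induction u with
  | nil => rfl
  | cons L u ih => exact congrArg Sum.inr (ih N)

theorem inLower_top (u : Chain a b) (N : Net b c) (i : Fin b.length) :
    u.inLower N (u.net.top i) = u.inUpper N (N.bot i) := by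
  induction u with
  | nil => rfl
  | cons L u ih => exact congrArg Sum.inr (ih N i)

theorem inUpper_injective (u : Chain a b) (N : Net b c) : Function.Injective (u.inUpper N) := by
  induction u with
  | nil => exact Function.injective_id
  | cons L u ih => exact Sum.inr_injective.comp (ih N)

theorem inLower_injective (u : Chain a b) {N : Net b c} (hN : Function.Injective N.bot) :
    Function.Injective (u.inLower N) := by
  induction u with
  | nil => exact hN
  | cons L u ih => exact Function.injective_id.sumMap (ih hN)

theorem eq_of_inLower_eq_inUpper (u : Chain a b) (N : Net b c) (e : u.net.E) (f : N.E)
    (h : u.inLower N e = u.inUpper N f) : ∃ i, e = u.net.top i ∧ f = N.bot i := by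
  induction u with
  | nil => exact ⟨e, rfl, h.symm⟩
  | cons L u ih =>
    rcases e with e | e
    · cases h
    · obtain ⟨i, hi, hi'⟩ := ih N e f (Sum.inr_injective h)
      exact ⟨i, congrArg Sum.inr hi, hi'⟩

theorem exists_inLower_or_inUpper (u : Chain a b) (N : Net b c) (e : (u.act N).E) :
    (∃ f, u.inLower N f = e) ∨ ∃ f, u.inUpper N f = e := by
  induction u with
  | nil => exact Or.inr ⟨e, rfl⟩
  | cons L u ih =>
    rcases e with e | e
    · exact Or.inl ⟨Sum.inl e, rfl⟩
    · rcases ih N e with ⟨f, hf⟩ | ⟨f, hf⟩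
      · exact Or.inl ⟨Sum.inr f, congrArg Sum.inr hf⟩
      · exact Or.inr ⟨f, congrArg Sum.inr hf⟩

theorem idx_inLower (u : Chain a b) {N : Net b c} (hN : N.Good) (e : u.net.E) :
    (u.act N).idx (u.inLower N e) = u.net.idx e := by
  induction u with
  | nil => exact hN.idx_bot e
  | cons L u ih =>
    rcases e with e | e
    · rfl
    · exact ih hN e

theorem idx_inUpper (u : Chain a b) (N : Net b c) (e : N.E) :
    (u.act N).idx (u.inUpper N e) = N.idx e := by
  induction u with
  | nil => rfl
  | cons L u ih => exact ih N e

theorem push_cons {E E' ι : Type} [Fintype E] [DecidableEq E] [Fintype E'] [DecidableEq E']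
    [Fintype ι] [DecidableEq ι] {X : Type} [Fintype X] [DecidableEq X]
    (A : Matrix ι ι ℤ[T;T⁻¹]) (B : Matrix ι X ℤ[T;T⁻¹])
    (C : Matrix X ι ℤ[T;T⁻¹]) (D : Matrix X X ℤ[T;T⁻¹]) (f : E → E') (bot : X → E)
    (F : Matrix E E ℤ[T;T⁻¹]) (G : Matrix E' E' ℤ[T;T⁻¹]) :
    fromBlocks A (B * indicator ℤ[T;T⁻¹] (f ∘ bot)) ((indicator ℤ[T;T⁻¹] (f ∘ bot))ᵀ * C)
      ((indicator ℤ[T;T⁻¹] (f ∘ bot))ᵀ * D * indicator ℤ[T;T⁻¹] (f ∘ bot) +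
        ((indicator ℤ[T;T⁻¹] f)ᵀ * F * indicator ℤ[T;T⁻¹] f + G)) =
    (indicator ℤ[T;T⁻¹] (Sum.map id f : ι ⊕ E → ι ⊕ E'))ᵀ *
      fromBlocks A (B * indicator ℤ[T;T⁻¹] bot) ((indicator ℤ[T;T⁻¹] bot)ᵀ * C)
        ((indicator ℤ[T;T⁻¹] bot)ᵀ * D * indicator ℤ[T;T⁻¹] bot + F) *
      indicator ℤ[T;T⁻¹] (Sum.map id f : ι ⊕ E → ι ⊕ E') + fromBlocks 0 0 0 G := by
  have h : indicator ℤ[T;T⁻¹] (Sum.map id f : ι ⊕ E → ι ⊕ E') =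
      fromBlocks 1 0 0 (indicator ℤ[T;T⁻¹] f) := by
    ext (i | i) (j | j) <;> simp [indicator_apply, Matrix.one_apply]
  rw [h, fromBlocks_transpose, fromBlocks_multiply, fromBlocks_multiply, fromBlocks_add,
    indicator_comp, transpose_mul]
  simp only [Matrix.mul_assoc, transpose_one, transpose_zero, Matrix.one_mul, Matrix.mul_one,
    Matrix.zero_mul, Matrix.mul_zero, add_zero, zero_add, Matrix.mul_add, Matrix.add_mul, add_assoc]

theorem one_transpose_mul_mul_one {E : Type} [Fintype E] [DecidableEq E]
    (F : Matrix E E ℤ[T;T⁻¹]) : (1 : Matrix E E ℤ[T;T⁻¹])ᵀ * F * (1 : Matrix E E ℤ[T;T⁻¹]) = F := by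
  simp

theorem fromCols_zero_transpose_mul_mul {E E' ι : Type} [Fintype E]
    (G : Matrix E E ℤ[T;T⁻¹]) (g : Matrix E E' ℤ[T;T⁻¹]) :
    (fromCols 0 g : Matrix E (ι ⊕ E') ℤ[T;T⁻¹])ᵀ * G * (fromCols 0 g : Matrix E (ι ⊕ E') ℤ[T;T⁻¹]) =
      fromBlocks 0 0 0 (gᵀ * G * g) := by
  rw [transpose_fromCols, fromRows_mul, fromRows_mul_fromCols]
  simp only [Matrix.transpose_zero, Matrix.zero_mul, Matrix.mul_zero]

/-- Stacking identifies the edges of the common row and introduces no new equation. The flow is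
therefore the sum of the two flows, each carried along its inclusion of edges. -/
theorem act_flow (u : Chain a b) (N : Net b c) :
    (u.act N).F = (indicator ℤ[T;T⁻¹] (u.inLower N))ᵀ * u.net.F * indicator ℤ[T;T⁻¹] (u.inLower N) +
      (indicator ℤ[T;T⁻¹] (u.inUpper N))ᵀ * N.F * indicator ℤ[T;T⁻¹] (u.inUpper N) := by
  induction u with
  | nil b =>
    have h1 : (nil b).net.F = 0 := rfl
    have h2 : indicator ℤ[T;T⁻¹] ((nil b).inUpper N) = (1 : Matrix N.E N.E _) := indicator_id
    rw [h1, h2, Matrix.mul_zero, Matrix.zero_mul, zero_add]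
    exact (one_transpose_mul_mul_one N.F).symm
  | @cons a b' b L u ih =>
    have h1 : ((cons L u).act N).F = fromBlocks L.flow.toBlocks₁₁
        (L.flow.toBlocks₁₂ * indicator ℤ[T;T⁻¹] (u.act N).bot)
        ((indicator ℤ[T;T⁻¹] (u.act N).bot)ᵀ * L.flow.toBlocks₂₁)
        ((indicator ℤ[T;T⁻¹] (u.act N).bot)ᵀ * L.flow.toBlocks₂₂ *
          indicator ℤ[T;T⁻¹] (u.act N).bot + (u.act N).F) := rfl
    have h2 : (u.act N).bot = u.inLower N ∘ u.net.bot := by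
      ext1 i; exact (inLower_bot u N i).symm
    have h3 : indicator ℤ[T;T⁻¹] ((cons L u).inUpper N) =
        (fromCols 0 (indicator ℤ[T;T⁻¹] (u.inUpper N)) :
          Matrix N.E (Fin a.length ⊕ (u.act N).E) ℤ[T;T⁻¹]) := indicator_inr_comp _
    rw [h1, ih N, h2]
    erw [push_cons]
    rw [h3]
    exact congrArg₂ (· + ·) rfl (fromCols_zero_transpose_mul_mul _ _).symm

end Chain

/-! ### Gluing two diagrams along a row of strands -/

section LinearAlgebra

open Matrix

variable {R : Type*} [CommRing R] {ι κ E E' E₁ E₂ : Type*}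

theorem push_congr_row [Fintype E] [DecidableEq E'] (f : E → E') {G G' : Matrix E E R} (g : E')
    (h : ∀ e, f e = g → G e = G' e) :
    ((indicator R f)ᵀ * G * indicator R f) g = ((indicator R f)ᵀ * G' * indicator R f) g := by
  ext x
  rw [Matrix.mul_assoc, Matrix.mul_assoc, Matrix.mul_apply, Matrix.mul_apply]
  refine Finset.sum_congr rfl fun e _ => ?_
  rw [transpose_apply, indicator_apply]
  split_ifs with he
  · rw [Matrix.mul_apply, Matrix.mul_apply, h e he]
  · simp

theorem push_zero_row [Fintype E] [DecidableEq E'] (f : E → E') {G : Matrix E E R} (g : E')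
    (h : ∀ e, f e = g → G e = 0) : ((indicator R f)ᵀ * G * indicator R f) g = 0 := by
  rw [push_congr_row f (G' := 0) g h]; simp; rfl

theorem indicator_elim_push [Fintype E₁] [Fintype E₂] [DecidableEq E'] (f : E₁ → E') (g : E₂ → E')
    (F₁ : Matrix E₁ E₁ R) (F₂ : Matrix E₂ E₂ R) :
    (indicator R (Sum.elim f g))ᵀ * fromBlocks F₁ 0 0 F₂ * indicator R (Sum.elim f g) =
      (indicator R f)ᵀ * F₁ * indicator R f + (indicator R g)ᵀ * F₂ * indicator R g := by
  have h : indicator R (Sum.elim f g) = fromRows (indicator R f) (indicator R g) := by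
    ext (i | i) j <;> rfl
  rw [h, transpose_fromRows, ← fromRows_fromCols_eq_fromBlocks, Matrix.mul_assoc, fromRows_mul,
    fromCols_mul_fromRows, fromCols_mul_fromRows, fromCols_mul_fromRows]
  simp [Matrix.mul_assoc]

/-- Gluing the strands at the top of one diagram to those at the bottom of another. -/
theorem det_glue [Fintype E₁] [DecidableEq E₁] [Fintype E₂] [DecidableEq E₂] [Fintype E']
    [DecidableEq E'] [Fintype ι] [DecidableEq ι] [Fintype κ] [DecidableEq κ]
    (y : ι → Bool) (top : ι → E₁) (bot : ι → E₂) (f : E₁ → E') (g : E₂ → E')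
    (htop : Function.Injective top) (hbot : Function.Injective bot)
    (hf : Function.Injective f) (hg : Function.Injective g)
    (hfg : ∀ i, f (top i) = g (bot i)) (hex : ∀ e e', f e = g e' → ∃ i, e = top i ∧ e' = bot i)
    (hsurj : ∀ e, (∃ e₁, f e₁ = e) ∨ ∃ e₂, g e₂ = e)
    (F₁ : Matrix E₁ E₁ R) (F₂ : Matrix E₂ E₂ R) (h₁ : ∀ i, y i = true → F₁ (top i) = 0)
    (h₂ : ∀ i, y i = false → F₂ (bot i) = 0) (x : κ → Bool) (t : κ → E₂) (b : κ → E₁)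
    (ht : ∀ k i, x k = true → y i = false → t k ≠ bot i)
    (hb : ∀ k i, x k = false → y i = true → b k ≠ top i) (C : Matrix κ κ R) :
    (1 - ((indicator R f)ᵀ * F₁ * indicator R f + (indicator R g)ᵀ * F₂ * indicator R g) -
        conn x (g ∘ t) (f ∘ b) C).det =
      (1 - fromBlocks F₁ 0 0 F₂ - conn x (Sum.inr ∘ t) (Sum.inl ∘ b) C -
        conn y (Sum.inl ∘ top) (Sum.inr ∘ bot) 1).det := by
  classical
  -- Of the two copies of a glued edge, `p i` is the one from which the connecting strand starts.
  -- The flows and the other connection are zero in its row, so `det_contract` can remove it.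
  set p : ι → E₁ ⊕ E₂ := port y (Sum.inl ∘ top) (Sum.inr ∘ bot) with hp
  have hp1 : ∀ i, y i = true → p i = Sum.inl (top i) := fun i hi => by simp [hp, port, hi]
  have hp2 : ∀ i, y i = false → p i = Sum.inr (bot i) := fun i hi => by simp [hp, port, hi]
  have hpl : ∀ i e, p i = Sum.inl e → y i = true ∧ top i = e := fun i e h => by
    by_cases hi : y i = true
    · rw [hp1 i hi] at h; exact ⟨hi, Sum.inl_injective h⟩
    · rw [hp2 i (by simpa using hi)] at h; cases h
  have hpr : ∀ i e, p i = Sum.inr e → y i = false ∧ bot i = e := fun i e h => by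
    by_cases hi : y i = true
    · rw [hp1 i hi] at h; cases h
    · rw [hp2 i (by simpa using hi)] at h; exact ⟨by simpa using hi, Sum.inr_injective h⟩
  have hpinj : Function.Injective p := fun i j h => by
    by_cases hi : y i = true
    · rw [hp1 i hi] at h; exact htop ((hpl j _ h.symm).2.symm)
    · rw [hp2 i (by simpa using hi)] at h; exact hbot ((hpr j _ h.symm).2.symm)
  have key := det_contract (R := R) (Sum.elim f g) (fun e => ∃ i, p i = e)
    (conn y (Sum.inl ∘ top) (Sum.inr ∘ bot) 1)
    (fromBlocks F₁ 0 0 F₂ + conn x (Sum.inr ∘ t) (Sum.inl ∘ b) C) ?_ ?_ ?_ ?_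
  · rw [Matrix.mul_add, Matrix.add_mul, indicator_elim_push, conn_push, ← sub_sub, ← sub_sub] at key
    exact key.symm
  · constructor
    · rintro ⟨e | e, he⟩ ⟨e' | e', he'⟩ h
      · have : e = e' := hf h
        subst this; rfl
      · obtain ⟨i, rfl, rfl⟩ := hex _ _ h
        by_cases hi : y i = true
        · exact absurd ⟨i, hp1 i hi⟩ he
        · exact absurd ⟨i, hp2 i (by simpa using hi)⟩ he'
      · obtain ⟨i, rfl, rfl⟩ := hex _ _ h.symm
        by_cases hi : y i = true
        · exact absurd ⟨i, hp1 i hi⟩ he'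
        · exact absurd ⟨i, hp2 i (by simpa using hi)⟩ he
      · have : e = e' := hg h
        subst this; rfl
    · intro e
      rcases hsurj e with ⟨e', rfl⟩ | ⟨e', rfl⟩
      · by_cases h : ∃ i, p i = Sum.inl e'
        · obtain ⟨i, hi⟩ := h
          obtain ⟨hi1, rfl⟩ := hpl _ _ hi
          refine ⟨⟨Sum.inr (bot i), ?_⟩, (hfg i).symm⟩
          rintro ⟨j, hj⟩
          obtain ⟨hj1, hj2⟩ := hpr _ _ hj
          rw [hbot hj2, hi1] at hj1
          cases hj1
        · exact ⟨⟨Sum.inl e', h⟩, rfl⟩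
      · by_cases h : ∃ i, p i = Sum.inr e'
        · obtain ⟨i, hi⟩ := h
          obtain ⟨hi1, rfl⟩ := hpr _ _ hi
          refine ⟨⟨Sum.inl (top i), ?_⟩, hfg i⟩
          rintro ⟨j, hj⟩
          obtain ⟨hj1, hj2⟩ := hpl _ _ hj
          rw [htop hj2, hi1] at hj1
          cases hj1
        · exact ⟨⟨Sum.inr e', h⟩, rfl⟩
  · intro e he
    exact conn_apply_of_ne _ _ _ _ _ fun i hi => he ⟨i, hi⟩
  · rintro e ⟨i, rfl⟩
    by_cases hi : y i = true
    · refine ⟨Sum.inr (bot i), ?_, ?_, ?_⟩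
      · rintro ⟨j, hj⟩
        obtain ⟨hj1, hj2⟩ := hpr _ _ hj
        rw [hbot hj2, hi] at hj1
        cases hj1
      · rw [hp1 i hi]; exact (hfg i).symm
      · rw [hp, conn_one_row hpinj i]; simp [hi]
    · have hi' : y i = false := by simpa using hi
      refine ⟨Sum.inl (top i), ?_, ?_, ?_⟩
      · rintro ⟨j, hj⟩
        obtain ⟨hj1, hj2⟩ := hpl _ _ hj
        rw [htop hj2, hi'] at hj1
        cases hj1
      · rw [hp2 i hi']; exact hfg i
      · rw [hp, conn_one_row hpinj i]; simp [hi']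
  · rintro e ⟨i, rfl⟩
    have hc : conn x (Sum.inr ∘ t) (Sum.inl ∘ b) C (p i) = 0 := by
      refine conn_apply_of_ne _ _ _ _ _ fun k hk => ?_
      by_cases hx : x k = true
      · rw [port, if_pos hx] at hk
        obtain ⟨h3, h4⟩ := hpr _ _ hk.symm
        exact ht k i hx h3 h4.symm
      · rw [port, if_neg hx] at hk
        obtain ⟨h3, h4⟩ := hpl _ _ hk.symm
        exact hb k i (by simpa using hx) h3 h4.symm
    ext e
    rw [Matrix.add_apply, hc]
    by_cases hi : y i = true
    · rw [hp1 i hi]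
      rcases e with e | e
      · simp [h₁ i hi]
      · simp
    · have hi' : y i = false := by simpa using hi
      rw [hp2 i hi']
      rcases e with e | e
      · simp
      · simp [h₂ i hi']

end LinearAlgebra

/-! ### Closed diagrams and independence of the chosen edge -/

namespace Net

open Matrix

variable {a b c : List Bool}

/-- The flow matrix of the closure of a diagram. -/
noncomputable def closedFlow (N : Net a a) : Matrix N.E N.E ℤ[T;T⁻¹] :=
  N.F + conn a.get N.top N.bot 1

theorem vecMul_orientProj (v : Fin a.length → ℤ[T;T⁻¹]) (y : Bool) :
    v ᵥ* orientProj ℤ[T;T⁻¹] a.get y = strandVec y a * v := by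
  ext1 i
  rw [orientProj, vecMul_diagonal, Pi.mul_apply, strandVec, mul_comm]

theorem orient_eq_sub {κ : Type} [Fintype κ] [DecidableEq κ] (x : κ → Bool) :
    orient ℤ[T;T⁻¹] x = orientProj ℤ[T;T⁻¹] x true - orientProj ℤ[T;T⁻¹] x false := by
  rw [orient, orientProj, orientProj, diagonal_sub]
  congr 1
  ext1 i
  by_cases h : x i = true <;> simp [h]

/-- Every relation of the Alexander module holds when all variables are equal. The boundary terms in
`Good` are exactly what the closing strands supply. -/
theorem closedFlow_mulVec {N : Net a a} (hN : N.Good) : N.closedFlow *ᵥ 1 = 1 := by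
  have h : conn a.get N.top N.bot (1 : Matrix _ _ ℤ[T;T⁻¹]) *ᵥ 1 =
      strandVec false a ᵥ* indicator ℤ[T;T⁻¹] N.bot + strandVec true a ᵥ* indicator ℤ[T;T⁻¹] N.top := by
    rw [conn, ← mulVec_mulVec, Matrix.one_mul, sub_mulVec, ← mulVec_mulVec _ (orient _ _), sub_mulVec,
      indicator_mulVec_one, indicator_mulVec_one, indicator_mulVec_one, sub_self, mulVec_zero,
      sub_zero, mulVec_transpose, indicator_port, vecMul_add, ← vecMul_vecMul, ← vecMul_vecMul,
      vecMul_orientProj, vecMul_orientProj, mul_one, mul_one, add_comm]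
  rw [closedFlow, add_mulVec, hN.row, h]
  abel

/-- The Wirtinger relations are dependent: weighted by t to the mean winding number next to each
edge, they add up to zero. -/
theorem vecMul_closedFlow {N : Net a a} (hN : N.Good) : N.weight ᵥ* N.closedFlow = N.weight := by
  have h0 : N.weight ᵥ* (indicator ℤ[T;T⁻¹] (port a.get N.top N.bot))ᵀ = rowWeight a := by
    ext1 i
    have : N.idx (port a.get N.top N.bot i) = rowIndex a i := by
      rw [port]; split_ifs
      · exact hN.idx_top i
      · exact hN.idx_bot i
    simp [vecMul, dotProduct, indicator_apply, weight, rowWeight, this]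
  have h : N.weight ᵥ* conn a.get N.top N.bot (1 : Matrix _ _ ℤ[T;T⁻¹]) =
      (strandVec true a * rowWeight a) ᵥ* indicator ℤ[T;T⁻¹] N.bot +
      (strandVec false a * rowWeight a) ᵥ* indicator ℤ[T;T⁻¹] N.top := by
    rw [conn, ← vecMul_vecMul, h0, Matrix.one_mul, orient_eq_sub, indicator_port,
      ← vecMul_orientProj, ← vecMul_orientProj, vecMul_vecMul, vecMul_vecMul, ← vecMul_add]
    congr 1
    rw [Matrix.sub_mul, Matrix.mul_sub, Matrix.mul_sub]
    abel
  rw [closedFlow, vecMul_add, hN.col, h]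
  abel

open Classical in
/-- The Alexander polynomial of the closure of a diagram, up to the normalization by the writhe and
the rotation number. -/
noncomputable def nabla (N : Net a a) : ℤ[T;T⁻¹] :=
  if h : Nonempty N.E then T (-N.idx (Classical.choice h)) *
    ((1 - N.closedFlow).submatrix (Subtype.val : {f // f ≠ Classical.choice h} → N.E)
      Subtype.val).det else 0

/-- The kernel vector 1 and the left kernel vector `weight` make the principal minors proportional
to the weights, and the factor T (-idx e) removes this dependence on the edge. -/
theorem nabla_eq {N : Net a a} (hN : N.Good) (e : N.E) :
    N.nabla = T (-N.idx e) * ((1 - N.closedFlow).updateRow e (Pi.single e 1)).det := by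
  have h : Nonempty N.E := ⟨e⟩
  rw [nabla, dif_pos h, det_submatrix_ne]
  set f := Classical.choice h
  have key := mul_det_updateRow_single (1 - N.closedFlow) N.weight
    (by rw [sub_mulVec, closedFlow_mulVec hN, one_mulVec, sub_self])
    (by rw [vecMul_sub, vecMul_closedFlow hN, vecMul_one, sub_self]) e f
  have h1 : (T (-N.idx e) : ℤ[T;T⁻¹]) * T (N.idx e) = 1 := by rw [← T_add]; simp
  have h2 : (T (-N.idx f) : ℤ[T;T⁻¹]) * T (N.idx f) = 1 := by rw [← T_add]; simp
  simp only [weight] at key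
  linear_combination (-T (-N.idx f) * T (-N.idx e)) * key -
    (T (-N.idx f) * ((1 - N.closedFlow).updateRow f (Pi.single f 1)).det) * h1 +
    (T (-N.idx e) * ((1 - N.closedFlow).updateRow e (Pi.single e 1)).det) * h2

/-- An edge whose row in the flow matrix is determined by the diagram. -/
def Inner (N : Net a b) (e : N.E) : Prop :=
  (∀ i, a.get i = false → N.bot i ≠ e) ∧ ∀ j, b.get j = true → N.top j ≠ e

/-- The flow matrix of a diagram that is cut open at an edge. -/
noncomputable def cut (N : Net a b) (e : N.E) : Matrix N.E N.E ℤ[T;T⁻¹] := N.F.updateRow e 0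

theorem Inner.port_ne {N : Net a a} {e : N.E} (he : N.Inner e) (i : Fin a.length) :
    port a.get N.top N.bot i ≠ e := by
  rw [port]; split_ifs with h
  · exact he.2 i h
  · exact he.1 i (by simpa using h)

/-- At an inner edge the closing strands contribute nothing to the row. The cut then affects only
the flow of the open diagram, and the closing equations remain a separate term in which a twist
matrix can later be inserted. -/
theorem nabla_eq_cut {N : Net a a} (hN : N.Good) {e : N.E} (he : N.Inner e) :
    N.nabla = T (-N.idx e) * (1 - N.cut e - conn a.get N.top N.bot 1).det := by
  rw [nabla_eq hN e]
  congr 2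
  refine funext fun f => ?_
  by_cases hf : f = e
  · subst hf
    rw [updateRow_self]
    have h1 := conn_apply_of_ne a.get N.top N.bot (1 : Matrix _ _ ℤ[T;T⁻¹]) f he.port_ne
    ext1 g
    rw [Matrix.sub_apply, Matrix.sub_apply, h1, cut, updateRow_self, Matrix.one_apply,
      Pi.single_apply]
    simp [eq_comm]
  · rw [updateRow_ne hf, closedFlow]
    ext1 g
    rw [Matrix.sub_apply, Matrix.sub_apply, Matrix.sub_apply, cut, updateRow_ne hf, Matrix.add_apply]
    ring

/-- An edge at which a strand enters the lowest layer has its equation inside the diagram. The field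
`inner` of `Layer` guarantees one even if no strand is directed upwards. -/
theorem exists_inner_cons (L : Layer a b) {N : Net b c} (hN : N.Good) :
    ∃ e, (cons L N).Inner e := by
  rcases L.inner with ⟨i, hi⟩ | ⟨j, hj⟩
  · refine ⟨Sum.inl i, ?_, ?_⟩
    · rintro k hk h
      rw [Sum.inl_injective h, hi] at hk
      cases hk
    · rintro k hk h
      cases h
  · refine ⟨Sum.inr (N.bot j), ?_, ?_⟩
    · rintro k hk h
      cases h
    · rintro k hk h
      have := hN.orient j k (Sum.inr_injective h).symm
      rw [hj, hk] at this
      cases this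

end Net

/-! ### The trace property of closed stacks -/

namespace Chain

open Matrix Net

variable {a b c : List Bool}

/-- An edge satisfying `he` may lie on the common row, but then its equation belongs to the upper
part and the lower part has a zero row there. Hence the cut changes the upper summand only. -/
theorem cut_inUpper (u : Chain a b) {N : Net b c} (e : N.E)
    (he : ∀ i, b.get i = false → N.bot i ≠ e) :
    (u.act N).cut (u.inUpper N e) =
      (indicator ℤ[T;T⁻¹] (u.inLower N))ᵀ * u.net.F * indicator ℤ[T;T⁻¹] (u.inLower N) +
      (indicator ℤ[T;T⁻¹] (u.inUpper N))ᵀ * N.cut e * indicator ℤ[T;T⁻¹] (u.inUpper N) := by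
  rw [cut, act_flow]
  refine funext fun g => ?_
  by_cases hg : g = u.inUpper N e
  · subst hg
    rw [updateRow_self]
    ext1 k
    rw [Matrix.add_apply, push_zero_row, push_zero_row]
    · simp
    · intro f hf
      rw [inUpper_injective u N hf, cut, updateRow_self]
    · intro f hf
      obtain ⟨i, rfl, rfl⟩ := eq_of_inLower_eq_inUpper u N f e hf
      exact u.net_good.zero_top i (by
        by_contra h
        exact he i (by simpa using h) rfl)
  · rw [updateRow_ne hg]
    ext1 k
    rw [Matrix.add_apply, Matrix.add_apply,
      push_congr_row (u.inUpper N) (G := N.F) (G' := N.cut e) g]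
    rintro f rfl
    rw [cut, updateRow_ne]
    rintro rfl
    exact hg rfl

theorem cut_inLower (u : Chain a b) {N : Net b c} (hN : N.Good) (e : u.net.E)
    (he : ∀ i, b.get i = true → u.net.top i ≠ e) :
    (u.act N).cut (u.inLower N e) =
      (indicator ℤ[T;T⁻¹] (u.inLower N))ᵀ * u.net.cut e * indicator ℤ[T;T⁻¹] (u.inLower N) +
      (indicator ℤ[T;T⁻¹] (u.inUpper N))ᵀ * N.F * indicator ℤ[T;T⁻¹] (u.inUpper N) := by
  rw [cut, act_flow]
  refine funext fun g => ?_
  by_cases hg : g = u.inLower N e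
  · subst hg
    rw [updateRow_self]
    ext1 k
    rw [Matrix.add_apply, push_zero_row, push_zero_row]
    · simp
    · intro f hf
      obtain ⟨i, rfl, rfl⟩ := eq_of_inLower_eq_inUpper u N e f hf.symm
      exact hN.zero_bot i (by
        by_contra h
        exact he i (by simpa using h) rfl)
    · intro f hf
      rw [inLower_injective u hN.bot_inj hf, cut, updateRow_self]
  · rw [updateRow_ne hg]
    ext1 k
    rw [Matrix.add_apply, Matrix.add_apply,
      push_congr_row (u.inLower N) (G := u.net.F) (G' := u.net.cut e) g]
    rintro f rfl
    rw [cut, updateRow_ne]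
    rintro rfl
    exact hg rfl

theorem cut_apply_zero {N : Net a b} (e f : N.E) (h : N.F f = 0) : N.cut e f = 0 := by
  rw [cut]
  by_cases hf : f = e
  · rw [hf, updateRow_self]
  · rw [updateRow_ne hf, h]

/-- The determinant of a closed diagram that is cut at an edge in its upper part. -/
theorem det_cut_inUpper (u : Chain a b) {N : Net b a} (hN : N.Good) {e : N.E} (he : N.Inner e)
    (C : Matrix (Fin a.length) (Fin a.length) ℤ[T;T⁻¹]) :
    (1 - (u.act N).cut (u.inUpper N e) - conn a.get (u.act N).top (u.act N).bot C).det =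
      (1 - fromBlocks u.net.F 0 0 (N.cut e) - conn a.get (Sum.inr ∘ N.top) (Sum.inl ∘ u.net.bot) C -
        conn b.get (Sum.inl ∘ u.net.top) (Sum.inr ∘ N.bot) 1).det := by
  have h₁ : u.inUpper N ∘ N.top = (u.act N).top := funext (inUpper_top u N)
  have h₂ : u.inLower N ∘ u.net.bot = (u.act N).bot := funext (inLower_bot u N)
  have key := det_glue b.get u.net.top N.bot (u.inLower N) (u.inUpper N) u.net_good.top_inj
    hN.bot_inj (inLower_injective u hN.bot_inj) (inUpper_injective u N) (inLower_top u N)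
    (eq_of_inLower_eq_inUpper u N) (exists_inLower_or_inUpper u N) u.net.F (N.cut e)
    (u.net_good.zero_top) (fun i hi => cut_apply_zero _ _ (hN.zero_bot i hi)) a.get N.top
    u.net.bot
    (fun k i hk hi h => by
      have := hN.orient i k h.symm
      rw [hk, hi] at this; cases this)
    (fun k i hk hi h => by
      have := u.net_good.orient k i h
      rw [hk, hi] at this; cases this) C
  rw [h₁, h₂, ← cut_inUpper u e he.1] at key
  exact key

/-- The determinant of a closed diagram that is cut at an edge in its lower part. -/
theorem det_cut_inLower (u : Chain a b) {N : Net b a} (hN : N.Good) {e : u.net.E}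
    (he : u.net.Inner e) (C : Matrix (Fin a.length) (Fin a.length) ℤ[T;T⁻¹]) :
    (1 - (u.act N).cut (u.inLower N e) - conn a.get (u.act N).top (u.act N).bot C).det =
      (1 - fromBlocks (u.net.cut e) 0 0 N.F - conn a.get (Sum.inr ∘ N.top) (Sum.inl ∘ u.net.bot) C -
        conn b.get (Sum.inl ∘ u.net.top) (Sum.inr ∘ N.bot) 1).det := by
  have h₁ : u.inUpper N ∘ N.top = (u.act N).top := funext (inUpper_top u N)
  have h₂ : u.inLower N ∘ u.net.bot = (u.act N).bot := funext (inLower_bot u N)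
  have key := det_glue b.get u.net.top N.bot (u.inLower N) (u.inUpper N) u.net_good.top_inj
    hN.bot_inj (inLower_injective u hN.bot_inj) (inUpper_injective u N) (inLower_top u N)
    (eq_of_inLower_eq_inUpper u N) (exists_inLower_or_inUpper u N) (u.net.cut e) N.F
    (fun i hi => cut_apply_zero _ _ (u.net_good.zero_top i hi)) (hN.zero_bot) a.get N.top
    u.net.bot
    (fun k i hk hi h => by
      have := hN.orient i k h.symm
      rw [hk, hi] at this; cases this)
    (fun k i hk hi h => by
      have := u.net_good.orient k i h
      rw [hk, hi] at this; cases this) C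
  rw [h₁, h₂, ← cut_inLower u hN e he.2] at key
  exact key

/-- Exchanging the two parts exchanges the roles of the gluing and the closing connection. This
symmetry makes it possible to carry one part around the axis. -/
theorem det_swap {R E₁ E₂ ι κ : Type*} [CommRing R] [Fintype E₁] [DecidableEq E₁] [Fintype E₂]
    [DecidableEq E₂] [Fintype ι] [DecidableEq ι] [Fintype κ] [DecidableEq κ] (F₁ : Matrix E₁ E₁ R)
    (F₂ : Matrix E₂ E₂ R) (x : κ → Bool) (t b : κ → E₁ ⊕ E₂) (C : Matrix κ κ R)
    (y : ι → Bool) (t' b' : ι → E₁ ⊕ E₂) (D : Matrix ι ι R) :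
    (1 - fromBlocks F₁ 0 0 F₂ - conn x t b C - conn y t' b' D).det =
      (1 - fromBlocks F₂ 0 0 F₁ - conn y (Sum.swap ∘ t') (Sum.swap ∘ b') D -
        conn x (Sum.swap ∘ t) (Sum.swap ∘ b) C).det := by
  have hpush : ∀ M : Matrix (E₁ ⊕ E₂) (E₁ ⊕ E₂) R,
      (indicator R (Sum.swap : E₁ ⊕ E₂ → E₂ ⊕ E₁))ᵀ * M * indicator R (Sum.swap : E₁ ⊕ E₂ → E₂ ⊕ E₁) =
        M.submatrix Sum.swap Sum.swap := by
    intro M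
    have h : indicator R (Sum.swap : E₁ ⊕ E₂ → E₂ ⊕ E₁) =
        (indicator R (Sum.swap : E₂ ⊕ E₁ → E₁ ⊕ E₂))ᵀ := by
      ext i j
      simp only [transpose_apply, indicator_apply]
      congr 1
      exact propext ⟨fun h => by rw [← h, Sum.swap_swap], fun h => by rw [← h, Sum.swap_swap]⟩
    rw [h, transpose_transpose, indicator_mul, mul_indicator_transpose]
    rfl
  rw [← conn_push, ← conn_push, hpush, hpush,
    ← det_submatrix_equiv_self (Equiv.sumComm E₂ E₁)]
  congr 1
  ext (i | i) (j | j) <;> simp [Matrix.sub_apply, Matrix.one_apply] <;> ring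

theorem inner_inUpper (u : Chain a b) {N : Net b c} {e : N.E} (he : N.Inner e) :
    (u.act N).Inner (u.inUpper N e) := by
  constructor
  · intro i hi h
    rw [← inLower_bot] at h
    obtain ⟨k, hk, rfl⟩ := eq_of_inLower_eq_inUpper u N _ _ h
    exact he.1 k ((u.net_good.orient i k hk).symm.trans hi) rfl
  · intro j hj h
    rw [← inUpper_top] at h
    exact he.2 j hj (inUpper_injective u N h)

theorem inner_inLower (u : Chain a b) {N : Net b c} (hN : N.Good) {e : u.net.E}
    (he : u.net.Inner e) : (u.act N).Inner (u.inLower N e) := by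
  constructor
  · intro i hi h
    rw [← inLower_bot] at h
    exact he.1 i hi (inLower_injective u hN.bot_inj h)
  · intro j hj h
    rw [← inUpper_top] at h
    obtain ⟨k, rfl, hk⟩ := eq_of_inLower_eq_inUpper u N _ _ h.symm
    exact he.2 k ((hN.orient k j hk.symm).trans hj) rfl

/-- A diagram does not change if a part of it is moved around the axis. -/
theorem nabla_comp_comm (u : Chain a b) (v : Chain b a) {e : v.net.E} (he : v.net.Inner e) :
    (u.comp v).net.nabla = (v.comp u).net.nabla := by
  rw [net_comp, net_comp, nabla_eq_cut (u.act_good v.net_good) (inner_inUpper u he),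
    nabla_eq_cut (v.act_good u.net_good) (inner_inLower v u.net_good he), idx_inUpper,
    idx_inLower v u.net_good, det_cut_inUpper u v.net_good he, det_cut_inLower v u.net_good he,
    det_swap]
  rfl

end Chain

/-! ### Moving a twist across a part of a closed diagram -/

section LinearAlgebra

open Matrix

variable {R : Type*} [CommRing R] {κ E₁ E₂ : Type*}

theorem port_injective {E : Type*} {x : κ → Bool} {t b : κ → E} (ht : Function.Injective t)
    (hb : Function.Injective b) (h : ∀ i j, x i = true → x j = false → t i ≠ b j) :
    Function.Injective (port x t b) := by
  intro i j hij
  simp only [port] at hij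
  by_cases hi : x i = true <;> by_cases hj : x j = true
  · rw [if_pos hi, if_pos hj] at hij; exact ht hij
  · rw [if_pos hi, if_neg hj] at hij; exact absurd hij (h i j hi (by simpa using hj))
  · rw [if_neg hi, if_pos hj] at hij; exact absurd hij.symm (h j i hj (by simpa using hi))
  · rw [if_neg hi, if_neg hj] at hij; exact hb hij

/-- A full twist may be moved across a part of a closed diagram. -/
theorem det_move_twist [Fintype κ] [DecidableEq κ] [Fintype E₁] [DecidableEq E₁] [Fintype E₂]
    [DecidableEq E₂] (x : κ → Bool) (t₁ b₁ : κ → E₁) (t₂ b₂ : κ → E₂)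
    (ht₁ : Function.Injective t₁) (hb₁ : Function.Injective b₁) (ht₂ : Function.Injective t₂)
    (hb₂ : Function.Injective b₂) (h₁ : ∀ i j, x i = true → x j = false → t₁ i ≠ b₁ j)
    (h₂ : ∀ i j, x i = true → x j = false → t₂ i ≠ b₂ j)
    (F₁ : Matrix E₁ E₁ R) (F₂ : Matrix E₂ E₂ R) (hF₁ : ∀ i, F₁ (port x t₁ b₁ i) = 0)
    (hF₂ : ∀ i, F₂ (port x t₂ b₂ i) = 0) (w : E₁ → R) (ω : κ → R)
    (hwt : ∀ i, w (t₁ i) = ω i) (hwb : ∀ i, w (b₁ i) = ω i)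
    (hrow : F₁ *ᵥ 1 = 1 - (1 : κ → R) ᵥ* indicator R (port x t₁ b₁))
    (hcol : w ᵥ* F₁ = w - ω ᵥ* indicator R (port x b₁ t₁))
    (z α α' c : R) (hα : α * α' = 1) (ℓ : κ → R) (hℓ : ℓ = z • (ω ᵥ* orient R x))
    (hone : α + c * ∑ i, ℓ i = 1) (C : Matrix κ κ R)
    (hC : C = α • (1 : Matrix κ κ R) + c • vecMulVec 1 ℓ) :
    (1 - fromBlocks F₁ 0 0 F₂ - conn x (Sum.inr ∘ t₂) (Sum.inl ∘ b₁) C -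
        conn x (Sum.inl ∘ t₁) (Sum.inr ∘ b₂) 1).det =
      (1 - fromBlocks F₁ 0 0 F₂ - conn x (Sum.inr ∘ t₂) (Sum.inl ∘ b₁) 1 -
        conn x (Sum.inl ∘ t₁) (Sum.inr ∘ b₂) C).det := by
  set u := orientProj R x true with hu
  set d := orientProj R x false with hd
  set S := orient R x with hS
  have hdd : d * d = d := orientProj_mul_self _ _
  have huu : u * u = u := orientProj_mul_self _ _
  have hdu : d * u = 0 := orientProj_mul_not x false
  have hud : u * d = 0 := orientProj_mul_not x true
  have hut : uᵀ = u := transpose_orientProj _ _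
  have hdt : dᵀ = d := transpose_orientProj _ _
  have hSud : S = u - d := by
    rw [hS, hu, hd, orient, orientProj, orientProj, diagonal_sub]
    congr 1
    ext1 i
    by_cases h : x i = true <;> simp [h]
  set A₁ := indicator R t₁ with hA₁
  set B₁ := indicator R b₁ with hB₁
  set A₂ := indicator R t₂ with hA₂
  set B₂ := indicator R b₂ with hB₂
  have inl_eq : ∀ f : κ → E₁, indicator R (Sum.inl ∘ f : κ → E₁ ⊕ E₂) =
      fromCols (indicator R f) 0 := fun f => by
    ext i (j | j) <;> simp [indicator_apply]
  have inr_eq : ∀ f : κ → E₂, indicator R (Sum.inr ∘ f : κ → E₁ ⊕ E₂) =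
      fromCols 0 (indicator R f) := fun f => indicator_inr_comp f
  set r₁ := indicator R (port x (Sum.inl ∘ t₁) (Sum.inr ∘ b₂) : κ → E₁ ⊕ E₂) with hr₁
  set r₂ := indicator R (port x (Sum.inr ∘ t₂) (Sum.inl ∘ b₁) : κ → E₁ ⊕ E₂) with hr₂
  set r := indicator R (port x (Sum.inl ∘ t₁) (Sum.inl ∘ b₁) : κ → E₁ ⊕ E₂) with hr
  set ρ := indicator R (port x t₁ b₁) with hρ
  have hρ' : ρ = u * A₁ + d * B₁ := indicator_port _ _ _
  have hr₁' : r₁ = fromCols (u * A₁) (d * B₂) := by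
    rw [hr₁, indicator_port, inl_eq, inr_eq, mul_fromCols, mul_fromCols, ← hu, ← hd]
    ext i (j | j) <;> simp [hA₁, hB₂]
  have hr₂' : r₂ = fromCols (d * B₁) (u * A₂) := by
    rw [hr₂, indicator_port, inl_eq, inr_eq, mul_fromCols, mul_fromCols, ← hu, ← hd]
    ext i (j | j) <;> simp [hB₁, hA₂]
  have hr' : r = fromCols ρ 0 := by
    rw [hr, indicator_port, inl_eq, inl_eq, mul_fromCols, mul_fromCols, hρ', ← hu, ← hd]
    ext i (j | j) <;> simp [hA₁, hB₁]
  have hρρ : ρ * ρᵀ = 1 := indicator_mul_transpose_self (port_injective ht₁ hb₁ h₁)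
  have hρtρ : ρᵀ * ρ = A₁ᵀ * (u * A₁) + B₁ᵀ * (d * B₁) := by
    rw [hρ', transpose_add, transpose_mul, transpose_mul, hut, hdt, Matrix.add_mul, Matrix.mul_add,
      Matrix.mul_add]
    simp only [Matrix.mul_assoc]
    rw [← Matrix.mul_assoc u u, ← Matrix.mul_assoc u d, ← Matrix.mul_assoc d u,
      ← Matrix.mul_assoc d d, huu, hud, hdu, hdd]
    simp
  have hρt : ρᵀ = A₁ᵀ * u + B₁ᵀ * d := by
    rw [hρ', transpose_add, transpose_mul, transpose_mul, hut, hdt]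
  have hρu : ρᵀ * u = A₁ᵀ * u := by
    rw [hρt, Matrix.add_mul, Matrix.mul_assoc, Matrix.mul_assoc, huu, hdu]; simp
  have hρd : ρᵀ * d = B₁ᵀ * d := by
    rw [hρt, Matrix.add_mul, Matrix.mul_assoc, Matrix.mul_assoc, hud, hdd]; simp
  have hρ0 : (1 - ρᵀ * ρ) * ρᵀ = 0 := by
    rw [Matrix.sub_mul, Matrix.mul_assoc, hρρ]; simp
  set P₂ := B₂ᵀ * (d * B₂) + A₂ᵀ * (u * A₂) with hP₂
  have hP : r₁ᵀ * r₁ + r₂ᵀ * r₂ = fromBlocks (ρᵀ * ρ) 0 0 P₂ := by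
    rw [hr₁', hr₂', transpose_fromCols, transpose_fromCols, fromRows_mul_fromCols,
      fromRows_mul_fromCols, fromBlocks_add]
    simp only [transpose_mul, hut, hdt, Matrix.mul_assoc]
    rw [← Matrix.mul_assoc u u, ← Matrix.mul_assoc u d, ← Matrix.mul_assoc d u,
      ← Matrix.mul_assoc d d, ← Matrix.mul_assoc u u, ← Matrix.mul_assoc u d,
      ← Matrix.mul_assoc d u, ← Matrix.mul_assoc d d, huu, hud, hdu, hdd, hρtρ]
    simp [hP₂]
  have hρF : ρ * F₁ = 0 := by
    rw [hρ, indicator_mul]; ext i j; exact congrFun (hF₁ i) j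
  have hr₁r₁ : r₁ * r₁ᵀ = 1 := indicator_mul_transpose_self (port_injective
    (Sum.inl_injective.comp ht₁) (Sum.inr_injective.comp hb₂) fun i j _ _ h => by cases h)
  have hr₂r₂ : r₂ * r₂ᵀ = 1 := indicator_mul_transpose_self (port_injective
    (Sum.inr_injective.comp ht₂) (Sum.inl_injective.comp hb₁) fun i j _ _ h => by cases h)
  have hr₁r₂ : r₁ * r₂ᵀ = 0 := by
    refine indicator_mul_transpose_of_ne fun i j => ?_
    simp only [port]
    by_cases hi : x i = true <;> by_cases hj : x j = true <;> simp [hi, hj]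
    · exact h₁ i j hi (by simpa using hj)
    · exact fun h => h₂ j i hj (by simpa using hi) h.symm
  have hr₂r₁ : r₂ * r₁ᵀ = 0 := by
    rw [← transpose_transpose r₂, ← transpose_mul, hr₁r₂, transpose_zero]
  have hr₁F : r₁ * fromBlocks F₁ 0 0 F₂ = 0 := by
    rw [hr₁, indicator_mul]
    ext i (j | j) <;> by_cases hi : x i = true <;> simp [port, hi]
    · have := congrFun (hF₁ i) j; simpa [port, hi] using this
    · have := congrFun (hF₂ i) j; simpa [port, hi] using this
  have hr₂F : r₂ * fromBlocks F₁ 0 0 F₂ = 0 := by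
    rw [hr₂, indicator_mul]
    ext i (j | j) <;> by_cases hi : x i = true <;> simp [port, hi]
    · have := congrFun (hF₁ i) j; simpa [port, hi] using this
    · have := congrFun (hF₂ i) j; simpa [port, hi] using this
  set A := 1 - fromBlocks F₁ 0 0 F₂ - (r₁ᵀ * r₁ + r₂ᵀ * r₂) with hA
  have hA' : A = fromBlocks (1 - F₁ - ρᵀ * ρ) 0 0 (1 - F₂ - P₂) := by
    rw [hA, hP, ← fromBlocks_one, fromBlocks_sub, fromBlocks_sub]; simp
  have hw : w ᵥ* ρᵀ = ω := by
    ext1 i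
    have : w (port x t₁ b₁ i) = ω i := by rw [port]; split_ifs <;> simp [hwt, hwb]
    simp [hρ, vecMul, dotProduct, indicator_apply, this]
  have hports : indicator R (port x b₁ t₁) - ρ = S * (B₁ - A₁) := by
    rw [hρ', indicator_port, hSud, Matrix.mul_sub, Matrix.sub_mul, Matrix.sub_mul]
    abel
  -- The conservation law: the weighted sum of the inner equations of the first part is the signed
  -- weighted sum at its bottom minus that at its top.
  have hwA : w ᵥ* (1 - F₁ - ρᵀ * ρ) = ω ᵥ* (S * (A₁ - B₁)) * (-1) := by
    rw [vecMul_sub, vecMul_sub, hcol, vecMul_one, ← vecMul_vecMul, hw,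
      show S * (A₁ - B₁) = -(S * (B₁ - A₁)) by rw [← Matrix.mul_neg, neg_sub], ← hports,
      vecMul_neg, vecMul_sub]
    ext1 i
    simp only [Pi.sub_apply, Pi.mul_apply, Pi.neg_apply, Pi.one_apply]
    ring
  -- J projects to the variables of the first part, and `v` is its constant solution. In `lam` the
  -- weights at the ports are removed, so that only equations inside the first part are combined;
  -- the connection rows remain untouched.
  have key := det_move A (fromBlocks 1 0 0 0) r₁ r₂ (fromCols A₁ 0) (fromCols 0 B₂) (fromCols 0 A₂)
    (fromCols B₁ 0) r S (replicateCol Unit 1) (replicateCol Unit (Sum.elim 1 0))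
    (replicateRow Unit ℓ) (replicateRow Unit (Sum.elim (z • (w ᵥ* (1 - ρᵀ * ρ))) 0)) α α' c hα
    (orient_mul_self x) hr₁r₁ hr₂r₂ hr₁r₂ hr₂r₁
    (by
      rw [hA, Matrix.mul_sub, Matrix.mul_sub, Matrix.mul_add, ← Matrix.mul_assoc,
        ← Matrix.mul_assoc, hr₁r₁, hr₁r₂, hr₁F]
      simp)
    (by
      rw [hA, Matrix.mul_sub, Matrix.mul_sub, Matrix.mul_add, ← Matrix.mul_assoc,
        ← Matrix.mul_assoc, hr₂r₁, hr₂r₂, hr₂F]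
      simp)
    (by simp [fromBlocks_multiply]) (by rw [hA']; simp [fromBlocks_multiply])
    (by rw [fromCols_mul_fromBlocks]; simp) (by rw [fromCols_mul_fromBlocks]; simp)
    (by rw [fromCols_mul_fromBlocks]; simp) (by rw [fromCols_mul_fromBlocks]; simp)
    (by
      rw [hP, hr', transpose_fromCols, fromRows_mul_fromCols, fromBlocks_multiply]; simp)
    (by
      rw [hP, hr', transpose_fromCols, fromRows_mul_fromCols, fromBlocks_multiply]; simp)
    (by rw [hr', transpose_fromCols, fromCols_mul_fromRows, hρρ]; simp)
    (by
      rw [hA', ← replicateCol_mulVec, fromBlocks_mulVec]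
      have : (1 - F₁ - ρᵀ * ρ) *ᵥ 1 = 0 := by
        rw [sub_mulVec, sub_mulVec, hrow, one_mulVec, ← mulVec_mulVec, show ρ *ᵥ 1 = 1 by ext1 i; simp [hρ, mulVec, dotProduct, indicator_apply],
          mulVec_transpose]
        abel
      ext (i | i) j
      · simpa using congrFun this i
      · simp)
    (by
      rw [← replicateCol_mulVec, fromBlocks_mulVec]
      ext (i | i) j <;> simp)
    (by
      ext i j
      simp [Matrix.mul_apply, hA₁, indicator_apply])
    (by
      ext i j
      simp [Matrix.mul_apply, hB₁, indicator_apply])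
    (by
      have hz : (1 - ρᵀ * ρ) * (1 - F₁ - ρᵀ * ρ) = 1 - F₁ - ρᵀ * ρ := by
        rw [Matrix.sub_mul, Matrix.one_mul, Matrix.mul_assoc, Matrix.mul_sub, Matrix.mul_sub,
          Matrix.mul_sub ρ, hρF, ← Matrix.mul_assoc ρ, hρρ]
        simp
      have h3 : (z • (w ᵥ* (1 - ρᵀ * ρ))) ᵥ* (1 - F₁ - ρᵀ * ρ) = ℓ ᵥ* (B₁ - A₁) := by
        rw [smul_vecMul, vecMul_vecMul, hz, hwA, hℓ, smul_vecMul, vecMul_vecMul,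
          show B₁ - A₁ = -(A₁ - B₁) by abel, Matrix.mul_neg, vecMul_neg]
        simp
      rw [hA', ← replicateRow_vecMul, vecMul_fromBlocks]
      have h4 : (fromCols B₁ 0 - fromCols A₁ 0 : Matrix κ (E₁ ⊕ E₂) R) = fromCols (B₁ - A₁) 0 := by
        ext i (j | j) <;> simp
      rw [h4, ← replicateRow_vecMul, vecMul_fromCols]
      ext i (j | j)
      · simpa using congrFun h3 j
      · simp)
    (by
      have h3 : (1 - ρᵀ * ρ) * (A₁ᵀ * u) = 0 := by
        rw [← hρu, ← Matrix.mul_assoc, hρ0, Matrix.zero_mul]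
      rw [hr₁', transpose_fromCols, transpose_mul, hut, ← replicateRow_vecMul,
        sumElim_vecMul_fromRows, smul_vecMul, vecMul_vecMul, h3]
      simp)
    (by
      have h3 : (1 - ρᵀ * ρ) * (B₁ᵀ * d) = 0 := by
        rw [← hρd, ← Matrix.mul_assoc, hρ0, Matrix.zero_mul]
      rw [hr₂', transpose_fromCols, transpose_mul, hdt, ← replicateRow_vecMul,
        sumElim_vecMul_fromRows, smul_vecMul, vecMul_vecMul, h3]
      simp)
    (by
      ext i j
      simp only [Matrix.add_apply, Matrix.smul_apply, Matrix.mul_apply, replicateRow_apply,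
        replicateCol_apply, Pi.one_apply, mul_one, smul_eq_mul]
      simpa using hone) C (by rw [hC, ← vecMulVec_eq])
  have e1 : ∀ C D : Matrix κ κ R, 1 - fromBlocks F₁ 0 0 F₂ - conn x (Sum.inr ∘ t₂) (Sum.inl ∘ b₁) C -
      conn x (Sum.inl ∘ t₁) (Sum.inr ∘ b₂) D = A + r₁ᵀ * (S * (fromCols A₁ 0 - D * fromCols 0 B₂)) +
        r₂ᵀ * (S * (fromCols 0 A₂ - C * fromCols B₁ 0)) := by
    intro C D
    rw [conn, conn, ← hr₁, ← hr₂, inl_eq, inl_eq, inr_eq, inr_eq, hA, Matrix.mul_sub,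
      Matrix.mul_sub r₁ᵀ]
    abel
  rw [e1, e1, Matrix.one_mul, Matrix.one_mul]
  exact key.symm

end LinearAlgebra

/-- The linear form `(t^{-1/2} - t^{1/2}) ∑ ± t^{index} v_i` on the strands of a row. -/
noncomputable def twistForm (a : List Bool) : Fin a.length → ℤ[T;T⁻¹] :=
  (T (-1) - T 1 : ℤ[T;T⁻¹]) • Matrix.vecMul (rowWeight a) (orient ℤ[T;T⁻¹] a.get)

/-- The matrices that can be moved around the axis; among them are those of the full twists. -/
def IsTwist (a : List Bool) (C : Matrix (Fin a.length) (Fin a.length) ℤ[T;T⁻¹]) : Prop :=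
  ∃ α α' c : ℤ[T;T⁻¹], α * α' = 1 ∧ α + c * ∑ i, twistForm a i = 1 ∧
    C = α • (1 : Matrix _ _ ℤ[T;T⁻¹]) + c • Matrix.vecMulVec 1 (twistForm a)

namespace Chain

open Matrix Net

variable {a b c : List Bool}

theorem zero_port {N : Net a a} (hN : N.Good) (i : Fin a.length) :
    N.F (port a.get N.top N.bot i) = 0 := by
  rw [port]
  split_ifs with h
  · exact hN.zero_top i h
  · exact hN.zero_bot i (by simpa using h)

/-- A twist may be moved across a part of a closed diagram. -/
theorem det_cut_twist_comm (u v : Chain a a) {e : v.net.E} (he : v.net.Inner e)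
    {C : Matrix (Fin a.length) (Fin a.length) ℤ[T;T⁻¹]} (hC : IsTwist a C) :
    (1 - (u.act v.net).cut (u.inUpper v.net e) -
        conn a.get (u.act v.net).top (u.act v.net).bot C).det =
      (1 - (v.act u.net).cut (v.inLower u.net e) -
        conn a.get (v.act u.net).top (v.act u.net).bot C).det := by
  obtain ⟨α, α', c, hα, hone, hC⟩ := hC
  rw [det_cut_inUpper u v.net_good he, det_cut_inLower v u.net_good he]
  have hu := u.net_good
  have hv := v.net_good
  -- The twist is moved across `u`, while the cut lies in `v`. Thus both balance laws are available
  -- where they are needed; the cut would destroy them in `v`.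
  have key := det_move_twist a.get u.net.top u.net.bot v.net.top v.net.bot hu.top_inj hu.bot_inj
    hv.top_inj hv.bot_inj
    (fun i j hi hj h => by
      have := hu.orient j i h.symm
      rw [hi, hj] at this; cases this)
    (fun i j hi hj h => by
      have := hv.orient j i h.symm
      rw [hi, hj] at this; cases this) u.net.F (v.net.cut e) (zero_port hu)
    (fun i => cut_apply_zero _ _ (zero_port hv i)) u.net.weight (rowWeight a)
    (fun i => by rw [weight, hu.idx_top, rowWeight]) (fun i => by rw [weight, hu.idx_bot, rowWeight])
    (by
      rw [hu.row, indicator_port, vecMul_add, ← vecMul_vecMul, ← vecMul_vecMul, vecMul_orientProj,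
        vecMul_orientProj, mul_one, mul_one]
      abel)
    (by
      rw [hu.col, indicator_port, vecMul_add, ← vecMul_vecMul, ← vecMul_vecMul, vecMul_orientProj,
        vecMul_orientProj]
      abel)
    (T (-1) - T 1) α α' c hα (twistForm a) rfl hone C hC
  rw [key, det_swap]
  rfl

theorem exists_inner_of_cons (L : Layer a b) (u : Chain b c) : ∃ e, (cons L u).net.Inner e :=
  exists_inner_cons L u.net_good

/-- A diagram does not change if a part of it is moved around the axis. -/
theorem nabla_comm (u : Chain a b) (v : Chain b a) :
    (u.comp v).net.nabla = (v.comp u).net.nabla := by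
  cases v with
  | nil => rw [comp_nil]; rfl
  | cons L v =>
    obtain ⟨e, he⟩ := exists_inner_of_cons L v
    exact nabla_comp_comm u _ he

/-- A braid-like stack, in which the lower variables are the image of the upper variables under
`B`, can be removed from a closed diagram. -/
def Peels (u : Chain a b) (π : Fin a.length ≃ Fin b.length)
    (B : Matrix (Fin a.length) (Fin b.length) ℤ[T;T⁻¹]) : Prop :=
  (∀ i, b.get (π i) = a.get i) ∧ ∃ U : ℤ[T;T⁻¹], ∀ (c : List Bool) (N : Net b c), N.Good →
    ∀ e : N.E, N.Inner e → ∀ σ : Fin a.length → Fin c.length, (∀ i, c.get (σ i) = a.get i) →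
    ∀ C : Matrix (Fin a.length) (Fin a.length) ℤ[T;T⁻¹],
      (1 - (u.act N).cut (u.inUpper N e) - conn a.get ((u.act N).top ∘ σ) (u.act N).bot C).det =
        U * (1 - N.cut e - conn a.get (N.top ∘ σ) (N.bot ∘ π)
          (C * B * (indicator ℤ[T;T⁻¹] π)ᵀ)).det

theorem peels_nil (a : List Bool) : (nil a).Peels (Equiv.refl _) 1 := by
  refine ⟨fun _ => rfl, 1, fun c N hN e he σ hσ C => ?_⟩
  have h : indicator ℤ[T;T⁻¹] (Equiv.refl (Fin a.length)) = 1 := indicator_id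
  rw [h, one_mul, Matrix.mul_one, transpose_one, Matrix.mul_one]
  rfl

/-- The two diagrams are equal only by induction, so their edges live in different types; the sigma
type transports the diagram together with its edge. -/
theorem inUpper_comp {d : List Bool} (u : Chain a b) (v : Chain b c) (N : Net c d) (e : N.E) :
    (⟨(u.comp v).act N, (u.comp v).inUpper N e⟩ : Σ M : Net a d, M.E) =
      ⟨u.act (v.act N), u.inUpper (v.act N) (v.inUpper N e)⟩ := by
  induction u with
  | nil => rfl
  | cons L u ih =>
    exact congrArg (fun p : Σ M : Net _ d, M.E =>
      (⟨Net.cons L p.1, Sum.inr p.2⟩ : Σ M : Net _ d, M.E)) (ih v)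

/-- Removing the lower stack permutes the strands by π relative to the top. After reindexing by π
the top is matched through σ ∘ π⁻¹, which is why `Peels` allows an arbitrary matching σ. -/
theorem Peels.comp {u : Chain a b} {v : Chain b c} {π π' B B'} (hu : u.Peels π B)
    (hv : v.Peels π' B') : (u.comp v).Peels (π.trans π') (B * B') := by
  obtain ⟨hπ, U, hU⟩ := hu
  obtain ⟨hπ', V, hV⟩ := hv
  refine ⟨fun i => by rw [Equiv.trans_apply, hπ', hπ], U * V, fun d N hN e he σ hσ C => ?_⟩
  have h1 := hU d (v.act N) (v.act_good hN) (v.inUpper N e) (inner_inUpper v he) σ hσ C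
  have h2 := hV d N hN e he (σ ∘ π.symm)
    (fun i => by rw [Function.comp_apply, hσ, ← hπ, Equiv.apply_symm_apply])
    (C.submatrix π.symm id * B)
  have e1 : conn a.get ((v.act N).top ∘ σ) ((v.act N).bot ∘ π) (C * B * (indicator ℤ[T;T⁻¹] π)ᵀ) =
      conn b.get ((v.act N).top ∘ σ ∘ π.symm) (v.act N).bot (C.submatrix π.symm id * B) := by
    rw [← conn_reindex π b.get]
    congr 1
    · exact funext fun i => (hπ i).symm
    · ext1 i; simp
    · rw [mul_indicator_transpose]
      ext i j
      simp [Matrix.mul_apply]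
  have e2 : conn b.get (N.top ∘ σ ∘ π.symm) (N.bot ∘ π')
        (C.submatrix π.symm id * B * B' * (indicator ℤ[T;T⁻¹] π')ᵀ) =
      conn a.get (N.top ∘ σ) (N.bot ∘ π.trans π')
        (C * (B * B') * (indicator ℤ[T;T⁻¹] (π.trans π'))ᵀ) := by
    rw [← conn_reindex π b.get]
    congr 1
    · exact funext fun i => (hπ i)
    · ext1 i; simp
    · rw [mul_indicator_transpose, mul_indicator_transpose, Matrix.mul_assoc]
      ext i j
      simp [Matrix.mul_apply]
  rw [e1] at h1
  rw [e2] at h2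
  rw [mul_assoc, ← h2]
  have h3 := congrArg (fun p : Σ M : Net a d, M.E =>
    (1 - p.1.cut p.2 - conn a.get (p.1.top ∘ σ) p.1.bot C).det) (inUpper_comp u v N e)
  exact h3.trans h1

/-- τ is brought to the bottom and peeled off, leaving C in the closing equations, where it can be
moved across a part. Both sides acquire the same factor U, so its value is irrelevant. -/
theorem nabla_comp_twist_comm {τ : Chain a a} {C : Matrix (Fin a.length) (Fin a.length) ℤ[T;T⁻¹]}
    (hτ : τ.Peels (Equiv.refl _) C) (hC : IsTwist a C) (u v : Chain a a) :
    ((u.comp v).comp τ).net.nabla = ((v.comp u).comp τ).net.nabla := by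
  cases v with
  | nil => rw [comp_nil]; rfl
  | cons L v =>
    obtain ⟨e, he⟩ := exists_inner_of_cons L v
    set v' := cons L v
    obtain ⟨-, U, hU⟩ := hτ
    have h : indicator ℤ[T;T⁻¹] (Equiv.refl (Fin a.length)) = 1 := indicator_id
    have h1 := hU a (u.act v'.net) (u.act_good v'.net_good) _ (inner_inUpper u he) id
      (fun _ => rfl) 1
    have h2 := hU a (v'.act u.net) (v'.act_good u.net_good) _ (inner_inLower v' u.net_good he) id
      (fun _ => rfl) 1
    rw [Matrix.one_mul, h, transpose_one, Matrix.mul_one] at h1 h2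
    rw [← nabla_comm τ, ← nabla_comm τ, net_comp, net_comp, net_comp, net_comp,
      nabla_eq_cut (τ.act_good (u.act_good v'.net_good)) (inner_inUpper τ (inner_inUpper u he)),
      nabla_eq_cut (τ.act_good (v'.act_good u.net_good))
        (inner_inUpper τ (inner_inLower v' u.net_good he)), idx_inUpper, idx_inUpper, idx_inUpper,
      idx_inLower v' u.net_good]
    congr 1
    refine h1.trans (Eq.trans ?_ h2.symm)
    exact congrArg (U * ·) (det_cut_twist_comm u v' he hC)

end Chain

/-! ### Flow matrices of pieces as bilinear forms -/

section Form

open Matrix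

variable {E : Type} [DecidableEq E]

/-- The flow matrix of a piece, in which the crossing is replaced by its oriented smoothing if
`sm = true`. -/
noncomputable def Piece.gflow (sm : Bool) : {a b : List Bool} → Piece a b →
    (Fin a.length → E) → (Fin b.length → E) → Matrix E E ℤ[T;T⁻¹]
  | _, _, .cross x y o b, l, u =>
      let l₀ := l ⟨0, Nat.succ_pos _⟩
      let l₁ := l ⟨1, Nat.succ_lt_succ (Nat.succ_pos _)⟩
      let u₀ := u ⟨0, Nat.succ_pos _⟩
      let u₁ := u ⟨1, Nat.succ_lt_succ (Nat.succ_pos _)⟩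
      let xi := if x then l₀ else u₁
      let xo := if x then u₁ else l₀
      let yi := if y then l₁ else u₀
      let yo := if y then u₀ else l₁
      (if sm then Matrix.single xi yo 1 + Matrix.single yi xo 1
        else if o then crossingFlow (crossingSign x y o) xi xo yi yo
        else crossingFlow (crossingSign x y o) yi yo xi xo) +
      ∑ i : Fin b.length, strandFlow (b.get i) (l i.succ.succ) (u i.succ.succ)
  | _, _, .cup x b, l, u =>
      strandFlow x (u ⟨1, Nat.succ_lt_succ (Nat.succ_pos _)⟩) (u ⟨0, Nat.succ_pos _⟩) +
      ∑ i : Fin b.length, strandFlow (b.get i) (l i) (u i.succ.succ)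
  | _, _, .cap x b, l, u =>
      strandFlow x (l ⟨0, Nat.succ_pos _⟩) (l ⟨1, Nat.succ_lt_succ (Nat.succ_pos _)⟩) +
      ∑ i : Fin b.length, strandFlow (b.get i) (l i.succ.succ) (u i)
  | _, _, .skip x p, l, u =>
      strandFlow x (l ⟨0, Nat.succ_pos _⟩) (u ⟨0, Nat.succ_pos _⟩) +
      p.gflow sm (fun i => l i.succ) (fun i => u i.succ)

theorem Piece.gflow_false {a b : List Bool} (p : Piece a b) (l : Fin a.length → E)
    (u : Fin b.length → E) : p.gflow false l u = p.flow l u := by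
  induction p with
  | cross x y o b => rfl
  | cup x b => rfl
  | cap x b => rfl
  | skip x p ih => rw [gflow, flow, ih]

/-- The bilinear form of a strand, evaluated at vectors with coordinates `p`, `q` and `v`, `w` at
its lower and upper end. -/
noncomputable def strandForm (x : Bool) (p q v w : ℤ[T;T⁻¹]) : ℤ[T;T⁻¹] :=
  if x then p * w else q * v

/-- The bilinear form of the flow matrix of a piece. -/
noncomputable def Piece.form (sm : Bool) : {a b : List Bool} → Piece a b →
    (Fin a.length → ℤ[T;T⁻¹]) → (Fin b.length → ℤ[T;T⁻¹]) →
    (Fin a.length → ℤ[T;T⁻¹]) → (Fin b.length → ℤ[T;T⁻¹]) → ℤ[T;T⁻¹]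
  | _, _, .cross x y o b, pl, pu, vl, vu =>
      let pxi := if x then pl ⟨0, Nat.succ_pos _⟩ else pu ⟨1, Nat.succ_lt_succ (Nat.succ_pos _)⟩
      let vxo := if x then vu ⟨1, Nat.succ_lt_succ (Nat.succ_pos _)⟩ else vl ⟨0, Nat.succ_pos _⟩
      let pyi := if y then pl ⟨1, Nat.succ_lt_succ (Nat.succ_pos _)⟩ else pu ⟨0, Nat.succ_pos _⟩
      let vyo := if y then vu ⟨0, Nat.succ_pos _⟩ else vl ⟨1, Nat.succ_lt_succ (Nat.succ_pos _)⟩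
      (if sm then pxi * vyo + pyi * vxo
        else if o then pxi * vxo + pyi * (T (2 * crossingSign x y o) * vyo) +
          pyi * ((1 - T (2 * crossingSign x y o)) * vxo)
        else pyi * vyo + pxi * (T (2 * crossingSign x y o) * vxo) +
          pxi * ((1 - T (2 * crossingSign x y o)) * vyo)) +
      ∑ i : Fin b.length, strandForm (b.get i) (pl i.succ.succ) (pu i.succ.succ)
        (vl i.succ.succ) (vu i.succ.succ)
  | _, _, .cup x b, pl, pu, vl, vu =>
      strandForm x (pu ⟨1, Nat.succ_lt_succ (Nat.succ_pos _)⟩) (pu ⟨0, Nat.succ_pos _⟩)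
        (vu ⟨1, Nat.succ_lt_succ (Nat.succ_pos _)⟩) (vu ⟨0, Nat.succ_pos _⟩) +
      ∑ i : Fin b.length, strandForm (b.get i) (pl i) (pu i.succ.succ) (vl i) (vu i.succ.succ)
  | _, _, .cap x b, pl, pu, vl, vu =>
      strandForm x (pl ⟨0, Nat.succ_pos _⟩) (pl ⟨1, Nat.succ_lt_succ (Nat.succ_pos _)⟩)
        (vl ⟨0, Nat.succ_pos _⟩) (vl ⟨1, Nat.succ_lt_succ (Nat.succ_pos _)⟩) +
      ∑ i : Fin b.length, strandForm (b.get i) (pl i.succ.succ) (pu i) (vl i.succ.succ) (vu i)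
  | _, _, .skip x p, pl, pu, vl, vu =>
      strandForm x (pl ⟨0, Nat.succ_pos _⟩) (pu ⟨0, Nat.succ_pos _⟩) (vl ⟨0, Nat.succ_pos _⟩)
        (vu ⟨0, Nat.succ_pos _⟩) +
      p.form sm (fun i => pl i.succ) (fun i => pu i.succ) (fun i => vl i.succ) (fun i => vu i.succ)

variable [Fintype E]

theorem dotProduct_single_mulVec (p v : E → ℤ[T;T⁻¹]) (e f : E) (r : ℤ[T;T⁻¹]) :
    p ⬝ᵥ (Matrix.single e f r *ᵥ v) = p e * (r * v f) := by
  rw [single_mulVec]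
  simp [dotProduct, Function.update_apply]

theorem dotProduct_strandFlow (p v : E → ℤ[T;T⁻¹]) (x : Bool) (e f : E) :
    p ⬝ᵥ (strandFlow x e f *ᵥ v) = strandForm x (p e) (p f) (v e) (v f) := by
  rw [strandFlow, strandForm]
  split_ifs <;> rw [dotProduct_single_mulVec, one_mul]

theorem dotProduct_crossingFlow (p v : E → ℤ[T;T⁻¹]) (s : ℤ) (oi oo ui uo : E) :
    p ⬝ᵥ (crossingFlow s oi oo ui uo *ᵥ v) =
      p oi * v oo + p ui * (T (2 * s) * v uo) + p ui * ((1 - T (2 * s)) * v oo) := by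
  rw [crossingFlow, add_mulVec, add_mulVec, dotProduct_add, dotProduct_add,
    dotProduct_single_mulVec, dotProduct_single_mulVec, dotProduct_single_mulVec, one_mul]

theorem dotProduct_sum_strandFlow {ι : Type} [Fintype ι] (p v : E → ℤ[T;T⁻¹]) (x : ι → Bool)
    (e f : ι → E) : p ⬝ᵥ ((∑ i, strandFlow (x i) (e i) (f i)) *ᵥ v) =
      ∑ i, strandForm (x i) (p (e i)) (p (f i)) (v (e i)) (v (f i)) := by
  rw [Matrix.sum_mulVec, dotProduct_sum]
  exact Finset.sum_congr rfl fun i _ => dotProduct_strandFlow _ _ _ _ _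

/-- The form depends only on the coordinates at the ends of the piece and not on the ambient set of
edges. Identities between flow matrices over different edge sets thereby become scalar identities.
-/
theorem Piece.dotProduct_gflow (sm : Bool) {a b : List Bool} (q : Piece a b) (l : Fin a.length → E)
    (u : Fin b.length → E) (p v : E → ℤ[T;T⁻¹]) :
    p ⬝ᵥ (q.gflow sm l u *ᵥ v) = q.form sm (p ∘ l) (p ∘ u) (v ∘ l) (v ∘ u) := by
  induction q with
  | cross x y o b =>
    simp only [gflow, form, add_mulVec, dotProduct_add, dotProduct_sum_strandFlow,
      Function.comp_apply]
    congr 1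
    cases sm <;> cases o <;> cases x <;> cases y <;>
      simp only [if_true, Bool.false_eq_true, if_false, dotProduct_crossingFlow, add_mulVec,
        dotProduct_add, dotProduct_single_mulVec, one_mul]
  | cup x b =>
    simp only [gflow, form, add_mulVec, dotProduct_add, dotProduct_sum_strandFlow,
      dotProduct_strandFlow, Function.comp_apply]
  | cap x b =>
    simp only [gflow, form, add_mulVec, dotProduct_add, dotProduct_sum_strandFlow,
      dotProduct_strandFlow, Function.comp_apply]
  | skip x q ih =>
    simp only [gflow, form, add_mulVec, dotProduct_add, dotProduct_strandFlow, ih]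
    rfl

theorem matrix_ext_of_dotProduct {M M' : Matrix E E ℤ[T;T⁻¹]}
    (h : ∀ p v, p ⬝ᵥ (M *ᵥ v) = p ⬝ᵥ (M' *ᵥ v)) : M = M' := by
  ext1 i j
  have := h (Pi.single i 1) (Pi.single j 1)
  simpa using this

theorem dotProduct_push {E' : Type} [Fintype E'] [DecidableEq E'] (f : E → E')
    (M : Matrix E E ℤ[T;T⁻¹]) (p v : E' → ℤ[T;T⁻¹]) :
    p ⬝ᵥ (((indicator ℤ[T;T⁻¹] f)ᵀ * M * indicator ℤ[T;T⁻¹] f) *ᵥ v) = (p ∘ f) ⬝ᵥ (M *ᵥ (v ∘ f)) := by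
  have h : ∀ v : E' → ℤ[T;T⁻¹], indicator ℤ[T;T⁻¹] f *ᵥ v = v ∘ f := fun v => by
    ext1 i; simp [mulVec, dotProduct, indicator_apply]
  rw [← mulVec_mulVec, ← mulVec_mulVec, h, dotProduct_mulVec, vecMul_transpose, h]

theorem strandForm_one (x : Bool) (p p' : ℤ[T;T⁻¹]) :
    strandForm x p p' 1 1 = p * (if x = true then 1 else 0) + p' * (if x = false then 1 else 0) := by
  cases x <;> simp [strandForm]

end Form

theorem winding_cons (x : Bool) (a : List Bool) : winding (x :: a) = strandSign x + winding a := by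
  simp [winding]

theorem Piece.winding_eq {a b : List Bool} (p : Piece a b) : winding a = winding b := by
  induction p with
  | cross x y o b => simp only [winding_cons]; ring
  | cup x b => cases x <;> simp [winding_cons, strandSign]
  | cap x b => cases x <;> simp [winding_cons, strandSign]
  | skip x p ih => simp only [winding_cons, ih]

/-! ### The two balance laws for pieces -/

namespace Piece

open Matrix

variable {a b : List Bool} (sm : Bool)

/-- The form reads its first argument only at the edges where a strand enters the piece. -/
theorem form_eq_zero (q : Piece a b) {pl pu} (vl vu) (hl : ∀ i, a.get i = true → pl i = 0)
    (hu : ∀ j, b.get j = false → pu j = 0) : q.form sm pl pu vl vu = 0 := by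
  have hs : ∀ (x : Bool) (p p' v v' : ℤ[T;T⁻¹]), (x = true → p = 0) → (x = false → p' = 0) →
      strandForm x p p' v v' = 0 := by
    intro x p p' v v' h h'
    cases x
    · simp [strandForm, h' rfl]
    · simp [strandForm, h rfl]
  induction q with
  | cross x y o b =>
    have h1 : (if x = true then pl ⟨0, Nat.succ_pos _⟩
        else pu ⟨1, Nat.succ_lt_succ (Nat.succ_pos _)⟩) = 0 := by
      split_ifs with h
      · exact hl _ h
      · exact hu _ (by simpa using h)
    have h2 : (if y = true then pl ⟨1, Nat.succ_lt_succ (Nat.succ_pos _)⟩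
        else pu ⟨0, Nat.succ_pos _⟩) = 0 := by
      split_ifs with h
      · exact hl _ h
      · exact hu _ (by simpa using h)
    simp only [form, h1, h2]
    rw [Finset.sum_eq_zero fun i _ => hs _ _ _ _ _ (hl i.succ.succ) (hu i.succ.succ)]
    simp
  | cup x b =>
    simp only [form]
    rw [Finset.sum_eq_zero fun i _ => hs _ _ _ _ _ (hl i) (hu i.succ.succ), hs]
    · simp
    · intro h; exact hu _ (by simp [h])
    · intro h; exact hu _ h
  | cap x b =>
    simp only [form]
    rw [Finset.sum_eq_zero fun i _ => hs _ _ _ _ _ (hl i.succ.succ) (hu i), hs]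
    · simp
    · intro h; exact hl _ h
    · intro h; exact hl _ (by simp [h])
  | skip x q ih =>
    simp only [form]
    rw [ih _ _ (fun i hi => hl i.succ hi) (fun i hi => hu i.succ hi), hs]
    · simp
    · intro h; exact hl _ h
    · intro h; exact hu _ h

theorem form_one (q : Piece a b) (pl pu) :
    q.form sm pl pu 1 1 = pl ⬝ᵥ strandVec true a + pu ⬝ᵥ strandVec false b := by
  have hs : ∀ c : List Bool, ∀ f g : Fin c.length → ℤ[T;T⁻¹],
      ∑ i, strandForm (c.get i) (f i) (g i) 1 1 = f ⬝ᵥ strandVec true c + g ⬝ᵥ strandVec false c := by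
    intro c f g
    rw [dotProduct, dotProduct, ← Finset.sum_add_distrib]
    exact Finset.sum_congr rfl fun i _ => strandForm_one _ _ _
  have hcons : ∀ (y x : Bool) (c : List Bool) (f : Fin (x :: c).length → ℤ[T;T⁻¹]),
      f ⬝ᵥ strandVec y (x :: c) = f ⟨0, Nat.succ_pos _⟩ * (if x = y then 1 else 0) +
        (fun i : Fin c.length => f i.succ) ⬝ᵥ strandVec y c := by
    intro y x c f
    exact Fin.sum_univ_succ _
  induction q with
  | cross x y o b =>
    simp only [form, Pi.one_apply, hcons, hs]
    cases x <;> cases y <;> cases sm <;> cases o <;> simp <;> ring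
  | cup x b =>
    simp only [form, Pi.one_apply, hcons, hs]
    simp only [strandForm_one]
    cases x <;> simp <;> ring
  | cap x b =>
    simp only [form, Pi.one_apply, hcons, hs]
    simp only [strandForm_one]
    cases x <;> simp <;> ring
  | skip x q ih =>
    simp only [form, Pi.one_apply, hcons, strandForm_one]
    have := ih (fun i => pl i.succ) (fun i => pu i.succ)
    erw [this]
    ring

/-- The weight of the two strands at a crossing is conserved for all orientations and both signs,
and equally for the smoothing. The factor ω collects the winding number of the strands to the right.
-/
theorem cross_weight (x y o : Bool) (ω l₀ l₁ u₀ u₁ : ℤ[T;T⁻¹]) :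
    (if sm = true then
      (if x = true then ω * T (2 * strandSign y + strandSign x) else ω * T (strandSign x)) *
        (if y = true then u₀ else l₁) +
      (if y = true then ω * T (strandSign y) else ω * T (2 * strandSign x + strandSign y)) *
        (if x = true then u₁ else l₀)
    else if o = true then
      (if x = true then ω * T (2 * strandSign y + strandSign x) else ω * T (strandSign x)) *
        (if x = true then u₁ else l₀) +
      (if y = true then ω * T (strandSign y) else ω * T (2 * strandSign x + strandSign y)) *
        (T (2 * crossingSign x y o) * if y = true then u₀ else l₁) +
      (if y = true then ω * T (strandSign y) else ω * T (2 * strandSign x + strandSign y)) *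
        ((1 - T (2 * crossingSign x y o)) * if x = true then u₁ else l₀)
    else
      (if y = true then ω * T (strandSign y) else ω * T (2 * strandSign x + strandSign y)) *
        (if y = true then u₀ else l₁) +
      (if x = true then ω * T (2 * strandSign y + strandSign x) else ω * T (strandSign x)) *
        (T (2 * crossingSign x y o) * if x = true then u₁ else l₀) +
      (if x = true then ω * T (2 * strandSign y + strandSign x) else ω * T (strandSign x)) *
        ((1 - T (2 * crossingSign x y o)) * if y = true then u₀ else l₁)) =
    ((if x = false then 1 else 0) * (ω * T (2 * strandSign y + strandSign x)) * l₀ +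
      (if y = false then 1 else 0) * (ω * T (strandSign y)) * l₁) +
    ((if y = true then 1 else 0) * (ω * T (2 * strandSign x + strandSign y)) * u₀ +
      (if x = true then 1 else 0) * (ω * T (strandSign x)) * u₁) := by
  have e1 : strandSign true = 1 := rfl
  have e2 : strandSign false = -1 := rfl
  have e3 : crossingSign true true true = 1 := rfl
  have e4 : crossingSign true true false = -1 := rfl
  have e5 : crossingSign false false true = 1 := rfl
  have e6 : crossingSign false false false = -1 := rfl
  have e7 : crossingSign true false true = -1 := rfl
  have e8 : crossingSign true false false = 1 := rfl
  have e9 : crossingSign false true true = -1 := rfl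
  have e0 : crossingSign false true false = 1 := rfl
  have h4 : (T 1 : ℤ[T;T⁻¹]) * T (-1) = 1 := by rw [← T_add]; simp
  have h5 : (T (2 * 1) : ℤ[T;T⁻¹]) = T 1 * T 1 := by rw [← T_add]; rfl
  have h6 : (T (2 * -1) : ℤ[T;T⁻¹]) = T (-1) * T (-1) := by rw [← T_add]; rfl
  have h7 : (T (2 * 1 + 1) : ℤ[T;T⁻¹]) = T 1 * T 1 * T 1 := by rw [← T_add, ← T_add]; rfl
  have h8 : (T (2 * -1 + -1) : ℤ[T;T⁻¹]) = T (-1) * T (-1) * T (-1) := by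
    rw [← T_add, ← T_add]; rfl
  have h9 : (T (2 * 1 + -1) : ℤ[T;T⁻¹]) = T 1 := rfl
  have h0 : (T (2 * -1 + 1) : ℤ[T;T⁻¹]) = T (-1) := rfl
  cases x <;> cases y <;> cases sm <;> cases o <;>
    simp only [e1, e2, e3, e4, e5, e6, e7, e8, e9, e0, h5, h6, h7, h8, h9, h0, if_true,
      Bool.false_eq_true, if_false, Bool.true_eq_false] <;>
    clear e1 e2 e3 e4 e5 e6 e7 e8 e9 e0 h5 h6 h7 h8 h9 h0 <;>
    generalize (T 1 : ℤ[T;T⁻¹]) = P at h4 ⊢ <;> generalize (T (-1) : ℤ[T;T⁻¹]) = N at h4 ⊢ <;>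
    grind

/-- The source of the dependency among the Alexander relations. At a cup or cap the two ends have
the same weight, and the strands to the left see the same winding number below and above the piece.
-/
theorem form_rowWeight (q : Piece a b) (vl vu) :
    q.form sm (rowWeight a) (rowWeight b) vl vu =
      (strandVec false a * rowWeight a) ⬝ᵥ vl + (strandVec true b * rowWeight b) ⬝ᵥ vu := by
  have hs : ∀ c : List Bool, ∀ f g : Fin c.length → ℤ[T;T⁻¹],
      ∑ i, strandForm (c.get i) (rowWeight c i) (rowWeight c i) (f i) (g i) =
        (strandVec false c * rowWeight c) ⬝ᵥ f + (strandVec true c * rowWeight c) ⬝ᵥ g := by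
    intro c f g
    rw [dotProduct, dotProduct, ← Finset.sum_add_distrib]
    refine Finset.sum_congr rfl fun i _ => ?_
    simp only [strandForm, Pi.mul_apply, strandVec]
    generalize c.get i = x
    cases x <;> simp
  have hcons : ∀ (y x : Bool) (c : List Bool) (f : Fin (x :: c).length → ℤ[T;T⁻¹]),
      (strandVec y (x :: c) * rowWeight (x :: c)) ⬝ᵥ f =
        (if x = y then 1 else 0) * T (2 * winding c + strandSign x) * f ⟨0, Nat.succ_pos _⟩ +
        (strandVec y c * rowWeight c) ⬝ᵥ (fun i : Fin c.length => f i.succ) := by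
    intro y x c f
    exact Fin.sum_univ_succ _
  have hw0 : ∀ x c, rowWeight (x :: c) ⟨0, Nat.succ_pos _⟩ = T (2 * winding c + strandSign x) :=
    fun x c => rfl
  have hw1 : ∀ x y c, rowWeight (x :: y :: c) ⟨1, Nat.succ_lt_succ (Nat.succ_pos _)⟩ =
    T (2 * winding c + strandSign y) := fun x y c => rfl
  have hw2 : ∀ x y c (i : Fin c.length), rowWeight (x :: y :: c) i.succ.succ = rowWeight c i :=
    fun x y c i => rfl
  have hw3 : ∀ x c (i : Fin c.length), rowWeight (x :: c) i.succ = rowWeight c i :=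
    fun x c i => rfl
  induction q with
  | cross x y o b =>
    have h2 : ∀ k m : ℤ, (T (2 * (k + winding b) + m) : ℤ[T;T⁻¹]) =
      T (2 * winding b) * T (2 * k + m) := fun k m => by rw [← T_add]; congr 1; ring
    have h3 : ∀ m : ℤ, (T (2 * winding b + m) : ℤ[T;T⁻¹]) = T (2 * winding b) * T m :=
      fun m => T_add _ _
    simp only [form, hcons, hw2, hs, hw0, hw1, winding_cons, h2, h3]
    have key := cross_weight sm x y o (T (2 * winding b)) (vl ⟨0, Nat.succ_pos _⟩)
      (vl ⟨1, Nat.succ_lt_succ (Nat.succ_pos _)⟩) (vu ⟨0, Nat.succ_pos _⟩)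
      (vu ⟨1, Nat.succ_lt_succ (Nat.succ_pos _)⟩)
    rw [key]
    exact (fun A B C D E F => by ring : ∀ A B C D E F : ℤ[T;T⁻¹], A + B + (C + D) + (E + F) =
      A + (B + E) + (C + (D + F))) _ _ _ _ _ _
  | cup x b =>
    simp only [form, hcons, hw2, hs, hw0, hw1, winding_cons]
    cases x <;> simp [strandForm, strandSign] <;> ring_nf
  | cap x b =>
    simp only [form, hcons, hw2, hs, hw0, hw1, winding_cons]
    cases x <;> simp [strandForm, strandSign] <;> ring_nf
  | skip x q ih =>
    simp only [form, hcons, hw0, hw3]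
    have := ih (fun i => vl i.succ) (fun i => vu i.succ)
    erw [this]
    rw [q.winding_eq]
    cases x <;> simp [strandForm] <;> ring

end Piece

/-! ### Pieces as layers -/

namespace Piece

open Matrix

variable {a b : List Bool}

theorem inner (q : Piece a b) : (∃ i, a.get i = true) ∨ ∃ j, b.get j = false := by
  cases q with
  | cross x y o b =>
    cases x
    · exact Or.inr ⟨⟨1, Nat.succ_lt_succ (Nat.succ_pos _)⟩, rfl⟩
    · exact Or.inl ⟨⟨0, Nat.succ_pos _⟩, rfl⟩
  | cup x b =>
    cases x
    · exact Or.inr ⟨⟨0, Nat.succ_pos _⟩, rfl⟩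
    · exact Or.inr ⟨⟨1, Nat.succ_lt_succ (Nat.succ_pos _)⟩, rfl⟩
  | cap x b =>
    cases x
    · exact Or.inl ⟨⟨1, Nat.succ_lt_succ (Nat.succ_pos _)⟩, rfl⟩
    · exact Or.inl ⟨⟨0, Nat.succ_pos _⟩, rfl⟩
  | skip x p =>
    cases x
    · exact Or.inr ⟨⟨0, Nat.succ_pos _⟩, rfl⟩
    · exact Or.inl ⟨⟨0, Nat.succ_pos _⟩, rfl⟩

/-- The layer of a piece, in which the crossing is smoothed if `sm = true`. -/
noncomputable def layer (sm : Bool) (q : Piece a b) : Layer a b where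
  flow := q.gflow sm Sum.inl Sum.inr
  zero_bot := by
    intro i hi
    ext1 j
    have h := q.dotProduct_gflow sm Sum.inl Sum.inr (Pi.single (Sum.inl i) 1) (Pi.single j 1)
    rw [q.form_eq_zero] at h
    · simpa using h
    · intro k hk
      have : k ≠ i := fun h => by rw [h, hi] at hk; cases hk
      simp [this]
    · intro k hk
      simp
  zero_top := by
    intro i hi
    ext1 j
    have h := q.dotProduct_gflow sm Sum.inl Sum.inr (Pi.single (Sum.inr i) 1) (Pi.single j 1)
    rw [q.form_eq_zero] at h
    · simpa using h
    · intro k hk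
      simp
    · intro k hk
      have : k ≠ i := fun h => by rw [h, hi] at hk; cases hk
      simp [this]
  row := by
    refine dotProduct_eq _ _ fun p => ?_
    rw [dotProduct_comm, dotProduct_gflow, dotProduct_comm _ p]
    refine (q.form_one sm _ _).trans ?_
    simp [dotProduct]
  col := by
    refine dotProduct_eq _ _ fun v => ?_
    rw [← dotProduct_mulVec, dotProduct_gflow]
    refine (q.form_rowWeight sm _ _).trans ?_
    simp [dotProduct]
  inner := q.inner

theorem gflow_cons_eq (sm : Bool) {E : Type} [Fintype E] [DecidableEq E] (p : Piece a b)
    (bot : Fin b.length → E) (F : Matrix E E ℤ[T;T⁻¹]) :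
    p.gflow sm (E := Fin a.length ⊕ E) Sum.inl (fun i => Sum.inr (bot i)) + fromBlocks 0 0 0 F =
      fromBlocks (p.layer sm).flow.toBlocks₁₁
        ((p.layer sm).flow.toBlocks₁₂ * indicator ℤ[T;T⁻¹] bot)
        ((indicator ℤ[T;T⁻¹] bot)ᵀ * (p.layer sm).flow.toBlocks₂₁)
        ((indicator ℤ[T;T⁻¹] bot)ᵀ * (p.layer sm).flow.toBlocks₂₂ * indicator ℤ[T;T⁻¹] bot + F) := by
  set L := (p.layer sm).flow with hL
  set f : Fin a.length ⊕ Fin b.length → Fin a.length ⊕ E := Sum.map id bot with hf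
  have h1 : p.gflow sm (E := Fin a.length ⊕ E) Sum.inl (fun i => Sum.inr (bot i)) =
      (indicator ℤ[T;T⁻¹] f)ᵀ * L * indicator ℤ[T;T⁻¹] f := by
    refine matrix_ext_of_dotProduct fun p' v => ?_
    rw [dotProduct_push, dotProduct_gflow, hL, layer,
      dotProduct_gflow]
    rfl
  have h2 : indicator ℤ[T;T⁻¹] f = fromBlocks 1 0 0 (indicator ℤ[T;T⁻¹] bot) := by
    ext (i | i) (j | j) <;> simp [hf, indicator_apply, Matrix.one_apply]
  rw [h1, h2, fromBlocks_transpose]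
  conv_lhs => rw [← fromBlocks_toBlocks L, fromBlocks_multiply, fromBlocks_multiply, fromBlocks_add]
  simp

end Piece

/-! ### From tangle diagrams to stacks of layers -/

namespace Tangle

open Matrix

variable {a b c : List Bool}

/-- The stack of layers of a tangle diagram. -/
noncomputable def toChain : {a b : List Bool} → Tangle a b → Chain a b
  | _, _, .nil a => .nil a
  | _, _, .cons p w => .cons (p.layer false) w.toChain

theorem toChain_comp (u : Tangle a b) (v : Tangle b c) :
    (u.comp v).toChain = u.toChain.comp v.toChain := by
  induction u with
  | nil => rfl
  | cons p u ih => simp only [comp, toChain, Chain.comp, ih]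

/-- The network of a tangle diagram. -/
noncomputable def toNet (w : Tangle a b) : Net a b where
  E := w.Edge
  bot := w.bottom
  top := w.top
  F := w.flow
  idx := w.edgeIndex

/-- Edges, ends and indices agree by definition at each step; the content is the comparison of flow
matrices in `Piece.gflow_cons_eq`. -/
theorem toNet_eq (w : Tangle a b) : w.toNet = w.toChain.net := by
  induction w with
  | nil a => rfl
  | @cons a b c p w ih =>
    have h : (cons p w).toNet = Net.cons (p.layer false) w.toNet := by
      have h2 := p.gflow_cons_eq false w.bottom w.flow
      rw [Piece.gflow_false] at h2
      exact congrArg (fun F => (Net.mk (Fin a.length ⊕ w.Edge) Sum.inl (Sum.inr ∘ w.top) F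
        (Sum.elim (rowIndex a) w.edgeIndex) : Net a c)) h2
    rw [h, ih]
    rfl

theorem alexander_eq (w : Tangle a a) :
    w.alexander = T (w.rotation - w.writhe) * w.toChain.net.nabla := by
  rw [← toNet_eq]
  have hc : w.toNet.closedFlow = w.closedFlow := by
    rw [Net.closedFlow, closedFlow, conn_one]
    rfl
  rw [alexander, Net.nabla]
  by_cases h : Nonempty w.Edge
  · rw [dif_pos h, dif_pos (show Nonempty w.toNet.E from h), alexanderAt, hc, ← mul_assoc, ← T_add,
      ← sub_eq_add_neg]
    rfl
  · rw [dif_neg h, dif_neg (show ¬Nonempty w.toNet.E from h), mul_zero]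

end Tangle

/-! ### The skein relation -/

section Skein

open Matrix

variable {E : Type} [DecidableEq E]

/-- The flow of a crossing of two strands, of sign `s` if the first strand is the upper one
(`o = true`) and of sign `-s` otherwise. -/
noncomputable def coreFlow (o : Bool) (s : ℤ) (xi xo yi yo : E) : Matrix E E ℤ[T;T⁻¹] :=
  if o then crossingFlow s xi xo yi yo else crossingFlow (-s) yi yo xi xo

theorem crossingSign_eq (x y o : Bool) :
    crossingSign x y o = if o then crossingSign x y true else -crossingSign x y true := by
  cases x <;> cases y <;> cases o <;> rfl

/-- The crossing, its change and its smoothing share everything except the rows `xi` and `yi`. Here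
s is the sign when the first strand is over. The edge `xo` avoids both rows and serves as the common
place to cut. -/
theorem Piece.CrossingChange.exists_coreFlow {a b : List Bool} {p p' : Piece a b}
    (h : Piece.CrossingChange p p') (l : Fin a.length → E) (u : Fin b.length → E)
    (hl : Function.Injective l) (hu : Function.Injective u) (hlu : ∀ i j, l i ≠ u j) :
    ∃ (o : Bool) (s : ℤ) (xi xo yi yo : E) (G : Matrix E E ℤ[T;T⁻¹]), xi ≠ yi ∧ xo ≠ xi ∧ xo ≠ yi ∧
      p.gflow false l u = G + coreFlow o s xi xo yi yo ∧
      p'.gflow false l u = G + coreFlow (!o) s xi xo yi yo ∧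
      p.gflow true l u = G + (Matrix.single xi yo 1 + Matrix.single yi xo 1) ∧
      p.writhe = (if o then s else -s) ∧ p'.writhe = if o then -s else s := by
  induction h with
  | cross x y o b =>
    have h01 : l ⟨0, Nat.succ_pos _⟩ ≠ l ⟨1, Nat.succ_lt_succ (Nat.succ_pos _)⟩ := hl.ne (by simp)
    have u01 : u ⟨0, Nat.succ_pos _⟩ ≠ u ⟨1, Nat.succ_lt_succ (Nat.succ_pos _)⟩ := hu.ne (by simp)
    refine ⟨o, crossingSign x y true,
      if x then l ⟨0, Nat.succ_pos _⟩ else u ⟨1, Nat.succ_lt_succ (Nat.succ_pos _)⟩,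
      if x then u ⟨1, Nat.succ_lt_succ (Nat.succ_pos _)⟩ else l ⟨0, Nat.succ_pos _⟩,
      if y then l ⟨1, Nat.succ_lt_succ (Nat.succ_pos _)⟩ else u ⟨0, Nat.succ_pos _⟩,
      if y then u ⟨0, Nat.succ_pos _⟩ else l ⟨1, Nat.succ_lt_succ (Nat.succ_pos _)⟩,
      ∑ i : Fin b.length, strandFlow (b.get i) (l i.succ.succ) (u i.succ.succ),
      ?_, ?_, ?_, ?_, ?_, ?_, ?_, ?_⟩
    · cases x <;> cases y <;> simp only [if_true, Bool.false_eq_true, if_false] <;>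
        first | exact h01 | exact u01.symm | exact hlu _ _ | exact (hlu _ _).symm
    · cases x <;> simp only [if_true, Bool.false_eq_true, if_false] <;>
        first | exact hlu _ _ | exact (hlu _ _).symm
    · cases x <;> cases y <;> simp only [if_true, Bool.false_eq_true, if_false] <;>
        first | exact h01 | exact u01.symm | exact hlu _ _ | exact (hlu _ _).symm
    · rw [Piece.gflow, add_comm, coreFlow, crossingSign_eq x y o]
      cases o <;> rfl
    · rw [Piece.gflow, add_comm, coreFlow, crossingSign_eq x y (!o)]
      cases o <;> rfl
    · rw [Piece.gflow, add_comm]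
      rfl
    · rw [Piece.writhe, crossingSign_eq]
    · rw [Piece.writhe, crossingSign_eq]
      cases o <;> rfl
  | skip x h ih =>
    obtain ⟨o, s, xi, xo, yi, yo, G, h1, h2, h3, h4, h5, h6, h7, h8⟩ :=
      ih (fun i => l i.succ) (fun i => u i.succ) (fun i j hij => Fin.succ_injective _ (hl hij))
        (fun i j hij => Fin.succ_injective _ (hu hij)) (fun i j => hlu _ _)
    refine ⟨o, s, xi, xo, yi, yo, strandFlow x (l ⟨0, Nat.succ_pos _⟩) (u ⟨0, Nat.succ_pos _⟩) + G,
      h1, h2, h3, ?_, ?_, ?_, h7, h8⟩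
    · rw [Piece.gflow, h4, add_assoc]
    · rw [Piece.gflow, h5, add_assoc]
    · rw [Piece.gflow, h6, add_assoc]

variable [Fintype E]

/-- Cutting at `xo` leaves the rows `xi` and `yi` intact, so the three determinants differ in just
these two rows and `det_updateRow_skein` applies with p = T s. -/
theorem det_skein (H : Matrix E E ℤ[T;T⁻¹]) (s : ℤ) {xi xo yi yo : E} (h₁ : xi ≠ yi) (h₂ : xo ≠ xi)
    (h₃ : xo ≠ yi) :
    T (-s) * ((1 - (H + coreFlow true s xi xo yi yo)).updateRow xo (Pi.single xo 1)).det -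
      T s * ((1 - (H + coreFlow false s xi xo yi yo)).updateRow xo (Pi.single xo 1)).det =
    (T (-s) - T s) * ((1 - (H + (Matrix.single xi yo 1 + Matrix.single yi xo 1))).updateRow xo
      (Pi.single xo 1)).det := by
  have hpq : (T s : ℤ[T;T⁻¹]) * T (-s) = 1 := by rw [← T_add]; simp
  have hp : (T (2 * s) : ℤ[T;T⁻¹]) = T s * T s := by rw [← T_add, two_mul]
  have hq : (T (2 * -s) : ℤ[T;T⁻¹]) = T (-s) * T (-s) := by rw [← T_add, two_mul]
  have key := det_updateRow_skein ((1 - H).updateRow xo (Pi.single xo 1)) h₁ ((1 - H) xi)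
    ((1 - H) yi) (Pi.single xo 1) (Pi.single yo 1) (T s) (T (-s)) hpq
  have aux : ∀ M : Matrix E E ℤ[T;T⁻¹], (∀ f, f ≠ xi → f ≠ yi → M f = 0) →
      (1 - (H + M)).updateRow xo (Pi.single xo 1) =
        (((1 - H).updateRow xo (Pi.single xo 1)).updateRow xi ((1 - H) xi - M xi)).updateRow yi
          ((1 - H) yi - M yi) := by
    intro M hM
    refine funext fun f => ?_
    by_cases hy : f = yi
    · subst hy
      rw [updateRow_self, updateRow_ne h₃.symm]
      ext1 g
      simp only [Matrix.sub_apply, Matrix.add_apply, Pi.sub_apply]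
      ring
    rw [updateRow_ne hy]
    by_cases hx : f = xi
    · subst hx
      rw [updateRow_self, updateRow_ne h₂.symm]
      ext1 g
      simp only [Matrix.sub_apply, Matrix.add_apply, Pi.sub_apply]
      ring
    rw [updateRow_ne hx]
    by_cases ho : f = xo
    · subst ho; rw [updateRow_self, updateRow_self]
    rw [updateRow_ne ho, updateRow_ne ho]
    ext1 g
    simp only [Matrix.sub_apply, Matrix.add_apply, hM f hx hy, Pi.zero_apply, add_zero]
  have e1 : ∀ f, f ≠ xi → f ≠ yi → coreFlow true s xi xo yi yo f = 0 := by
    intro f hx hy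
    ext1 g
    simp [coreFlow, crossingFlow, hx.symm, hy.symm]
  have e2 : ∀ f, f ≠ xi → f ≠ yi → coreFlow false s xi xo yi yo f = 0 := by
    intro f hx hy
    ext1 g
    simp [coreFlow, crossingFlow, hx.symm, hy.symm]
  have e3 : ∀ f, f ≠ xi → f ≠ yi → (Matrix.single xi yo 1 + Matrix.single yi xo 1 :
      Matrix E E ℤ[T;T⁻¹]) f = 0 := by
    intro f hx hy
    ext1 g
    simp [hx.symm, hy.symm]
  have f1 : coreFlow true s xi xo yi yo xi = Pi.single xo 1 := by
    ext1 g
    simp [coreFlow, crossingFlow, Matrix.single_apply, h₁.symm, Pi.single_apply, eq_comm]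
  have f2 : coreFlow true s xi xo yi yo yi =
      (T s * T s : ℤ[T;T⁻¹]) • Pi.single yo 1 + (1 - T s * T s : ℤ[T;T⁻¹]) • Pi.single xo 1 := by
    ext1 g
    simp [coreFlow, crossingFlow, Matrix.single_apply, h₁, Pi.single_apply, eq_comm, hp]
  have f3 : coreFlow false s xi xo yi yo yi = Pi.single yo 1 := by
    ext1 g
    simp [coreFlow, crossingFlow, Matrix.single_apply, h₁, Pi.single_apply, eq_comm]
  have f4 : coreFlow false s xi xo yi yo xi =
      (T (-s) * T (-s) : ℤ[T;T⁻¹]) • Pi.single xo 1 +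
        (1 - T (-s) * T (-s) : ℤ[T;T⁻¹]) • Pi.single yo 1 := by
    ext1 g
    have := hq
    rw [mul_neg] at this
    simp [coreFlow, crossingFlow, Matrix.single_apply, h₁.symm, Pi.single_apply, eq_comm, this]
  have f5 : (Matrix.single xi yo 1 + Matrix.single yi xo 1 : Matrix E E ℤ[T;T⁻¹]) xi =
      Pi.single yo 1 := by
    ext1 g
    simp [Matrix.single_apply, h₁.symm, Pi.single_apply, eq_comm]
  have f6 : (Matrix.single xi yo 1 + Matrix.single yi xo 1 : Matrix E E ℤ[T;T⁻¹]) yi =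
      Pi.single xo 1 := by
    ext1 g
    simp [Matrix.single_apply, h₁, Pi.single_apply, eq_comm]
  rw [aux _ e1, aux _ e2, aux _ e3, f1, f2, f3, f4, f5, f6, ← sub_sub, ← sub_sub]
  exact key

end Skein

namespace Piece

open Matrix Net

variable {a b : List Bool}

theorem CrossingChange.writhe_eq {p p' : Piece a b} (h : CrossingChange p p') :
    p'.writhe = -p.writhe := by
  induction h with
  | cross x y o b => rw [writhe, writhe, crossingSign_eq, crossingSign_eq x y o]; cases o <;> simp
  | skip x h ih => exact ih

theorem CrossingChange.turning_eq {p p' : Piece a b} (h : CrossingChange p p') :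
    p'.turning = p.turning := by
  induction h with
  | cross x y o b => rfl
  | skip x h ih => exact ih

/-- The skein relation. -/
theorem CrossingChange.nabla_cons {p p' : Piece a b} (h : CrossingChange p p') {N : Net b a}
    (hN : N.Good) :
    T (-p.writhe) * (Net.cons (p.layer false) N).nabla -
      T p.writhe * (Net.cons (p'.layer false) N).nabla =
    (T (-p.writhe) - T p.writhe) * (Net.cons (p.layer true) N).nabla := by
  obtain ⟨o, s, xi, xo, yi, yo, G, h1, h2, h3, h4, h5, h6, h7, h8⟩ :=
    h.exists_coreFlow (Sum.inl : Fin a.length → Fin a.length ⊕ N.E) (fun i => Sum.inr (N.bot i))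
      Sum.inl_injective (Sum.inr_injective.comp hN.bot_inj) (fun i j h => by cases h)
  set K : Matrix (Fin a.length ⊕ N.E) (Fin a.length ⊕ N.E) ℤ[T;T⁻¹] :=
    fromBlocks 0 0 0 N.F + conn a.get (Sum.inr ∘ N.top) Sum.inl 1 with hK
  have aux : ∀ (q : Piece a b) (sm : Bool) (M : Matrix (Fin a.length ⊕ N.E) (Fin a.length ⊕ N.E) _),
      q.gflow sm (Sum.inl : Fin a.length → Fin a.length ⊕ N.E) (fun i => Sum.inr (N.bot i)) = G + M →
      (Net.cons (q.layer sm) N).nabla = T (-Sum.elim (rowIndex a) N.idx xo) *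
        ((1 - (G + K + M)).updateRow xo (Pi.single xo 1)).det := by
    intro q sm M hM
    have hF : (Net.cons (q.layer sm) N).closedFlow = G + K + M := by
      have hc := gflow_cons_eq sm q N.bot N.F
      have : (Net.cons (q.layer sm) N).closedFlow = q.gflow sm
          (Sum.inl : Fin a.length → Fin a.length ⊕ N.E) (fun i => Sum.inr (N.bot i)) +
          fromBlocks 0 0 0 N.F + conn a.get (Sum.inr ∘ N.top) Sum.inl 1 := by
        rw [hc]; rfl
      rw [this, hM, hK]
      abel
    have hn := nabla_eq (cons_good (q.layer sm) hN) (xo : Fin a.length ⊕ N.E)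
    rw [hF] at hn
    exact hn
  rw [aux _ _ _ h4, aux _ _ _ h5, aux _ _ _ h6, h7]
  have key := det_skein (yo := yo) (G + K) s h1 h2 h3
  -- If the first strand is under, `p` has sign -s and the two crossings exchange their roles; both
  -- sides of the relation change sign.
  cases o
  · simp only [Bool.not_false, Bool.false_eq_true, if_false, neg_neg]
    linear_combination (-T (-Sum.elim (rowIndex a) N.idx xo)) * key
  · simp only [Bool.not_true, if_true]
    linear_combination T (-Sum.elim (rowIndex a) N.idx xo) * key

end Piece

namespace Tangle

variable {a b c : List Bool}

/-- The stacks of layers of two tangle diagrams that differ by a crossing change, and the stack of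
layers with this crossing smoothed. -/
theorem CrossingChange.exists_split {w w' : Tangle a b} (h : CrossingChange w w') :
    ∃ (c d : List Bool) (u : Chain a c) (p p' : Piece c d) (v : Chain d b),
      Piece.CrossingChange p p' ∧ w.toChain = u.comp (.cons (p.layer false) v) ∧
      w'.toChain = u.comp (.cons (p'.layer false) v) ∧ w'.writhe = w.writhe - 2 * p.writhe ∧
      w'.turning = w.turning := by
  induction h with
  | @head a b c p p' w h =>
    refine ⟨a, b, .nil a, p, p', w.toChain, h, rfl, rfl, ?_, ?_⟩
    · rw [writhe, writhe, h.writhe_eq]; ring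
    · rw [turning, turning, h.turning_eq]
  | tail q h ih =>
    obtain ⟨c, d, u, p, p', v, h1, h2, h3, h4, h5⟩ := ih
    refine ⟨c, d, .cons (q.layer false) u, p, p', v, h1, ?_, ?_, ?_, ?_⟩
    · rw [toChain, h2]; rfl
    · rw [toChain, h3]; rfl
    · rw [writhe, writhe, h4]; ring
    · rw [turning, turning, h5]

end Tangle

/-- The skein relation in an arbitrary position. -/
theorem Piece.CrossingChange.nabla_comp {a c d : List Bool} {p p' : Piece c d}
    (h : Piece.CrossingChange p p') (u : Chain a c) (v : Chain d a) :
    T (-p.writhe) * (u.comp (.cons (p.layer false) v)).net.nabla -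
      T p.writhe * (u.comp (.cons (p'.layer false) v)).net.nabla =
    (T (-p.writhe) - T p.writhe) * (u.comp (.cons (p.layer true) v)).net.nabla := by
  rw [Chain.nabla_comm u, Chain.nabla_comm u, Chain.nabla_comm u]
  exact h.nabla_cons (v.comp u).net_good

/-! ### Cyclic words modulo a prime -/

section Words

/-- A sum that is invariant under a permutation of order a power of `p` is congruent modulo `p` to
the sum over the fixed points. -/
theorem sum_sub_sum_fixed_mem_span {α R : Type*} [Fintype α] [DecidableEq α] [CommRing R] {p n : ℕ}
    (hp : p.Prime) (σ : Equiv.Perm α) (hσ : σ ^ p ^ n = 1) (φ : α → R) (hφ : ∀ x, φ (σ x) = φ x) :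
    ∑ x, φ x - ∑ x with σ x = x, φ x ∈ Ideal.span {(p : R)} := by
  classical
  have := Fact.mk hp
  -- Grouping by the value of φ reduces the claim to counting: σ acts on each fibre with order a
  -- power of p, so the number of points is congruent to the number of fixed points.
  have h1 : ∑ x, φ x = ∑ v ∈ Finset.univ.image φ, ∑ x with φ x = v, φ x :=
    (Finset.sum_fiberwise_of_maps_to (fun x _ => Finset.mem_image_of_mem φ (Finset.mem_univ x)) φ).symm
  have h2 : ∑ x with σ x = x, φ x =
      ∑ v ∈ Finset.univ.image φ, ∑ x with σ x = x ∧ φ x = v, φ x := by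
    rw [← Finset.sum_fiberwise_of_maps_to (s := Finset.univ.filter fun x => σ x = x)
      (t := Finset.univ.image φ) (fun x _ => Finset.mem_image_of_mem φ (Finset.mem_univ x)) φ]
    refine Finset.sum_congr rfl fun v _ => ?_
    rw [Finset.filter_filter]
  rw [h1, h2, ← Finset.sum_sub_distrib]
  refine Ideal.sum_mem _ fun v _ => ?_
  have h3 : ∑ x with φ x = v, φ x = (Fintype.card {x // φ x = v} : R) * v := by
    rw [Finset.sum_congr rfl (g := fun _ => v) (by simp), Finset.sum_const, nsmul_eq_mul,
      Fintype.card_subtype]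
  have h4 : ∑ x with σ x = x ∧ φ x = v, φ x =
      (Fintype.card {x // σ x = x ∧ φ x = v} : R) * v := by
    rw [Finset.sum_congr rfl (g := fun _ => v) (by simp), Finset.sum_const, nsmul_eq_mul,
      Fintype.card_subtype]
  let τ : Equiv.Perm {x // φ x = v} := σ.subtypePerm fun x => by rw [hφ]
  have hτ : τ ^ p ^ n = 1 := by
    ext x
    simp only [τ, Equiv.Perm.subtypePerm_pow, hσ]
    rfl
  have h5 := Equiv.Perm.card_fixedPoints_modEq (α := {x // φ x = v}) (f := MulAction.toEndHom τ) (p := p) (n := n)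
    (by rw [← map_pow, hτ, map_one])
  have h6 : ∀ _ : Fintype
      (Function.fixedPoints (MulAction.toEndHom τ : Function.End {x // φ x = v})),
      Fintype.card (Function.fixedPoints (MulAction.toEndHom τ : Function.End {x // φ x = v})) =
      Fintype.card {x // σ x = x ∧ φ x = v} := by
    intro
    refine Fintype.card_congr ⟨fun x => ⟨x.1.1, congrArg Subtype.val x.2, x.1.2⟩,
      fun x => ⟨⟨x.1, x.2.2⟩, Subtype.ext x.2.1⟩, fun x => rfl, fun x => rfl⟩
  rw [h3, h4, ← sub_mul]
  refine Ideal.mul_mem_right _ _ ?_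
  rw [Ideal.mem_span_singleton]
  have h7 := (Nat.modEq_iff_dvd.mp (h5.symm))
  rw [h6] at h7
  have := map_dvd (Int.castRingHom R) h7
  simpa using this

variable {M R : Type*} [Monoid M] [CommRing R] (g : M → R) (X : M) (W : Bool → M) (α : R)
  (β : Bool → R)

/-- The relation resolves a factor X in front only. After each use the trace property moves the
resolved factor behind ρ, which brings the next X to the front; hence the induction needs arbitrary
ρ. -/
theorem pow_mul_apply_pow (hg : ∀ u v, g (u * v) = g (v * u))
    (h : ∀ ρ, α * g (X * ρ) = ∑ b, β b * g (W b * ρ)) (k : ℕ) (ρ : M) :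
    α ^ k * g (X ^ k * ρ) =
      ∑ f : Fin k → Bool, (∏ i, β (f i)) * g ((List.ofFn fun i => W (f i)).prod * ρ) := by
  induction k generalizing ρ with
  | zero => simp
  | succ k ih =>
    rw [← (Fin.consEquiv fun _ => Bool).sum_comp, Fintype.sum_prod_type, pow_succ, mul_assoc,
      pow_succ' X, mul_assoc, h, Finset.mul_sum]
    refine Finset.sum_congr rfl fun b _ => ?_
    rw [mul_left_comm, hg, mul_assoc, ih, Finset.mul_sum]
    refine Finset.sum_congr rfl fun f _ => ?_
    simp only [Fin.consEquiv_apply, Fin.prod_univ_succ, Fin.cons_zero, Fin.cons_succ, List.ofFn_succ,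
      List.prod_cons]
    rw [mul_assoc, ← mul_assoc _ ρ, hg _ (W b), mul_assoc]

theorem finRotate_pow_card (n : ℕ) : finRotate n ^ n = 1 := by
  cases n with
  | zero => rfl
  | succ m =>
    have h : ∀ (k : ℕ) (i : Fin (m + 1)), ((finRotate (m + 1) ^ k) i).val = (i + k) % (m + 1) := by
      intro k
      induction k with
      | zero => intro i; simp [Nat.mod_eq_of_lt i.2]
      | succ k ih =>
        intro i
        rw [pow_succ', Equiv.Perm.mul_apply, finRotate_apply, Fin.val_add, ih, Fin.val_one',
          ← Nat.add_mod, add_assoc]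
    ext1 i
    refine Fin.ext ?_
    rw [h]
    simp [Nat.mod_eq_of_lt i.2]

theorem apply_prod_rotate (hg : ∀ u v, g (u * v) = g (v * u)) (n : ℕ) (f : Fin n → M) :
    g (List.ofFn fun i => f (finRotate n i)).prod = g (List.ofFn f).prod := by
  cases n with
  | zero => rfl
  | succ m =>
    rw [List.ofFn_succ', List.ofFn_succ, List.concat_eq_append, List.prod_append,
      List.prod_singleton, List.prod_cons, hg, finRotate_last]
    congr 4
    ext1 i
    congr 1
    rw [finRotate_apply, Fin.coeSucc_eq_succ]

theorem comp_finRotate_eq_iff {β : Type*} {n : ℕ} (f : Fin n → β) (i₀ : Fin n) :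
    (∀ i, f (finRotate n i) = f i) ↔ ∀ i, f i = f i₀ := by
  cases n with
  | zero => exact i₀.elim0
  | succ m =>
    constructor
    · intro h
      have h0 : ∀ i, f i = f 0 := by
        intro i
        induction i using Fin.induction with
        | zero => rfl
        | succ i ih => rw [← ih, ← h i.castSucc, finRotate_apply, Fin.coeSucc_eq_succ]
      intro i
      rw [h0 i, h0 i₀]
    · intro h i
      rw [h, h i]

/-- Rotation of words of length p^s has order dividing p^s and preserves each summand: the
coefficient is a commutative product and g is a trace. Modulo p only the words fixed by rotation,
that is the constant ones, contribute. -/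
theorem pow_mul_apply_pow_sub_mem {p s : ℕ} (hp : p.Prime) (hg : ∀ u v, g (u * v) = g (v * u))
    (h : ∀ ρ, α * g (X * ρ) = ∑ b, β b * g (W b * ρ)) :
    α ^ p ^ s * g (X ^ p ^ s) - ∑ b, β b ^ p ^ s * g (W b ^ p ^ s) ∈ Ideal.span {(p : R)} := by
  classical
  have h1 := pow_mul_apply_pow g X W α β hg h (p ^ s) 1
  simp only [mul_one] at h1
  let i₀ : Fin (p ^ s) := ⟨0, pow_pos hp.pos s⟩
  let σ : Equiv.Perm (Fin (p ^ s) → Bool) := (finRotate (p ^ s)).symm.arrowCongr (Equiv.refl _)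
  have hσ : ∀ f i, σ f i = f (finRotate _ i) := fun f i => rfl
  have hσk : ∀ k f i, (σ ^ k) f i = f ((finRotate _ ^ k) i) := by
    intro k
    induction k with
    | zero => intro f i; rfl
    | succ k ih =>
      intro f i
      rw [pow_succ', Equiv.Perm.mul_apply, hσ, ih, ← Equiv.Perm.mul_apply, ← pow_succ]
  have key := sum_sub_sum_fixed_mem_span (R := R) hp σ (n := s)
    (by
      ext f i
      rw [hσk, finRotate_pow_card]; rfl)
    (fun f => (∏ i, β (f i)) * g ((List.ofFn fun i => W (f i)).prod)) (by
      intro f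
      congr 1
      · exact Equiv.prod_comp (finRotate _) fun i => β (f i)
      · exact apply_prod_rotate g hg _ fun i => W (f i))
  rw [← h1] at key
  convert key using 2
  have hfix : (Finset.univ.filter fun f => σ f = f) =
      Finset.univ.image fun (b : Bool) (_ : Fin (p ^ s)) => b := by
    ext f
    simp only [Finset.mem_filter, Finset.mem_univ, true_and, Finset.mem_image]
    constructor
    · intro hf
      have := (comp_finRotate_eq_iff f i₀).mp fun i => congrFun hf i
      exact ⟨f i₀, funext fun i => (this i).symm⟩
    · rintro ⟨b, rfl⟩
      rfl
  rw [hfix, Finset.sum_image fun b _ b' _ hb => congrFun hb i₀]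
  simp

end Words

/-! ### The monoid of stacks from a row to itself -/

namespace Chain

variable {a : List Bool}

instance : Monoid (Chain a a) where
  mul := comp
  mul_assoc := comp_assoc
  one := nil a
  one_mul := fun _ => rfl
  mul_one := comp_nil

theorem mul_eq_comp (u v : Chain a a) : u * v = u.comp v := rfl

end Chain

theorem Tangle.toChain_pow {a : List Bool} (w : Tangle a a) (n : ℕ) :
    (w.pow n).toChain = w.toChain ^ n := by
  induction n with
  | zero => rfl
  | succ n ih => rw [pow, toChain_comp, ih, pow_succ']; rfl

/-! ### Braids and the elimination of their equations -/

section Braids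

open Matrix

variable {a b c : List Bool}

/-- The equations of the piece `q` express the lower variables through the upper ones by the linear
map `β`; the strands connect the position `i` at the bottom with the position `π i` at the top. -/
def Piece.Solves (q : Piece a b) (π : Fin a.length ≃ Fin b.length)
    (β : (Fin b.length → ℤ[T;T⁻¹]) →ₗ[ℤ[T;T⁻¹]] (Fin a.length → ℤ[T;T⁻¹])) : Prop :=
  (∀ i, b.get (π i) = a.get i) ∧
  ∃ Q : (Fin a.length → ℤ[T;T⁻¹]) →ₗ[ℤ[T;T⁻¹]] (Fin a.length → ℤ[T;T⁻¹]), ∀ pl pu vl vu,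
    q.form false pl pu vl vu = ∑ i, (if a.get i = true then pl i else pu (π i)) *
      ((if a.get i = true then vl i else vu (π i)) - Q (vl - β vu) i)

/-- Each strand supplies its equation at the bottom if directed upwards and at the top otherwise.
Separating these cases with `orientProj` turns the bilinear description into the four blocks
required by `det_peel`. -/
theorem Piece.Solves.exists_blocks {q : Piece a b} {π β} (h : q.Solves π β) :
    ∃ Q : Matrix (Fin a.length) (Fin a.length) ℤ[T;T⁻¹],
      (q.layer false).flow.toBlocks₁₁ =
        orientProj _ a.get true - orientProj _ a.get true * Q ∧
      (q.layer false).flow.toBlocks₁₂ = orientProj _ a.get true * Q * LinearMap.toMatrix' β ∧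
      (q.layer false).flow.toBlocks₂₁ =
        -((indicator ℤ[T;T⁻¹] π)ᵀ * (orientProj ℤ[T;T⁻¹] a.get false * Q)) ∧
      (q.layer false).flow.toBlocks₂₂ =
        (indicator ℤ[T;T⁻¹] π)ᵀ * (orientProj ℤ[T;T⁻¹] a.get false * Q * LinearMap.toMatrix' β) +
        (indicator ℤ[T;T⁻¹] π)ᵀ * (orientProj ℤ[T;T⁻¹] a.get false * indicator ℤ[T;T⁻¹] π) := by
  obtain ⟨-, Q, hQ⟩ := h
  refine ⟨LinearMap.toMatrix' Q, ?_⟩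
  set Q' := LinearMap.toMatrix' Q with hQ'
  set B := LinearMap.toMatrix' β with hB
  set P := indicator ℤ[T;T⁻¹] π with hP
  rw [← fromBlocks_inj, fromBlocks_toBlocks]
  refine matrix_ext_of_dotProduct fun p v => ?_
  have hL : (q.layer false).flow = q.gflow false Sum.inl Sum.inr := rfl
  rw [hL, Piece.dotProduct_gflow, hQ, fromBlocks_mulVec]
  have hQv : ∀ v, Q' *ᵥ v = Q v := fun v => LinearMap.toMatrix'_mulVec Q v
  have hBv : ∀ v, B *ᵥ v = β v := fun v => LinearMap.toMatrix'_mulVec β v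
  have hPv : ∀ v : Fin b.length → ℤ[T;T⁻¹], P *ᵥ v = v ∘ π := fun v => by
    ext1 i; simp [hP, mulVec, dotProduct, indicator_apply]
  set vl := v ∘ Sum.inl
  set vu := v ∘ Sum.inr
  have e1 : (orientProj ℤ[T;T⁻¹] a.get true - orientProj ℤ[T;T⁻¹] a.get true * Q') *ᵥ vl +
      (orientProj ℤ[T;T⁻¹] a.get true * Q' * B) *ᵥ vu =
      orientProj ℤ[T;T⁻¹] a.get true *ᵥ (vl - Q (vl - β vu)) := by
    rw [sub_mulVec, ← mulVec_mulVec, ← mulVec_mulVec, ← mulVec_mulVec, hQv, hBv, hQv, map_sub,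
      mulVec_sub, mulVec_sub]
    abel
  have e2 : (-(Pᵀ * (orientProj ℤ[T;T⁻¹] a.get false * Q'))) *ᵥ vl +
      (Pᵀ * (orientProj ℤ[T;T⁻¹] a.get false * Q' * B) +
        Pᵀ * (orientProj ℤ[T;T⁻¹] a.get false * P)) *ᵥ vu =
      Pᵀ *ᵥ (orientProj ℤ[T;T⁻¹] a.get false *ᵥ (vu ∘ π - Q (vl - β vu))) := by
    rw [neg_mulVec, add_mulVec]
    simp only [← mulVec_mulVec]
    rw [hQv, hBv, hQv, hPv, map_sub, ← mulVec_add, ← mulVec_neg, ← mulVec_add]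
    congr 1
    rw [← mulVec_neg, ← mulVec_add, ← mulVec_add]
    congr 1
    abel
  rw [e1, e2]
  have e3 : p ⬝ᵥ Sum.elim (orientProj ℤ[T;T⁻¹] a.get true *ᵥ (vl - Q (vl - β vu)))
      (Pᵀ *ᵥ (orientProj ℤ[T;T⁻¹] a.get false *ᵥ (vu ∘ π - Q (vl - β vu)))) =
      (p ∘ Sum.inl) ⬝ᵥ (orientProj ℤ[T;T⁻¹] a.get true *ᵥ (vl - Q (vl - β vu))) +
      (p ∘ Sum.inr) ⬝ᵥ (Pᵀ *ᵥ (orientProj ℤ[T;T⁻¹] a.get false *ᵥ (vu ∘ π - Q (vl - β vu)))) := by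
    simp [dotProduct]
  rw [e3, dotProduct_mulVec _ Pᵀ, vecMul_transpose, hPv, dotProduct, dotProduct,
    ← Finset.sum_add_distrib]
  refine Finset.sum_congr rfl fun i _ => ?_
  rw [orientProj, orientProj, mulVec_diagonal, mulVec_diagonal]
  by_cases hi : a.get i = true <;> simp only [hi] <;> simp

theorem Chain.cut_act_inUpper (L : Layer a b) (N : Net b c) (e : N.E)
    (he : ∀ i, b.get i = false → N.bot i ≠ e) :
    (Net.cons L N).cut (Sum.inr e) =
      fromBlocks L.flow.toBlocks₁₁ (L.flow.toBlocks₁₂ * indicator ℤ[T;T⁻¹] N.bot)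
        ((indicator ℤ[T;T⁻¹] N.bot)ᵀ * L.flow.toBlocks₂₁)
        ((indicator ℤ[T;T⁻¹] N.bot)ᵀ * L.flow.toBlocks₂₂ * indicator ℤ[T;T⁻¹] N.bot + N.cut e) := by
  have h1 := cut_inUpper (.cons L (.nil b)) e he
  -- `act_flow` holds for every `Net`, good or not, so it can be read backwards for `N` with its
  -- flow replaced by the cut one.
  exact h1.trans (act_flow (.cons L (.nil b)) (Net.mk N.E N.bot N.top (N.cut e) N.idx)).symm

theorem Piece.Solves.peels {q : Piece a b} {π β} (h : q.Solves π β) :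
    (Chain.cons (q.layer false) (.nil b)).Peels π (LinearMap.toMatrix' β) := by
  obtain ⟨Q, h₁₁, h₁₂, h₂₁, h₂₂⟩ := h.exists_blocks
  refine ⟨h.1, (1 - (2 : ℤ[T;T⁻¹]) • orientProj ℤ[T;T⁻¹] a.get false).det * Q.det,
    fun c N hN e he σ hσ C => ?_⟩
  have key := det_peel a.get π (N.top ∘ σ) N.bot hN.bot_inj
    (fun i j hi hj hij => by
      have := hN.orient _ _ hij
      rw [h.1, hσ, hi, hj] at this
      cases this) (N.cut e)
    (fun i hi => Chain.cut_apply_zero _ _ (hN.zero_bot _ (by rw [h.1, hi]))) Q C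
    (LinearMap.toMatrix' β) _ _ _ _ h₁₁ h₁₂ h₂₁ h₂₂
  rw [← Chain.cut_act_inUpper _ N e he.1] at key
  exact key

/-- Stacks of pieces whose equations express the lower variables through the upper ones. -/
inductive Tangle.IsBraid : {a b : List Bool} → Tangle a b → (Fin a.length ≃ Fin b.length) →
    ((Fin b.length → ℤ[T;T⁻¹]) →ₗ[ℤ[T;T⁻¹]] (Fin a.length → ℤ[T;T⁻¹])) → Prop
  | nil (a : List Bool) : Tangle.IsBraid (.nil a) (Equiv.refl _) LinearMap.id
  | cons {a b c : List Bool} {p : Piece a b} {w : Tangle b c} {π π' β β'} (hp : p.Solves π β)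
      (hw : Tangle.IsBraid w π' β') : Tangle.IsBraid (.cons p w) (π.trans π') (β ∘ₗ β')

theorem Tangle.IsBraid.comp {u : Tangle a b} {v : Tangle b c} {π π' β β'} (hu : u.IsBraid π β)
    (hv : v.IsBraid π' β') : (u.comp v).IsBraid (π.trans π') (β ∘ₗ β') := by
  induction hu with
  | nil a => exact hv
  | cons hp hw ih => exact .cons hp (ih hv)

theorem Tangle.IsBraid.peels {w : Tangle a b} {π β} (h : w.IsBraid π β) :
    w.toChain.Peels π (LinearMap.toMatrix' β) := by
  induction h with
  | nil a => rw [LinearMap.toMatrix'_id]; exact Chain.peels_nil a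
  | cons hp hw ih => rw [LinearMap.toMatrix'_comp]; exact hp.peels.comp ih

end Braids

/-! ### The linear maps of full twists -/

section Twists

open Matrix

variable {a b c : List Bool}

/-- Add a fixed point at `0` to an equivalence. -/
def succEquiv {m n : ℕ} (π : Fin m ≃ Fin n) : Fin (m + 1) ≃ Fin (n + 1) where
  toFun := Fin.cases 0 fun i => (π i).succ
  invFun := Fin.cases 0 fun i => (π.symm i).succ
  left_inv := fun i => by refine Fin.cases rfl (fun i => ?_) i; simp
  right_inv := fun i => by refine Fin.cases rfl (fun i => ?_) i; simp

/-- Add an unchanged first coordinate to a linear map. -/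
def succMap {R : Type*} [CommRing R] {m n : ℕ} (r : R) (β : (Fin n → R) →ₗ[R] (Fin m → R)) :
    (Fin (n + 1) → R) →ₗ[R] (Fin (m + 1) → R) :=
  LinearMap.pi (Fin.cons (r • LinearMap.proj 0)
    fun i => LinearMap.proj i ∘ₗ β ∘ₗ LinearMap.funLeft R R Fin.succ)

/-- A linear map that only changes the first two coordinates, by the matrix `(r₀ r₁; s₀ s₁)`, and
is multiplication by `d` on the others. -/
def headMap {R : Type*} [CommRing R] {n : ℕ} (r₀ r₁ s₀ s₁ : R) (d : Fin n → R) :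
    (Fin (n + 2) → R) →ₗ[R] (Fin (n + 2) → R) :=
  LinearMap.pi (Fin.cons (r₀ • LinearMap.proj 0 + r₁ • LinearMap.proj 1)
    (Fin.cons (s₀ • LinearMap.proj 0 + s₁ • LinearMap.proj 1)
      fun i => d i • LinearMap.proj i.succ.succ))

theorem sum_fin_add_two {R : Type*} [CommRing R] {n : ℕ} (f : Fin (n + 2) → R) :
    ∑ i, f i = f 0 + f 1 + ∑ i : Fin n, f i.succ.succ := by
  rw [Fin.sum_univ_succ, Fin.sum_univ_succ, ← add_assoc]; rfl

/-- The linear map that expresses the lower variables of a crossing through the upper ones. -/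
noncomputable def crossMap (x y o : Bool) (b : List Bool) :
    (Fin (y :: x :: b).length → ℤ[T;T⁻¹]) →ₗ[ℤ[T;T⁻¹]] (Fin (x :: y :: b).length → ℤ[T;T⁻¹]) :=
  if o then headMap 0 1 (T (2 * strandSign x)) (1 - T (2 * strandSign x)) 1
  else headMap (1 - T (-2 * strandSign y)) (T (-2 * strandSign y)) 1 0 1

theorem Piece.skip_solves {q : Piece a b} {π β} (h : q.Solves π β) (x : Bool) :
    (Piece.skip x q).Solves (succEquiv π) (succMap 1 β) := by
  obtain ⟨hπ, Q, hQ⟩ := h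
  refine ⟨fun i => ?_, succMap (strandSign x : ℤ[T;T⁻¹]) Q, fun pl pu vl vu => ?_⟩
  · refine Fin.cases rfl (fun i => ?_) i
    exact hπ i
  · rw [Piece.form, hQ]
    refine Eq.trans ?_ (Fin.sum_univ_succ _).symm
    congr 1
    change strandForm x (pl 0) (pu 0) (vl 0) (vu 0) = (if x = true then pl 0 else pu 0) *
      ((if x = true then vl 0 else vu 0) - (strandSign x : ℤ[T;T⁻¹]) * (vl 0 - 1 * vu 0))
    cases x <;> simp [strandForm, strandSign]

/-- The crossing relations are solved for the lower variables under each choice of orientations and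
over-strand. The factors after each `if o` are the coefficients of Q, and the cases reduce to T 2 ·
T (-2) = 1. -/
theorem cross_solves_aux (x y o : Bool) (pl₀ pl₁ pu₀ pu₁ vl₀ vl₁ vu₀ vu₁ : ℤ[T;T⁻¹]) :
    (if o = true then
      (if x = true then pl₀ else pu₁) * (if x = true then vu₁ else vl₀) +
      (if y = true then pl₁ else pu₀) *
        (T (2 * crossingSign x y o) * if y = true then vu₀ else vl₁) +
      (if y = true then pl₁ else pu₀) *
        ((1 - T (2 * crossingSign x y o)) * if x = true then vu₁ else vl₀)
    else
      (if y = true then pl₁ else pu₀) * (if y = true then vu₀ else vl₁) +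
      (if x = true then pl₀ else pu₁) *
        (T (2 * crossingSign x y o) * if x = true then vu₁ else vl₀) +
      (if x = true then pl₀ else pu₁) *
        ((1 - T (2 * crossingSign x y o)) * if y = true then vu₀ else vl₁)) =
    (if x = true then pl₀ else pu₁) * ((if x = true then vl₀ else vu₁) -
      if o = true then (strandSign x : ℤ[T;T⁻¹]) * (vl₀ - vu₁)
      else (if x = true then 1 else -T (2 * crossingSign x y o)) *
        (vl₀ - ((1 - T (-2 * strandSign y)) * vu₀ + T (-2 * strandSign y) * vu₁)) +
        (if y = true then 0 else -(1 - T (2 * crossingSign x y o))) * (vl₁ - vu₀)) +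
    (if y = true then pl₁ else pu₀) * ((if y = true then vl₁ else vu₀) -
      if o = true then (if x = true then 0 else -(1 - T (2 * crossingSign x y o))) * (vl₀ - vu₁) +
        (if y = true then 1 else -T (2 * crossingSign x y o)) *
        (vl₁ - (T (2 * strandSign x) * vu₀ + (1 - T (2 * strandSign x)) * vu₁))
      else (strandSign y : ℤ[T;T⁻¹]) * (vl₁ - vu₀)) := by
  have e1 : strandSign true = 1 := rfl
  have e2 : strandSign false = -1 := rfl
  have e3 : crossingSign true true true = 1 := rfl
  have e4 : crossingSign true true false = -1 := rfl
  have e5 : crossingSign false false true = 1 := rfl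
  have e6 : crossingSign false false false = -1 := rfl
  have e7 : crossingSign true false true = -1 := rfl
  have e8 : crossingSign true false false = 1 := rfl
  have e9 : crossingSign false true true = -1 := rfl
  have e0 : crossingSign false true false = 1 := rfl
  have h4 : (T 2 : ℤ[T;T⁻¹]) * T (-2) = 1 := by rw [← T_add]; simp
  cases x <;> cases y <;> cases o <;>
    simp only [e1, e2, e3, e4, e5, e6, e7, e8, e9, e0, if_true, Bool.false_eq_true, if_false,
      mul_one, mul_neg, neg_neg, Int.cast_one, Int.cast_neg] <;>
    clear e1 e2 e3 e4 e5 e6 e7 e8 e9 e0 <;>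
    generalize (T 2 : ℤ[T;T⁻¹]) = P at h4 ⊢ <;> generalize (T (-2) : ℤ[T;T⁻¹]) = N at h4 ⊢ <;>
    grind

theorem Piece.cross_solves (x y o : Bool) (b : List Bool) :
    (Piece.cross x y o b).Solves (Equiv.swap (0 : Fin (b.length + 2)) 1) (crossMap x y o b) := by
  have hs0 : Equiv.swap (0 : Fin (b.length + 2)) 1 0 = 1 := Equiv.swap_apply_left _ _
  have hs1 : Equiv.swap (0 : Fin (b.length + 2)) 1 1 = 0 := Equiv.swap_apply_right _ _
  have hs2 : ∀ i : Fin b.length, Equiv.swap (0 : Fin (b.length + 2)) 1 i.succ.succ = i.succ.succ :=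
    fun i => Equiv.swap_apply_of_ne_of_ne (Fin.succ_ne_zero _)
      (fun h => Fin.succ_ne_zero _ (Fin.succ_injective _ h))
  refine ⟨fun i => ?_, if o then headMap (strandSign x : ℤ[T;T⁻¹]) 0
      (if x = true then 0 else -(1 - T (2 * crossingSign x y o)))
      (if y = true then 1 else -T (2 * crossingSign x y o)) (fun i => (strandSign (b.get i) : ℤ[T;T⁻¹]))
    else headMap (if x = true then 1 else -T (2 * crossingSign x y o))
      (if y = true then 0 else -(1 - T (2 * crossingSign x y o))) 0 (strandSign y : ℤ[T;T⁻¹])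
      (fun i => (strandSign (b.get i) : ℤ[T;T⁻¹])), fun pl pu vl vu => ?_⟩
  · refine Fin.cases ?_ (fun i => Fin.cases ?_ (fun i => ?_) i) i
    · rfl
    · rfl
    · erw [hs2 i]; rfl
  · rw [Piece.form]
    refine Eq.trans ?_ (sum_fin_add_two _).symm
    rw [hs0, hs1]
    simp only [hs2]
    congr 1
    · have key := cross_solves_aux x y o (pl 0) (pl 1) (pu 0) (pu 1) (vl 0) (vl 1) (vu 0) (vu 1)
      refine Eq.trans key ?_
      cases o
      · change _ = (if x = true then pl 0 else pu 1) * ((if x = true then vl 0 else vu 1) -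
          ((if x = true then 1 else -T (2 * crossingSign x y false)) *
            (vl 0 - ((1 - T (-2 * strandSign y)) * vu 0 + T (-2 * strandSign y) * vu 1)) +
          (if y = true then 0 else -(1 - T (2 * crossingSign x y false))) *
            (vl 1 - (1 * vu 0 + 0 * vu 1)))) +
          (if y = true then pl 1 else pu 0) * ((if y = true then vl 1 else vu 0) -
          (0 * (vl 0 - ((1 - T (-2 * strandSign y)) * vu 0 + T (-2 * strandSign y) * vu 1)) +
            (strandSign y : ℤ[T;T⁻¹]) * (vl 1 - (1 * vu 0 + 0 * vu 1))))
        simp only [Bool.false_eq_true, if_false, zero_mul, one_mul, zero_add, add_zero]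
      · change _ = (if x = true then pl 0 else pu 1) * ((if x = true then vl 0 else vu 1) -
          ((strandSign x : ℤ[T;T⁻¹]) * (vl 0 - (0 * vu 0 + 1 * vu 1)) +
          0 * (vl 1 - (T (2 * strandSign x) * vu 0 + (1 - T (2 * strandSign x)) * vu 1)))) +
          (if y = true then pl 1 else pu 0) * ((if y = true then vl 1 else vu 0) -
          ((if x = true then 0 else -(1 - T (2 * crossingSign x y true))) *
            (vl 0 - (0 * vu 0 + 1 * vu 1)) +
          (if y = true then 1 else -T (2 * crossingSign x y true)) *
            (vl 1 - (T (2 * strandSign x) * vu 0 + (1 - T (2 * strandSign x)) * vu 1))))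
        simp only [if_true, zero_mul, one_mul, zero_add, add_zero]
    · refine Finset.sum_congr rfl fun i _ => ?_
      have hi : strandForm (b.get i) (pl i.succ.succ) (pu i.succ.succ) (vl i.succ.succ)
          (vu i.succ.succ) = (if b.get i = true then pl i.succ.succ else pu i.succ.succ) *
          ((if b.get i = true then vl i.succ.succ else vu i.succ.succ) -
            (strandSign (b.get i) : ℤ[T;T⁻¹]) * (vl i.succ.succ - 1 * vu i.succ.succ)) := by
        generalize b.get i = z
        cases z <;> simp [strandForm, strandSign]
      cases o <;> exact hi

theorem Tangle.IsBraid.skip {w : Tangle a b} {π β} (h : w.IsBraid π β) (x : Bool) :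
    (w.skip x).IsBraid (succEquiv π) (succMap 1 β) := by
  induction h with
  | nil a =>
    have h1 : succEquiv (Equiv.refl (Fin a.length)) = Equiv.refl _ := by
      ext1 i; refine Fin.cases rfl (fun i => rfl) i
    have h2 : succMap (1 : ℤ[T;T⁻¹]) (LinearMap.id : (Fin a.length → ℤ[T;T⁻¹]) →ₗ[ℤ[T;T⁻¹]] _) =
        LinearMap.id := by
      refine LinearMap.ext fun v => funext fun i => ?_
      refine Fin.cases ?_ (fun i => rfl) i
      exact one_mul _
    rw [h1, h2]
    exact .nil (x :: a)
  | @cons a b c p w π π' β β' hp hw ih =>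
    have h1 : succEquiv (π.trans π') = (succEquiv π).trans (succEquiv π') := by
      ext1 i; refine Fin.cases rfl (fun i => rfl) i
    have h2 : succMap (1 : ℤ[T;T⁻¹]) (β ∘ₗ β') = succMap 1 β ∘ₗ succMap 1 β' := by
      refine LinearMap.ext fun v => funext fun i => ?_
      refine Fin.cases ?_ (fun i => rfl) i
      exact (one_mul _).symm
    rw [h1, h2]
    exact .cons (Piece.skip_solves hp x) ih

/-- The prefactor t^{-1/2} - t^{1/2} turns the signed weight of a strand into a difference of
consecutive powers t^{winding}, so the sum of the coefficients telescopes. -/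
theorem twistForm_cons (x : Bool) (b : List Bool) (v : Fin (x :: b).length → ℤ[T;T⁻¹]) :
    twistForm (x :: b) ⬝ᵥ v = T (2 * winding b) * (1 - T (2 * strandSign x)) * v 0 +
      twistForm b ⬝ᵥ fun i => v i.succ := by
  have h : ∀ (c : List Bool) i, twistForm c i =
      (T (-1) - T 1 : ℤ[T;T⁻¹]) * (T (rowIndex c i) * if c.get i = true then 1 else -1) := by
    intro c i
    rw [twistForm, orient, Pi.smul_apply, vecMul_diagonal, smul_eq_mul, rowWeight]
  refine (Fin.sum_univ_succ _).trans ?_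
  congr 1
  · rw [h]
    change (T (-1) - T 1 : ℤ[T;T⁻¹]) * (T (2 * winding b + strandSign x) *
      if x = true then 1 else -1) * v 0 = _
    rw [T_add]
    have h4 : (T 1 : ℤ[T;T⁻¹]) * T (-1) = 1 := by rw [← T_add]; simp
    cases x
    · have h6 : (T (2 * strandSign false) : ℤ[T;T⁻¹]) = T (-1) * T (-1) := by rw [← T_add]; rfl
      rw [h6]
      simp only [strandSign, Bool.false_eq_true, if_false]
      linear_combination (T (2 * winding b) * v 0) * h4
    · have h5 : (T (2 * strandSign true) : ℤ[T;T⁻¹]) = T 1 * T 1 := by rw [← T_add]; rfl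
      rw [h5]
      simp only [strandSign, if_true]
      linear_combination (T (2 * winding b) * v 0) * h4
  · refine Finset.sum_congr rfl fun i _ => ?_
    rw [h, h]
    rfl

theorem sum_twistForm (b : List Bool) : ∑ i, twistForm b i = 1 - T (2 * winding b) := by
  induction b with
  | nil => simp [winding]
  | cons x b ih =>
    have h := twistForm_cons x b 1
    rw [dotProduct_one] at h
    have h2 : (fun i : Fin b.length => (1 : Fin (x :: b).length → ℤ[T;T⁻¹]) i.succ) = 1 := rfl
    rw [h, h2, dotProduct_one, ih, winding_cons, mul_add, T_add, Pi.one_apply]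
    ring

/-- The linear maps that can be moved around the axis. -/
def IsTwistMap (a : List Bool) (α c : ℤ[T;T⁻¹])
    (β : (Fin a.length → ℤ[T;T⁻¹]) →ₗ[ℤ[T;T⁻¹]] (Fin a.length → ℤ[T;T⁻¹])) : Prop :=
  IsUnit α ∧ α + c * (1 - T (2 * winding a)) = 1 ∧
    ∀ v i, β v i = α * v i + c * (twistForm a ⬝ᵥ v)

end Twists

section Twists

open Matrix

variable {a : List Bool}

theorem swap_trans_succEquiv_trans_swap (n : ℕ) :
    (Equiv.swap (0 : Fin (n + 2)) 1).trans ((succEquiv (Equiv.refl (Fin (n + 1)))).trans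
      ((Equiv.swap (0 : Fin (n + 2)) 1).trans (Equiv.refl _))) = Equiv.refl _ := by
  have h : succEquiv (Equiv.refl (Fin (n + 1))) = Equiv.refl _ := by
    ext1 i; refine Fin.cases rfl (fun i => rfl) i
  rw [h]
  ext1 i
  simp

theorem encircle_isBraid (o x y : Bool) (b : List Bool) {ε}
    (h : (Tangle.encircle o x b).IsBraid (Equiv.refl _) ε) :
    (Tangle.encircle o x (y :: b)).IsBraid (Equiv.refl _)
      (crossMap x y o b ∘ₗ (succMap 1 ε ∘ₗ (crossMap y x o b ∘ₗ LinearMap.id))) := by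
  have h1 : (Tangle.encircle o x (y :: b)).IsBraid _ _ :=
    Tangle.IsBraid.cons (Piece.cross_solves x y o b)
      ((h.skip y).comp (.cons (Piece.cross_solves y x o b) (.nil (x :: y :: b))))
  have h2 := swap_trans_succEquiv_trans_swap b.length
  exact h2 ▸ h1

/-- For the encircling strand, passing each further strand adds one term of the telescoping form
`twistForm`. Every other strand is changed only by the encircling one, hence through `ε v 0`. -/
theorem encircle_true (x : Bool) (b : List Bool) :
    ∃ ε, (Tangle.encircle true x b).IsBraid (Equiv.refl _) ε ∧
      (∀ v, ε v 0 = T (2 * winding b) * v 0 + twistForm b ⬝ᵥ fun i => v i.succ) ∧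
      ∀ v (i : Fin b.length), ε v i.succ =
        T (2 * strandSign x) * v i.succ + (1 - T (2 * strandSign x)) * ε v 0 := by
  induction b with
  | nil =>
    refine ⟨LinearMap.id, .nil [x], fun v => ?_, fun v i => i.elim0⟩
    have h0 : (twistForm [] ⬝ᵥ fun i => v i.succ) = 0 := rfl
    rw [h0]
    simp [winding]
  | cons y b ih =>
    obtain ⟨ε, h1, h2, h3⟩ := ih
    refine ⟨_, encircle_isBraid true x y b h1, ?_, ?_⟩
    · intro v
      set n : Fin (x :: b).length → ℤ[T;T⁻¹] := fun i => crossMap y x true b v i.succ with hn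
      have e0 : (crossMap x y true b ∘ₗ (succMap 1 ε ∘ₗ (crossMap y x true b ∘ₗ LinearMap.id))) v 0 =
        0 * (1 * crossMap y x true b v 0) + 1 * ε n 0 := rfl
      have e1 : n 0 = T (2 * strandSign y) * v 0 + (1 - T (2 * strandSign y)) * v 1 := rfl
      have e2 : (fun i : Fin b.length => n i.succ) = fun i => v i.succ.succ := by
        ext1 i; exact one_mul _
      rw [e0, h2, e1, e2, twistForm_cons, winding_cons, mul_add (_ : ℤ), T_add]
      change _ = _ + (T (2 * winding b) * (1 - T (2 * strandSign y)) * v 1 +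
        twistForm b ⬝ᵥ fun i => v i.succ.succ)
      ring
    · intro v i
      set n : Fin (x :: b).length → ℤ[T;T⁻¹] := fun i => crossMap y x true b v i.succ with hn
      have e0 : (crossMap x y true b ∘ₗ (succMap 1 ε ∘ₗ (crossMap y x true b ∘ₗ LinearMap.id))) v 0 =
        0 * (1 * crossMap y x true b v 0) + 1 * ε n 0 := rfl
      rw [e0]
      refine Fin.cases ?_ (fun i => ?_) i
      · change T (2 * strandSign x) * (1 * (0 * v 0 + 1 * v 1)) + (1 - T (2 * strandSign x)) * ε n 0 =
          T (2 * strandSign x) * v 1 + _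
        ring
      · change 1 * ε n i.succ = _
        rw [h3]
        change 1 * (T (2 * strandSign x) * (1 * v i.succ.succ) + (1 - T (2 * strandSign x)) * ε n 0) =
          T (2 * strandSign x) * v i.succ.succ + _
        ring

/-- This braid is the inverse of the right-handed one, and the formulas are those of `encircle_true`
solved for the other side. The value at 0 is left implicit in the remaining values, which is all
that `fullTwist_isBraid` uses. -/
theorem encircle_false (x : Bool) (b : List Bool) :
    ∃ ε, (Tangle.encircle false x b).IsBraid (Equiv.refl _) ε ∧
      (∀ v, ε v 0 = T (-2 * winding b) * (v 0 - twistForm b ⬝ᵥ fun i => ε v i.succ)) ∧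
      ∀ v (i : Fin b.length), ε v i.succ =
        T (-2 * strandSign x) * v i.succ + (1 - T (-2 * strandSign x)) * v 0 := by
  induction b with
  | nil =>
    refine ⟨LinearMap.id, .nil [x], fun v => ?_, fun v i => i.elim0⟩
    have h0 : (twistForm [] ⬝ᵥ fun i : Fin 0 => (LinearMap.id (R := ℤ[T;T⁻¹]) v) i.succ) = 0 := rfl
    erw [h0]
    simp [winding]
  | cons y b ih =>
    obtain ⟨ε, h1, h2, h3⟩ := ih
    refine ⟨_, encircle_isBraid false x y b h1, ?_⟩
    set l := crossMap x y false b ∘ₗ (succMap 1 ε ∘ₗ (crossMap y x false b ∘ₗ LinearMap.id)) with hl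
    have hsucc : ∀ v (i : Fin (y :: b).length), l v i.succ =
        T (-2 * strandSign x) * v i.succ + (1 - T (-2 * strandSign x)) * v 0 := by
      intro v i
      set n : Fin (x :: b).length → ℤ[T;T⁻¹] := fun i => crossMap y x false b v i.succ with hn
      refine Fin.cases ?_ (fun i => ?_) i
      · change 1 * (1 * ((1 - T (-2 * strandSign x)) * v 0 + T (-2 * strandSign x) * v 1)) + 0 * ε n 0 =
          T (-2 * strandSign x) * v 1 + _
        ring
      · change 1 * ε n i.succ = _
        rw [h3]
        change 1 * (T (-2 * strandSign x) * (1 * v i.succ.succ) +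
          (1 - T (-2 * strandSign x)) * (1 * v 0 + 0 * v 1)) =
          T (-2 * strandSign x) * v i.succ.succ + _
        ring
    refine ⟨?_, hsucc⟩
    intro v
    set n : Fin (x :: b).length → ℤ[T;T⁻¹] := fun i => crossMap y x false b v i.succ with hn
    have e0 : l v 0 = (1 - T (-2 * strandSign y)) * (1 * crossMap y x false b v 0) +
      T (-2 * strandSign y) * ε n 0 := rfl
    have e1 : n 0 = 1 * v 0 + 0 * v 1 := rfl
    have e2 : (fun i : Fin b.length => ε n i.succ) = fun i => l v i.succ.succ := by
      ext1 i; exact (one_mul _).symm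
    have e3 : l v 1 = 1 * (1 * crossMap y x false b v 0) + 0 * ε n 0 := rfl
    have h4 : (T (-2 * strandSign y) : ℤ[T;T⁻¹]) * T (2 * strandSign y) = 1 := by
      rw [← T_add]; simp
    have h5 : (T (-2 * winding b) : ℤ[T;T⁻¹]) * T (2 * winding b) = 1 := by
      rw [← T_add]; simp
    rw [twistForm_cons, winding_cons, mul_add (_ : ℤ), T_add]
    change l v 0 = _ * (v 0 - (T (2 * winding b) * (1 - T (2 * strandSign y)) * l v 1 +
      twistForm b ⬝ᵥ fun i => l v i.succ.succ))
    rw [e0, h2, e1, e2, e3]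
    set z := crossMap y x false b v 0
    set S := twistForm b ⬝ᵥ fun i => l v i.succ.succ
    linear_combination (T (-2 * strandSign y) * z * (1 - T (2 * strandSign y))) * h5 - z * h4

theorem IsTwistMap.isTwist {α c β} (h : IsTwistMap a α c β) : IsTwist a (LinearMap.toMatrix' β) := by
  obtain ⟨h1, h2, h3⟩ := h
  obtain ⟨α', hα⟩ := isUnit_iff_exists_inv.mp h1
  refine ⟨α, α', c, hα, by rw [sum_twistForm, h2], ?_⟩
  ext1 i j
  rw [LinearMap.toMatrix'_apply]
  have := h3 (Pi.single j 1) i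
  simp only [dotProduct_single, mul_one] at this
  refine Eq.trans ?_ (this.trans ?_)
  · congr 1
  · simp [Matrix.one_apply, Pi.single_apply]

/-- By induction on the strands: the condition α + c(1 - t^{winding}) = 1 makes `twistForm b`
invariant under the inner twist, so encircling it by one more strand again gives a scalar plus a
rank-one map. The values of α and c for `o = false` are those of the inverse map. -/
theorem fullTwist_isBraid (o : Bool) (a : List Bool) :
    ∃ β, (Tangle.fullTwist o a).IsBraid (Equiv.refl _) β ∧
      IsTwistMap a (if o then T (2 * winding a) else T (-2 * winding a))
        (if o then 1 else -T (-2 * winding a)) β := by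
  have hinv : ∀ k : ℤ, (T (-2 * k) : ℤ[T;T⁻¹]) * T (2 * k) = 1 := fun k => by
    rw [← T_add]; simp
  have hunit : ∀ a : List Bool,
      IsUnit (if o = true then T (2 * winding a) else T (-2 * winding a) : ℤ[T;T⁻¹]) := by
    intro a; split_ifs <;> exact isUnit_T _
  have hone : ∀ a : List Bool, (if o = true then T (2 * winding a) else T (-2 * winding a) : ℤ[T;T⁻¹]) +
      (if o = true then 1 else -T (-2 * winding a)) * (1 - T (2 * winding a)) = 1 := by
    intro a; split_ifs
    · ring
    · linear_combination hinv (winding a)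
  induction a with
  | nil => exact ⟨LinearMap.id, .nil [], hunit [], hone [], fun v i => i.elim0⟩
  | cons x b ih =>
    obtain ⟨β, h1, -, -, h2⟩ := ih
    have hsucc : (Equiv.refl (Fin (x :: b).length)).trans (succEquiv (Equiv.refl (Fin b.length))) =
        Equiv.refl _ := by
      ext1 i; refine Fin.cases rfl (fun i => rfl) i
    have hlin : ∀ (p q : ℤ[T;T⁻¹]) (v w : Fin b.length → ℤ[T;T⁻¹]), (∀ i, w i = p * v i + q) →
        twistForm b ⬝ᵥ w = p * (twistForm b ⬝ᵥ v) + q * (1 - T (2 * winding b)) := by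
      intro p q v w hw
      rw [← sum_twistForm, dotProduct, dotProduct, Finset.mul_sum, Finset.mul_sum,
        ← Finset.sum_add_distrib]
      refine Finset.sum_congr rfl fun i _ => ?_
      rw [hw]
      ring
    cases o
    · obtain ⟨ε, h3, h4, h5⟩ := encircle_false x b
      refine ⟨ε ∘ₗ succMap 1 β, hsucc ▸ h3.comp (h1.skip x), hunit _, hone _, fun v i => ?_⟩
      set ℓ := twistForm b ⬝ᵥ fun i => v i.succ with hℓ
      have m0 : succMap 1 β v 0 = v 0 := one_mul _
      have m1 : ∀ i : Fin b.length, succMap 1 β v i.succ =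
        T (-2 * winding b) * v i.succ + -T (-2 * winding b) * ℓ := fun i => h2 _ i
      have l1 : ∀ i : Fin b.length, ε (succMap 1 β v) i.succ =
          T (-2 * strandSign x) * T (-2 * winding b) * v i.succ +
            (-(T (-2 * strandSign x) * T (-2 * winding b) * ℓ) +
              (1 - T (-2 * strandSign x)) * v 0) := by
        intro i
        rw [h5, m1, m0]
        ring
      have hl := hlin _ _ (fun i => v i.succ) (fun i => ε (succMap 1 β v) i.succ) l1
      have l0 := h4 (succMap 1 β v)
      rw [hl, m0, ← hℓ] at l0
      change ε (succMap 1 β v) i = T (-2 * winding (x :: b)) * v i +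
        -T (-2 * winding (x :: b)) * (twistForm (x :: b) ⬝ᵥ v)
      rw [twistForm_cons, winding_cons, mul_add (_ : ℤ), T_add, ← hℓ]
      have e1 := hinv (strandSign x)
      have e2 := hinv (winding b)
      refine Fin.cases ?_ (fun i => ?_) i
      · refine l0.trans ?_
        linear_combination (-T (-2 * winding b) * T (-2 * strandSign x) * ℓ) * e2 -
          (T (-2 * winding b) * T (2 * winding b) * v 0) * e1
      · refine (l1 i).trans ?_
        linear_combination (v 0 * (T (-2 * strandSign x) - 1)) * e2 -
          (v 0 * T (-2 * winding b) * T (2 * winding b)) * e1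
    · obtain ⟨ε, h3, h4, h5⟩ := encircle_true x b
      refine ⟨ε ∘ₗ succMap 1 β, hsucc ▸ h3.comp (h1.skip x), hunit _, hone _, fun v i => ?_⟩
      have m0 : succMap 1 β v 0 = v 0 := one_mul _
      have m1 : ∀ i : Fin b.length, succMap 1 β v i.succ =
        T (2 * winding b) * v i.succ + 1 * (twistForm b ⬝ᵥ fun i => v i.succ) := fun i => h2 _ i
      have hl := hlin _ _ (fun i => v i.succ) (fun i => succMap 1 β v i.succ) m1
      have l0 : ε (succMap 1 β v) 0 = T (2 * winding b) * v 0 + twistForm b ⬝ᵥ fun i => v i.succ := by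
        rw [h4, hl, m0]; ring
      change ε (succMap 1 β v) i = T (2 * winding (x :: b)) * v i + 1 * (twistForm (x :: b) ⬝ᵥ v)
      rw [twistForm_cons, winding_cons, mul_add (_ : ℤ), T_add]
      refine Fin.cases ?_ (fun i => ?_) i
      · refine l0.trans ?_
        ring
      · refine (h5 _ i).trans ?_
        rw [l0, m1]
        ring

/-- The cross terms collapse to c' + cα' because the first map fixes the constants. -/
theorem IsTwistMap.comp {α c β α' c' β'} (h : IsTwistMap a α c β) (h' : IsTwistMap a α' c' β') :
    IsTwistMap a (α * α') (c' + c * α') (β ∘ₗ β') := by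
  obtain ⟨h1, h2, h3⟩ := h
  obtain ⟨h1', h2', h3'⟩ := h'
  refine ⟨h1.mul h1', by linear_combination α' * h2 + h2', fun v i => ?_⟩
  have h4 : twistForm a ⬝ᵥ β' v =
      α' * (twistForm a ⬝ᵥ v) + c' * (twistForm a ⬝ᵥ v) * (1 - T (2 * winding a)) := by
    rw [← sum_twistForm]
    have h5 : twistForm a ⬝ᵥ β' v =
        ∑ i, twistForm a i * (α' * v i + c' * (twistForm a ⬝ᵥ v)) :=
      Finset.sum_congr rfl fun i _ => by rw [h3']
    rw [h5]
    simp only [mul_add, Finset.sum_add_distrib, ← Finset.sum_mul]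
    rw [mul_comm (∑ i, twistForm a i)]
    congr 1
    rw [dotProduct, Finset.mul_sum]
    exact Finset.sum_congr rfl fun i _ => by ring
  rw [LinearMap.comp_apply, h3, h3', h4]
  linear_combination (c' * (twistForm a ⬝ᵥ v)) * h2

theorem fullTwists_isBraid (a : List Bool) (m : ℤ) :
    ∃ β α c, (Tangle.fullTwists a m).IsBraid (Equiv.refl _) β ∧ IsTwistMap a α c β := by
  rw [Tangle.fullTwists]
  generalize decide (0 ≤ m) = o
  generalize m.natAbs = n
  induction n with
  | zero => exact ⟨LinearMap.id, 1, 0, .nil a, isUnit_one, by ring, fun v i => by simp⟩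
  | succ n ih =>
    obtain ⟨β, h1, h2⟩ := fullTwist_isBraid o a
    obtain ⟨β', α', c', h1', h2'⟩ := ih
    exact ⟨_, _, _, h1.comp h1', h2.comp h2'⟩

end Twists

/-! ### Normalization of powers, and the congruence -/

namespace Tangle

variable {a b c : List Bool}

theorem writhe_comp (u : Tangle a b) (v : Tangle b c) : (u.comp v).writhe = u.writhe + v.writhe := by
  induction u with
  | nil => simp [comp, writhe]
  | cons p u ih => simp only [comp, writhe, ih]; ring

theorem turning_comp (u : Tangle a b) (v : Tangle b c) :
    (u.comp v).turning = u.turning + v.turning := by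
  induction u with
  | nil => simp [comp, turning]
  | cons p u ih => simp only [comp, turning, ih]; ring

theorem writhe_pow (w : Tangle a a) (n : ℕ) : (w.pow n).writhe = n * w.writhe := by
  induction n with
  | zero => simp [pow, writhe]
  | succ n ih => rw [pow, writhe_comp, ih]; push_cast; ring

theorem turning_pow (w : Tangle a a) (n : ℕ) : (w.pow n).turning = n * w.turning := by
  induction n with
  | zero => simp [pow, turning]
  | succ n ih => rw [pow, turning_comp, ih]; push_cast; ring

end Tangle

/-- Modulo a prime `r`, the `r ^ s`-th power of `t^{-k/2} - t^{k/2}` is divisible by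
`t ^ r ^ s - 1`. -/
theorem T_sub_T_pow_mem (r s : ℕ) (hr : r.Prime) (k : ℤ) :
    (T (-k) - T k : ℤ[T;T⁻¹]) ^ r ^ s ∈
      Ideal.span {(T 2 : ℤ[T;T⁻¹]) ^ r ^ s - 1, (r : ℤ[T;T⁻¹])} := by
  set I := Ideal.span {(T 2 : ℤ[T;T⁻¹]) ^ r ^ s - 1, (r : ℤ[T;T⁻¹])} with hI
  have hr' : (r : ℤ[T;T⁻¹]) ∈ I := Ideal.subset_span (by simp)
  have ht : (T 2 : ℤ[T;T⁻¹]) ^ r ^ s - 1 ∈ I := Ideal.subset_span (by simp)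
  -- With n = r^s, the difference is -T(-m)^n · (t^{nm} - 1).
  have hnat : ∀ m : ℕ, (T (-m) : ℤ[T;T⁻¹]) ^ r ^ s - T m ^ r ^ s ∈ I := by
    intro m
    have h1 : ((T 2 : ℤ[T;T⁻¹]) ^ r ^ s) ^ m - 1 ∈ I :=
      I.mem_of_dvd (by simpa using sub_dvd_pow_sub_pow ((T 2 : ℤ[T;T⁻¹]) ^ r ^ s) 1 m) ht
    have h2 := I.mul_mem_left (-(T (-m) : ℤ[T;T⁻¹]) ^ r ^ s) h1
    convert h2 using 1
    have h3 : (T (-m) : ℤ[T;T⁻¹]) ^ r ^ s * ((T 2 : ℤ[T;T⁻¹]) ^ r ^ s) ^ m = T m ^ r ^ s := by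
      rw [T_pow, T_pow, T_pow, T_pow, ← T_add]
      congr 1
      ring
    linear_combination h3
  have hdiff : (T (-k) : ℤ[T;T⁻¹]) ^ r ^ s - T k ^ r ^ s ∈ I := by
    obtain ⟨m, rfl | rfl⟩ := k.eq_nat_or_neg
    · exact hnat m
    · rw [neg_neg, ← neg_sub]
      exact I.neg_mem (hnat m)
  obtain ⟨c, hc⟩ := exists_add_pow_prime_pow_eq hr (T (-k) : ℤ[T;T⁻¹]) (-T k) s
  -- For odd r the sign passes through the power, and for r = 2 it does not matter modulo 2. The
  -- exponent 1, which is odd, must be treated apart when r = 2.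
  have hneg : (-T k : ℤ[T;T⁻¹]) ^ r ^ s + T k ^ r ^ s ∈ I := by
    rcases hr.eq_two_or_odd' with rfl | hodd
    · by_cases hs : s = 0
      · subst hs; simp
      · rw [Even.neg_pow ((Nat.even_pow' hs).mpr even_two), ← two_mul]
        exact I.mul_mem_right _ hr'
    · rw [Odd.neg_pow hodd.pow, neg_add_cancel]
      exact I.zero_mem
  rw [sub_eq_add_neg, hc]
  have := I.add_mem (I.add_mem hdiff hneg) (I.mul_mem_right (T (-k) * -T k * c) hr')
  convert this using 1
  ring

/-- `w` is a fundamental domain of a periodic diagram of `L`; `w'` arises from it by one crossing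
change, so that the diagrams of `L` and `L'` differ by changing one orbit of crossings. -/
theorem lemma4 (r s : ℕ) (hr : r.Prime) (hs : 0 < s) (q : ℤ) (a : List Bool)
    (w w' : Tangle a a) (h : Tangle.CrossingChange w w') :
    (w.periodicTwisted (r ^ s) (-q)).alexander - (w'.periodicTwisted (r ^ s) (-q)).alexander ∈
      Ideal.span {(LaurentPolynomial.T 2 : LaurentPolynomial ℤ) ^ r ^ s - 1,
        (r : LaurentPolynomial ℤ)} := by
  obtain ⟨c, d, u, p, p', v, hp, hw, hw', hwr, htu⟩ := h.exists_split
  obtain ⟨β, α, γ, hβ, hβ'⟩ := fullTwists_isBraid a (-q)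
  set I := Ideal.span {(T 2 : ℤ[T;T⁻¹]) ^ r ^ s - 1, (r : ℤ[T;T⁻¹])} with hI
  set τ := (Tangle.fullTwists a (-q)).toChain with hτ
  set X : Chain a a := u.comp (.cons (p.layer false) v) with hX
  set Y : Chain a a := u.comp (.cons (p'.layer false) v) with hY
  set S : Chain a a := u.comp (.cons (p.layer true) v) with hS
  -- The twists are kept out of the words: τ occurs once, outside the n-th power, and the trace
  -- property lets words rotate in its presence.
  set g : Chain a a → ℤ[T;T⁻¹] := fun x => (x.comp τ).net.nabla with hg
  have hcomm : ∀ x y, g (x * y) = g (y * x) := fun x y =>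
    Chain.nabla_comp_twist_comm hβ.peels hβ'.isTwist x y
  have hskein : ∀ ρ, T (-p.writhe) * g (X * ρ) =
      ∑ b : Bool, (if b then T p.writhe else T (-p.writhe) - T p.writhe) *
        g ((if b then Y else S) * ρ) := by
    intro ρ
    have h1 := hp.nabla_comp u ((v.comp ρ).comp τ)
    have h2 : ∀ L : Layer c d, ((u.comp (.cons L v) * ρ).comp τ) =
        u.comp (.cons L ((v.comp ρ).comp τ)) := by
      intro L
      rw [Chain.mul_eq_comp, Chain.comp_assoc, Chain.comp_assoc]
      simp only [Chain.comp, Chain.comp_assoc]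
    rw [← h2, ← h2, ← h2] at h1
    simp only [Fintype.sum_bool, if_true, Bool.false_eq_true, if_false]
    linear_combination h1
  have key := pow_mul_apply_pow_sub_mem g X (fun b => if b then Y else S) (T (-p.writhe))
    (fun b => if b then T p.writhe else T (-p.writhe) - T p.writhe) hr (s := s) hcomm hskein
  simp only [Fintype.sum_bool, if_true, Bool.false_eq_true, if_false] at key
  have hrI : Ideal.span {(r : ℤ[T;T⁻¹])} ≤ I := Ideal.span_mono (by simp)
  -- This removes the word S^n, the only surviving word besides Y^n.
  have hz := T_sub_T_pow_mem r s hr p.writhe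
  have hmem : T (-p.writhe) ^ r ^ s * g (X ^ r ^ s) - T p.writhe ^ r ^ s * g (Y ^ r ^ s) ∈ I := by
    have := I.add_mem (hrI key) (I.mul_mem_right (g (S ^ r ^ s)) hz)
    convert this using 1
    ring
  have halex : ∀ x : Tangle a a, (x.periodicTwisted (r ^ s) (-q)).alexander =
      T (winding a + (r ^ s : ℕ) * x.turning + (Tangle.fullTwists a (-q)).turning -
        ((r ^ s : ℕ) * x.writhe + (Tangle.fullTwists a (-q)).writhe)) * g (x.toChain ^ r ^ s) := by
    intro x
    rw [Tangle.alexander_eq, Tangle.rotation, Tangle.periodicTwisted, Tangle.writhe_comp,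
      Tangle.turning_comp, Tangle.writhe_pow, Tangle.turning_pow, Tangle.toChain_comp,
      Tangle.toChain_pow, add_assoc]
  -- The exponent uses the mean of the writhes of `w` and `w'`, since these are `w.writhe` and
  -- `w.writhe - 2 * p.writhe`. The factors T(∓p.writhe)^n in `hmem` then restore the normalization
  -- of each diagram.
  have hfin := I.mul_mem_left (T (winding a + (r ^ s : ℕ) * w.turning +
    (Tangle.fullTwists a (-q)).turning - ((r ^ s : ℕ) * (w.writhe - p.writhe) +
      (Tangle.fullTwists a (-q)).writhe))) hmem
  convert hfin using 1
  rw [halex, halex, hw, hw', hwr, htu, mul_sub (T _ : ℤ[T;T⁻¹]), ← mul_assoc, ← mul_assoc, T_pow, T_pow, ← T_add,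
    ← T_add]
  congr 3 <;> ring
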